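/- Let $N\ge 3$ be an integer, $\alpha\in(0,N)$, $p,q>1$ and $\gamma\in\mathbb R$. Let $$I_\alpha(x)=\frac{A_\alpha}{|x|^{N-\alpha}},\qquad A_\alpha=\frac{\Gamma\left(\frac{N-\alpha}{2}\right)}{\Gamma\left(\frac{\alpha}{2}\right)\pi^{N/2}2^{\alpha}},$$ be the Riesz kernel on $\mathbb R^N$, let $K(x)=(1+|x|^2)^{-\gamma/2}$, and consider the system $$\begin{cases}-\Delta u+u+K(x)\,\phi\,|u|^{q-2}u=(I_\alpha*|u|^p)\,|u|^{p-2}u & \text{in }\mathbb R^N,\\ -\Delta\phi=K(x)\,|u|^q & \text{in }\mathbb R^N,\end{cases}\tag{S}$$ for real-valued $u,\phi$, understood in the weak sense (tested against $C_c^\infty(\mathbb R^N)$, all terms being well defined and locally integrable). Assume that one of the following holds: 1. $0\le\gamma<\frac{N+2}{2}$, $\;p\ge\frac{N+\alpha}{N-2}\;$ and $\;\frac{N+\alpha}{p}\le\frac{N+2-2\gamma}{q}$; 2. $\gamma\le 0$, $\;p\le\frac{N+\alpha}{N}\;$ and $\;\frac{N+\alpha}{p}\ge\frac{N+2-2\gamma}{q}$.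 Then the only weak solution $(u,\phi)$ of (S) such that $$u\in H^1(\mathbb R^N)\cap L^{\frac{2Np}{N+\alpha}}(\mathbb R^N),\quad \phi\in H^1(\mathbb R^N),\quad K|u|^q\in L^{\frac{2N}{N+2}}(\mathbb R^N),\quad \nabla u\in H^1_{loc}(\mathbb R^N)\cap L^{\frac{2Np}{N+\alpha}}_{loc}(\mathbb R^N)$$ (where $\nabla u$ is the weak gradient of $u$, and membership in $H^1_{loc}$ is meant for each of its components) is the trivial one, $u=\phi=0$ almost everywhere. -/

import Mathlib

open MeasureTheory
open scoped ContDiff Gradient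

noncomputable section

namespace ChoquardPoisson

/-- The Euclidean space `ℝ^N`. -/
abbrev Space (N : ℕ) : Type := EuclideanSpace ℝ (Fin N)

/-- Test functions: the space `C_c^∞(ℝ^N)`. -/
structure IsTest {N : ℕ} (ψ : Space N → ℝ) : Prop where
  smooth : ContDiff ℝ ∞ ψ
  compact : HasCompactSupport ψ

/-- `G` is the weak (distributional) gradient of `u` on `ℝ^N`. The last field is the vector identity
`∫ u ∇ψ = - ∫ ψ G`, that is, `∫ u ∂ᵢψ = - ∫ Gᵢ ψ` for every coordinate `i`. -/
structure HasWeakGradient {N : ℕ} (u : Space N → ℝ) (G : Space N → Space N) : Prop where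
  locInt : LocallyIntegrable u
  locInt_grad : LocallyIntegrable G
  integral_eq : ∀ ψ : Space N → ℝ, IsTest ψ → ∫ x, u x • ∇ ψ x = -∫ x, ψ x • G x

/-- `f ∈ L^r_loc(ℝ^N)`: `f` is in `L^r(S)` for every compact set `S`. -/
def MemLpLoc {N : ℕ} {F : Type*} [NormedAddCommGroup F] (f : Space N → F) (r : ENNReal) : Prop :=
  ∀ S : Set (Space N), IsCompact S → MemLp f r (volume.restrict S)

/-- `u ∈ H^1(ℝ^N)`. -/
def MemH1 {N : ℕ} (u : Space N → ℝ) : Prop :=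
  MemLp u 2 ∧ ∃ G : Space N → Space N, HasWeakGradient u G ∧ MemLp G 2

/-- `u ∈ H^1_loc(ℝ^N)`. -/
def MemH1Loc {N : ℕ} (u : Space N → ℝ) : Prop :=
  MemLpLoc u 2 ∧ ∃ G : Space N → Space N, HasWeakGradient u G ∧ MemLpLoc G 2

/-- The Riesz kernel `I_α(x) = A_α / |x|^(N-α)`,
`A_α = Γ((N-α)/2) / (Γ(α/2) π^(N/2) 2^α)`. -/
def rieszKernel (N : ℕ) (α : ℝ) (x : Space N) : ℝ :=
  Real.Gamma (((N : ℝ) - α) / 2) / (Real.Gamma (α / 2) * Real.pi ^ ((N : ℝ) / 2) * 2 ^ α)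
    / ‖x‖ ^ ((N : ℝ) - α)

/-- The convolution `I_α * f`. -/
def rieszPotential {N : ℕ} (α : ℝ) (f : Space N → ℝ) (x : Space N) : ℝ :=
  ∫ y, rieszKernel N α (x - y) * f y

/-- The coefficient `K(x) = (1 + |x|²)^(-γ/2)`. -/
def weight {N : ℕ} (γ : ℝ) (x : Space N) : ℝ :=
  (1 + ‖x‖ ^ 2) ^ (-γ / 2)

/-- `(u, φ)` is a weak solution on `ℝ^N` of the system
`-Δu + u + K φ |u|^(q-2) u = (I_α * |u|^p) |u|^(p-2) u`, `-Δφ = K |u|^q`.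
All terms are required to make sense: `u`, `φ` have weak gradients, the integral that defines
`I_α * |u|^p` converges almost everywhere, and the nonlinear terms are in `L^1_loc`. -/
structure IsWeakSolution {N : ℕ} (α p q : ℝ) (K u φ : Space N → ℝ) : Prop where
  conv_exists : ∀ᵐ x : Space N, Integrable fun y => rieszKernel N α (x - y) * |u y| ^ p
  locInt_choquard : LocallyIntegrable fun x =>
    rieszPotential α (fun y => |u y| ^ p) x * |u x| ^ (p - 2) * u x
  locInt_coupling : LocallyIntegrable fun x => K x * φ x * |u x| ^ (q - 2) * u x
  locInt_source : LocallyIntegrable fun x => K x * |u x| ^ q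
  first_eq : ∃ G : Space N → Space N, HasWeakGradient u G ∧ ∀ ψ : Space N → ℝ, IsTest ψ →
    (∫ x, inner ℝ (G x) (∇ ψ x)) + (∫ x, u x * ψ x)
        + (∫ x, K x * φ x * |u x| ^ (q - 2) * u x * ψ x)
      = ∫ x, rieszPotential α (fun y => |u y| ^ p) x * |u x| ^ (p - 2) * u x * ψ x
  second_eq : ∃ H : Space N → Space N, HasWeakGradient φ H ∧ ∀ ψ : Space N → ℝ, IsTest ψ →
    ∫ x, inner ℝ (H x) (∇ ψ x) = ∫ x, K x * |u x| ^ q * ψ x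

/-- The regularity class:
`u ∈ H^1 ∩ L^(2Np/(N+α))`, `φ ∈ H^1`, `K |u|^q ∈ L^(2N/(N+2))`, and
`∇u ∈ H^1_loc ∩ L^(2Np/(N+α))_loc`, where `∇u` is the weak gradient of `u`. -/
structure IsRegular {N : ℕ} (α p q : ℝ) (K u φ : Space N → ℝ) : Prop where
  u_H1 : MemH1 u
  u_Lp : MemLp u (ENNReal.ofReal (2 * N * p / (N + α)))
  phi_H1 : MemH1 φ
  source_Lp : MemLp (fun x => K x * |u x| ^ q) (ENNReal.ofReal (2 * N / (N + 2)))
  grad_u : ∃ G : Space N → Space N, HasWeakGradient u G ∧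
    (∀ i : Fin N, MemH1Loc fun x => G x i) ∧
    MemLpLoc G (ENNReal.ofReal (2 * N * p / (N + α)))

end ChoquardPoisson

end

/-!
Pohozaev's argument. Write `S = K |u|^q`. Since `φ` and `∇φ` are square integrable, the second
equation forces `φ` to be a positive multiple of the Newton potential of `S`. Testing the first
equation with `u` and with the dilation field `x · ∇u` (both through cutoffs) gives two identities
between `∫ |∇u|²`, `∫ u²`, `∫ φ S`, `∫ φ S |x|² / (1 + |x|²)` and the Choquard energy
`∫ (I_α * |u|^p) |u|^p`. The nonlocal terms are handled by one formula: for `|x|^(-s) * F`,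
symmetrizing the double integral turns `x · ∇` into `(x - y) · ∇`, whose adjoint sees only the
homogeneity of the kernel. Testing with `x · ∇u` requires `|u|^(q-2) u ∇u` to be locally integrable;
this is read off the equation itself, because a nonzero Newton potential is bounded below on balls.

Eliminating the Choquard energy leaves
`(2 - N + (N+α)/p) ∫ |∇u|² + ((N+α)/p - N) ∫ u² + ((N+α)/p - (N+2)/q) ∫ φ S
  + (2γ/q) ∫ φ S |x|² / (1 + |x|²) = 0`.
The last integral lies between `0` and `∫ φ S`, so in either range of parameters all contributions
have the same sign, and the first or second one has a nonzero coefficient.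
-/

noncomputable section

namespace ChoquardPoisson

open Filter Topology Metric Set Function
open Module (finrank)
open scoped Convolution

variable {N : ℕ}

/-! ### Test functions -/

namespace IsTest

variable {ψ : Space N → ℝ}

lemma continuous (h : IsTest ψ) : Continuous ψ := h.smooth.continuous

lemma differentiable (h : IsTest ψ) : Differentiable ℝ ψ :=
  h.smooth.differentiable (by simp)

lemma continuous_fderiv (h : IsTest ψ) : Continuous (fderiv ℝ ψ) :=
  h.smooth.continuous_fderiv (by simp)

lemma mul_left (h : IsTest ψ) {g : Space N → ℝ} (hg : ContDiff ℝ ∞ g) :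
    IsTest fun x => g x * ψ x :=
  ⟨hg.mul h.smooth, h.compact.mul_left⟩

lemma mul_right (h : IsTest ψ) {g : Space N → ℝ} (hg : ContDiff ℝ ∞ g) :
    IsTest fun x => ψ x * g x :=
  ⟨h.smooth.mul hg, h.compact.mul_right⟩

lemma fderiv_apply (h : IsTest ψ) (v : Space N) : IsTest fun x => fderiv ℝ ψ x v :=
  ⟨(h.smooth.fderiv_right (m := ∞) (by simp)).clm_apply contDiff_const, h.compact.fderiv_apply ℝ v⟩

lemma comp_sub_left (h : IsTest ψ) (a : Space N) : IsTest fun x => ψ (a - x) :=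
  ⟨h.smooth.comp (contDiff_const.sub contDiff_id),
    h.compact.comp_homeomorph (Homeomorph.subLeft a)⟩

lemma integrable_mul (h : IsTest ψ) {f : Space N → ℝ} (hf : LocallyIntegrable f) :
    Integrable fun x => f x * ψ x := by
  simpa [mul_comm] using
    hf.integrable_smul_left_of_hasCompactSupport h.continuous h.compact

lemma integrable (h : IsTest ψ) : Integrable ψ :=
  h.continuous.integrable_of_hasCompactSupport h.compact

lemma memLp (h : IsTest ψ) (r : ENNReal) : MemLp ψ r :=
  h.continuous.memLp_of_hasCompactSupport h.compact

lemma exists_bound (h : IsTest ψ) : ∃ C, 0 ≤ C ∧ ∀ x, |ψ x| ≤ C := by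
  obtain ⟨C, hC⟩ := h.compact.exists_bound_of_continuous h.continuous
  exact ⟨C, (norm_nonneg _).trans (hC 0), hC⟩

end IsTest

/-! ### Mollification -/

section Mollification

variable {E : Type*} [NormedAddCommGroup E]

variable (E) in
/-- A sequence of bump functions whose supports shrink to the origin. The ratio of the two radii
is constant, as the Lebesgue differentiation theorem requires. -/
def mollifier (n : ℕ) : ContDiffBump (0 : E) where
  rIn := 1 / (2 * ((n : ℝ) + 1))
  rOut := 1 / ((n : ℝ) + 1)
  rIn_pos := by positivity
  rIn_lt_rOut := by
    apply one_div_lt_one_div_of_lt <;> nlinarith [(n.cast_nonneg : (0 : ℝ) ≤ n)]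

lemma mollifier_rOut_le_one (n : ℕ) : (mollifier E n).rOut ≤ 1 :=
  div_le_one_of_le₀ (by linarith [(n.cast_nonneg : (0 : ℝ) ≤ n)]) (by positivity)

lemma tendsto_mollifier_rOut : Tendsto (fun n => (mollifier E n).rOut) atTop (𝓝 0) :=
  tendsto_one_div_add_atTop_nhds_zero_nat

variable {F : Type*} [NormedAddCommGroup F] [NormedSpace ℝ F]
  [NormedSpace ℝ E] [FiniteDimensional ℝ E] [MeasurableSpace E] [BorelSpace E] {μ : Measure E}

variable (μ) in
/-- The mollification of `f` at scale `1 / (n + 1)`, with respect to the measure `μ`. -/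
def mollify (n : ℕ) (f : E → F) : E → F :=
  (mollifier E n).normed μ ⋆[ContinuousLinearMap.lsmul ℝ ℝ, μ] f

variable [μ.IsAddHaarMeasure] {f g : E → F}

lemma mollify_apply (n : ℕ) (f : E → F) (x : E) :
    mollify μ n f x = ∫ t, (mollifier E n).normed μ (x - t) • f t ∂μ := by
  rw [mollify, convolution_eq_swap]
  rfl

lemma contDiff_mollify (n : ℕ) (hf : LocallyIntegrable f μ) :
    ContDiff ℝ ∞ (mollify μ n f) :=
  (ContDiffBump.hasCompactSupport_normed _).contDiff_convolution_left _
    (ContDiffBump.contDiff_normed _) hf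

lemma ae_tendsto_mollify [CompleteSpace F] (hf : LocallyIntegrable f μ) :
    ∀ᵐ x ∂μ, Tendsto (fun n => mollify μ n f x) atTop (𝓝 (f x)) := by
  refine ContDiffBump.ae_convolution_tendsto_right_of_locallyIntegrable (K := 2)
    tendsto_mollifier_rOut (Eventually.of_forall fun n => le_of_eq ?_) hf
  change 1 / ((n : ℝ) + 1) = 2 * (1 / (2 * ((n : ℝ) + 1)))
  field_simp

lemma mollify_sub (n : ℕ) (hf : LocallyIntegrable f μ) (hg : LocallyIntegrable g μ) :
    mollify μ n (f - g) = mollify μ n f - mollify μ n g := by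
  have exists_conv : ∀ {h : E → F}, LocallyIntegrable h μ →
      ConvolutionExists ((mollifier E n).normed μ) h (ContinuousLinearMap.lsmul ℝ ℝ) μ := fun hh =>
    (ContDiffBump.hasCompactSupport_normed _).convolutionExists_left _
      (ContDiffBump.continuous_normed _) hh
  ext x
  simp only [mollify, convolution, Pi.sub_apply, map_sub]
  exact integral_sub (exists_conv hf x) (exists_conv hg x)

lemma norm_mollify_sub_le (n : ℕ) (hf : LocallyIntegrable f μ) (hg : LocallyIntegrable g μ)
    (x : E) : ‖mollify μ n f x - f x‖
      ≤ ‖mollify μ n (f - g) x‖ + ‖mollify μ n g x - g x‖ + ‖f x - g x‖ := by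
  have decomposition : mollify μ n f x - f x
      = mollify μ n (f - g) x + (mollify μ n g x - g x) + (g x - f x) := by
    rw [mollify_sub n hf hg, Pi.sub_apply]
    abel
  rw [decomposition, norm_sub_rev (f x) (g x)]
  exact norm_add₃_le

lemma mollify_congr_of_ball (n : ℕ) {x : E} (h : ∀ t ∈ ball x 1, f t = g t) :
    mollify μ n f x = mollify μ n g x := by
  simp only [mollify_apply]
  refine integral_congr_ae (Eventually.of_forall fun t => ?_)
  by_cases ht : t ∈ ball x 1
  · simp only [h t ht]
  · have : x - t ∉ support ((mollifier E n).normed μ) := by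
      rw [ContDiffBump.support_normed_eq, mem_ball, dist_zero_right, not_lt, ← dist_eq_norm,
        dist_comm]
      exact (mollifier_rOut_le_one n).trans (not_lt.1 ht)
    simp [notMem_support.1 this]

lemma integrable_mollify (n : ℕ) (hf : Integrable f μ) : Integrable (mollify μ n f) μ :=
  (ContDiffBump.integrable_normed _).integrable_convolution _ hf

lemma integral_norm_mollify_le (n : ℕ) (hf : Integrable f μ) :
    ∫ x, ‖mollify μ n f x‖ ∂μ ≤ ∫ x, ‖f x‖ ∂μ := by
  have integral_eq : ∫ x, mollify μ n (fun y => ‖f y‖) x ∂μ = ∫ x, ‖f x‖ ∂μ := by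
    unfold mollify
    rw [integral_convolution (ContinuousLinearMap.lsmul ℝ ℝ) (ContDiffBump.integrable_normed _)
      hf.norm, ContDiffBump.integral_normed]
    simp
  rw [← integral_eq]
  refine integral_mono (integrable_mollify n hf).norm (integrable_mollify n hf.norm) fun x => ?_
  simp only [mollify_apply]
  refine (norm_integral_le_integral_norm _).trans_eq
    (integral_congr_ae (Eventually.of_forall fun t => ?_))
  simp only [norm_smul, Real.norm_of_nonneg (ContDiffBump.nonneg_normed _ _), smul_eq_mul]

lemma tendstoUniformly_mollify [CompleteSpace F] (hg : UniformContinuous g) :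
    TendstoUniformly (fun n => mollify μ n g) g atTop := by
  rw [Metric.tendstoUniformly_iff]
  intro ε hε
  obtain ⟨δ, hδ, hgδ⟩ := Metric.uniformContinuous_iff.1 hg (ε / 2) (half_pos hε)
  filter_upwards [(tendsto_mollifier_rOut (E := E)).eventually_lt_const hδ] with n hn x
  rw [dist_comm]
  exact (ContDiffBump.dist_normed_convolution_le hg.continuous.aestronglyMeasurable fun y hy =>
    (hgδ ((mem_ball.1 hy).trans hn)).le).trans_lt (half_lt_self hε)

lemma tendsto_setIntegral_norm_mollify_sub_of_uniformContinuous [CompleteSpace F]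
    (hg : UniformContinuous g) {S : Set E} (hS : μ S ≠ ⊤) :
    Tendsto (fun n => ∫ x in S, ‖mollify μ n g x - g x‖ ∂μ) atTop (𝓝 0) := by
  rw [Metric.tendsto_atTop]
  intro ε hε
  set δ := ε / (μ.real S + 1)
  have hδ : 0 < δ := by positivity
  obtain ⟨n₀, hn₀⟩ := eventually_atTop.1 (Metric.tendstoUniformly_iff.1
    (tendstoUniformly_mollify (μ := μ) hg) δ hδ)
  refine ⟨n₀, fun n hn => ?_⟩
  rw [dist_zero_right]
  calc ‖∫ x in S, ‖mollify μ n g x - g x‖ ∂μ‖ ≤ δ * μ.real S := by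
        refine norm_setIntegral_le_of_norm_le_const hS.lt_top fun x _ => ?_
        rw [norm_norm, ← dist_eq_norm, dist_comm]
        exact (hn₀ n hn x).le
    _ < δ * (μ.real S + 1) := by gcongr; linarith
    _ = ε := div_mul_cancel₀ _ (by positivity)

lemma tendsto_setIntegral_norm_mollify_sub_of_integrable [CompleteSpace F] (hf : Integrable f μ)
    {S : Set E} (hS : μ S ≠ ⊤) :
    Tendsto (fun n => ∫ x in S, ‖mollify μ n f x - f x‖ ∂μ) atTop (𝓝 0) := by
  rw [Metric.tendsto_atTop]
  intro ε hε
  obtain ⟨g, hgc, hfg, hg, hgi⟩ := hf.exists_hasCompactSupport_integral_sub_le (ε := ε / 3)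
    (by positivity)
  obtain ⟨n₀, hn₀⟩ := Metric.tendsto_atTop.1
    (tendsto_setIntegral_norm_mollify_sub_of_uniformContinuous (μ := μ)
      (hgc.uniformContinuous_of_continuous hg) hS) (ε / 3) (by positivity)
  refine ⟨n₀, fun n hn => ?_⟩
  have hn := hn₀ n hn
  rw [Real.dist_0_eq_abs, abs_of_nonneg (integral_nonneg fun _ => norm_nonneg _)] at hn ⊢
  have i₁ : Integrable (fun x => ‖mollify μ n (f - g) x‖) μ :=
    (integrable_mollify n (hf.sub hgi)).norm
  have i₂ : Integrable (fun x => ‖mollify μ n g x - g x‖) μ :=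
    ((integrable_mollify n hgi).sub hgi).norm
  have i₃ : Integrable (fun x => ‖f x - g x‖) μ := (hf.sub hgi).norm
  have i₁₂ : Integrable (fun x => ‖mollify μ n (f - g) x‖ + ‖mollify μ n g x - g x‖) μ :=
    i₁.add i₂
  calc ∫ x in S, ‖mollify μ n f x - f x‖ ∂μ
      ≤ ∫ x in S, (‖mollify μ n (f - g) x‖ + ‖mollify μ n g x - g x‖ + ‖f x - g x‖) ∂μ :=
        integral_mono ((integrable_mollify n hf).sub hf).norm.restrict (i₁₂.add i₃).restrict
          (norm_mollify_sub_le n hf.locallyIntegrable hgi.locallyIntegrable)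
    _ = (∫ x in S, ‖mollify μ n (f - g) x‖ ∂μ) + (∫ x in S, ‖mollify μ n g x - g x‖ ∂μ)
        + ∫ x in S, ‖f x - g x‖ ∂μ := by
        rw [integral_add i₁₂.restrict i₃.restrict, integral_add i₁.restrict i₂.restrict]
    _ ≤ (∫ x, ‖f x - g x‖ ∂μ) + (∫ x in S, ‖mollify μ n g x - g x‖ ∂μ) + ∫ x, ‖f x - g x‖ ∂μ :=
        add_le_add (add_le_add_left
          ((setIntegral_le_integral i₁ (Eventually.of_forall fun _ => norm_nonneg _)).trans
            (integral_norm_mollify_le n (hf.sub hgi))) _)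
          (setIntegral_le_integral i₃ (Eventually.of_forall fun _ => norm_nonneg _))
    _ < ε := by linarith

lemma tendsto_setIntegral_norm_mollify_sub [CompleteSpace F] (hf : LocallyIntegrable f μ)
    {S : Set E} (hS : IsCompact S) :
    Tendsto (fun n => ∫ x in S, ‖mollify μ n f x - f x‖ ∂μ) atTop (𝓝 0) := by
  have hf' : Integrable ((cthickening 1 S).indicator f) μ := by
    rw [integrable_indicator_iff isClosed_cthickening.measurableSet]
    exact hf.integrableOn_isCompact hS.cthickening
  refine (tendsto_setIntegral_norm_mollify_sub_of_integrable hf' hS.measure_ne_top).congr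
    fun n => setIntegral_congr_fun hS.measurableSet fun x hx => ?_
  have hball : ∀ t ∈ ball x 1, (cthickening 1 S).indicator f t = f t := fun t ht =>
    indicator_of_mem (mem_cthickening_of_dist_le t x 1 S hx (mem_ball.1 ht).le) f
  simp only [mollify_congr_of_ball n hball, hball x (mem_ball_self one_pos)]

end Mollification

/-! ### Weak directional derivatives -/

/-- `g` is the weak derivative of `f` in the direction `v`. -/
structure HasWeakDeriv (v : Space N) (f g : Space N → ℝ) : Prop where
  locInt : LocallyIntegrable f
  locInt_deriv : LocallyIntegrable g
  integral_eq : ∀ ψ : Space N → ℝ, IsTest ψ →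
    ∫ x, f x * fderiv ℝ ψ x v = -∫ x, g x * ψ x

lemma IsTest.continuous_gradient {ψ : Space N → ℝ} (h : IsTest ψ) : Continuous (∇ ψ) :=
  (InnerProductSpace.toDual ℝ (Space N)).symm.continuous.comp h.continuous_fderiv

lemma IsTest.compact_gradient {ψ : Space N → ℝ} (h : IsTest ψ) : HasCompactSupport (∇ ψ) :=
  (h.compact.fderiv ℝ).comp_left (g := (InnerProductSpace.toDual ℝ (Space N)).symm) (by simp)

lemma HasWeakGradient.hasWeakDeriv {u : Space N → ℝ} {G : Space N → Space N}
    (h : HasWeakGradient u G) (v : Space N) : HasWeakDeriv v u fun x => inner ℝ (G x) v := by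
  refine ⟨h.locInt, fun x => (h.locInt_grad x).imp fun _ hs => ⟨hs.1, hs.2.inner_const v⟩,
    fun ψ hψ => ?_⟩
  have integrable_left : Integrable fun x => u x • ∇ ψ x :=
    h.locInt.integrable_smul_right_of_hasCompactSupport hψ.continuous_gradient hψ.compact_gradient
  have integrable_right : Integrable fun x => ψ x • G x :=
    h.locInt_grad.integrable_smul_left_of_hasCompactSupport hψ.continuous hψ.compact
  have inner_eq := congrArg (fun w => inner ℝ v w) (h.integral_eq ψ hψ)
  simp only [inner_neg_right] at inner_eq
  rw [← integral_inner integrable_left, ← integral_inner integrable_right] at inner_eq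
  simpa only [inner_smul_right, inner_gradient_right, conj_trivial, real_inner_comm,
    mul_comm (ψ _)] using inner_eq

namespace HasWeakDeriv

variable {v : Space N} {f g f' g' : Space N → ℝ}

lemma ae_unique (h : HasWeakDeriv v f g) (h' : HasWeakDeriv v f g') : g =ᵐ[volume] g' := by
  refine ae_eq_of_integral_contDiff_smul_eq h.locInt_deriv h'.locInt_deriv fun ψ hψ hc => ?_
  simp only [smul_eq_mul, mul_comm (ψ _)]
  exact neg_injective ((h.integral_eq ψ ⟨hψ, hc⟩).symm.trans (h'.integral_eq ψ ⟨hψ, hc⟩))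

lemma congr_right (h : HasWeakDeriv v f g) (e : g =ᵐ[volume] g') : HasWeakDeriv v f g' := by
  refine ⟨h.locInt, h.locInt_deriv.congr e, fun ψ hψ => ?_⟩
  rw [h.integral_eq ψ hψ]
  exact congrArg Neg.neg (integral_congr_ae (e.mono fun x hx => by simp only [hx]))

lemma add (h : HasWeakDeriv v f f') (k : HasWeakDeriv v g g') :
    HasWeakDeriv v (fun x => f x + g x) fun x => f' x + g' x := by
  refine ⟨h.locInt.add k.locInt, h.locInt_deriv.add k.locInt_deriv, fun ψ hψ => ?_⟩
  simp only [add_mul]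
  rw [integral_add ((hψ.fderiv_apply v).integrable_mul h.locInt)
    ((hψ.fderiv_apply v).integrable_mul k.locInt), integral_add
    (hψ.integrable_mul h.locInt_deriv) (hψ.integrable_mul k.locInt_deriv),
    h.integral_eq ψ hψ, k.integral_eq ψ hψ]
  ring

lemma const_mul (h : HasWeakDeriv v f f') (c : ℝ) :
    HasWeakDeriv v (fun x => c * f x) fun x => c * f' x := by
  refine ⟨h.locInt.smul c, h.locInt_deriv.smul c, fun ψ hψ => ?_⟩
  simp only [mul_assoc]
  rw [integral_const_mul, integral_const_mul, h.integral_eq ψ hψ]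
  ring

lemma sub (h : HasWeakDeriv v f f') (k : HasWeakDeriv v g g') :
    HasWeakDeriv v (fun x => f x - g x) fun x => f' x - g' x := by
  simpa [sub_eq_add_neg] using h.add (k.const_mul (-1))

lemma mul_smooth (h : HasWeakDeriv v f f') {η : Space N → ℝ} (hη : ContDiff ℝ ∞ η) :
    HasWeakDeriv v (fun x => η x * f x) fun x => η x * f' x + fderiv ℝ η x v * f x := by
  have locInt_mul : LocallyIntegrable fun x => η x * f x := h.locInt.continuous_mul hη.continuous
  have locInt_mul_deriv : LocallyIntegrable fun x => η x * f' x :=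
    h.locInt_deriv.continuous_mul hη.continuous
  have locInt_fderiv_mul : LocallyIntegrable fun x => fderiv ℝ η x v * f x :=
    h.locInt.continuous_mul ((hη.continuous_fderiv (by simp)).clm_apply continuous_const)
  refine ⟨locInt_mul, locInt_mul_deriv.add locInt_fderiv_mul, fun ψ hψ => ?_⟩
  have leibniz : ∀ x, f x * fderiv ℝ (fun x => η x * ψ x) x v
      = η x * f x * fderiv ℝ ψ x v + fderiv ℝ η x v * f x * ψ x := by
    intro x
    rw [fderiv_fun_mul (hη.differentiable (by simp) x) (hψ.differentiable x)]
    simp only [add_apply, smul_apply, smul_eq_mul]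
    ring
  have tested := h.integral_eq _ (hψ.mul_left hη)
  simp only [leibniz] at tested
  rw [integral_add ((hψ.fderiv_apply v).integrable_mul locInt_mul)
    (hψ.integrable_mul locInt_fderiv_mul)] at tested
  simp only [add_mul]
  rw [integral_add (hψ.integrable_mul locInt_mul_deriv) (hψ.integrable_mul locInt_fderiv_mul)]
  have rearranged : ∫ x, η x * f' x * ψ x = ∫ x, f' x * (η x * ψ x) := by
    congr 1 with x
    ring
  rw [rearranged]
  linarith

open ContinuousLinearMap (lsmul precompL_apply) in
lemma fderiv_mollify (h : HasWeakDeriv v f f') (n : ℕ) (x : Space N) :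
    fderiv ℝ (mollify volume n f) x v = mollify volume n f' x := by
  set ρ := (mollifier (Space N) n).normed volume
  have hρ : IsTest ρ := ⟨ContDiffBump.contDiff_normed _, ContDiffBump.hasCompactSupport_normed _⟩
  have fderiv_eq : fderiv ℝ (mollify volume n f) x
      = (fderiv ℝ ρ ⋆[(lsmul ℝ ℝ).precompL (Space N), volume] f) x :=
    (hρ.compact.hasFDerivAt_convolution_left (lsmul ℝ ℝ) (hρ.smooth.of_le (by simp))
      h.locInt x).fderiv
  have exists_convolution :
      ConvolutionExistsAt (fderiv ℝ ρ) f x ((lsmul ℝ ℝ).precompL (Space N)) volume :=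
    (hρ.compact.fderiv ℝ).convolutionExists_left _ hρ.continuous_fderiv h.locInt x
  have fderiv_comp_sub : ∀ t, fderiv ℝ (fun t => ρ (x - t)) t v = -fderiv ℝ ρ (x - t) v := by
    intro t
    have := (hρ.differentiable (x - t)).hasFDerivAt.comp t ((hasFDerivAt_id t).const_sub x)
    rw [HasFDerivAt.fderiv (f := fun t => ρ (x - t)) this]
    simp
  calc fderiv ℝ (mollify volume n f) x v
      = ∫ t, ((lsmul ℝ ℝ).precompL (Space N) (fderiv ℝ ρ (x - t)) (f t)) v := by
        rw [fderiv_eq, convolution_eq_swap,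
          ContinuousLinearMap.integral_apply exists_convolution.integrable_swap]
    _ = -∫ t, f t * fderiv ℝ (fun t => ρ (x - t)) t v := by
        rw [← integral_neg]
        simp [fderiv_comp_sub, precompL_apply, mul_comm]
    _ = ∫ t, f' t * ρ (x - t) := neg_eq_iff_eq_neg.2 (h.integral_eq _ (hρ.comp_sub_left x))
    _ = mollify volume n f' x := by simp only [mollify_apply, smul_eq_mul, mul_comm, ρ]

end HasWeakDeriv

/-! ### The chain rule and products -/

lemma hasWeakDeriv_of_differentiable {v : Space N} {F : Space N → ℝ} (hF : Differentiable ℝ F)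
    (hF' : Continuous fun x => fderiv ℝ F x v) : HasWeakDeriv v F fun x => fderiv ℝ F x v where
  locInt := hF.continuous.locallyIntegrable
  locInt_deriv := hF'.locallyIntegrable
  integral_eq _ hψ := integral_mul_fderiv_eq_neg_fderiv_mul_of_integrable
    (hψ.integrable_mul hF'.locallyIntegrable)
    ((hψ.fderiv_apply v).integrable_mul hF.continuous.locallyIntegrable)
    (hψ.integrable_mul hF.continuous.locallyIntegrable)
    (fun x _ => hF x) (fun x _ => hψ.differentiable x)

lemma tendsto_integral_norm_mul_sub {X : Type*} [MeasurableSpace X] {μ : Measure X} {L : ℝ}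
    {a g : ℕ → X → ℝ} {A G : X → ℝ} (ha : ∀ n, AEStronglyMeasurable (a n) μ)
    (haL : ∀ n x, ‖a n x‖ ≤ L) (haA : ∀ᵐ x ∂μ, Tendsto (fun n => a n x) atTop (𝓝 (A x)))
    (hg : ∀ n, Integrable (g n) μ) (hG : Integrable G μ)
    (hgG : Tendsto (fun n => ∫ x, ‖g n x - G x‖ ∂μ) atTop (𝓝 0)) :
    Tendsto (fun n => ∫ x, ‖a n x * g n x - A x * G x‖ ∂μ) atTop (𝓝 0) := by
  have hA : AEStronglyMeasurable A μ := aestronglyMeasurable_of_tendsto_ae atTop ha haA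
  have haL' : ∀ n, ∀ᵐ x ∂μ, ‖a n x‖ ≤ L := fun n => Eventually.of_forall (haL n)
  have hAL : ∀ᵐ x ∂μ, ‖A x‖ ≤ L := haA.mono fun x hx =>
    le_of_tendsto hx.norm (Eventually.of_forall fun n => haL n x)
  have integrable_coeff : ∀ n, Integrable (fun x => ‖(a n x - A x) * G x‖) μ := fun n =>
    ((hG.bdd_mul (ha n) (haL' n)).sub (hG.bdd_mul hA hAL)).norm.congr
      (Eventually.of_forall fun x => by simp only [Pi.sub_apply, sub_mul])
  have tendsto_coeff : Tendsto (fun n => ∫ x, ‖(a n x - A x) * G x‖ ∂μ) atTop (𝓝 0) := by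
    rw [← integral_zero X ℝ (μ := μ)]
    refine tendsto_integral_of_dominated_convergence (fun x => 2 * L * ‖G x‖)
      (fun n => (integrable_coeff n).aestronglyMeasurable) (hG.norm.const_mul _) (fun n => ?_) ?_
    · filter_upwards [hAL] with x hx
      rw [norm_norm, norm_mul]
      exact mul_le_mul_of_nonneg_right ((norm_sub_le _ _).trans (by linarith [haL n x]))
        (norm_nonneg _)
    · filter_upwards [haA] with x hx
      simpa using ((tendsto_sub_nhds_zero_iff.2 hx).mul_const (G x)).norm
  refine squeeze_zero (fun n => integral_nonneg fun _ => norm_nonneg _) (fun n => ?_)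
    (by simpa only [mul_zero, add_zero] using (hgG.const_mul L).add tendsto_coeff)
  have integrable_diff : Integrable (fun x => L * ‖g n x - G x‖) μ :=
    ((hg n).sub hG).norm.const_mul L
  rw [← integral_const_mul, ← integral_add integrable_diff (integrable_coeff n)]
  refine integral_mono_of_nonneg (Eventually.of_forall fun _ => norm_nonneg _)
    (integrable_diff.add (integrable_coeff n)) (Eventually.of_forall fun x => ?_)
  calc ‖a n x * g n x - A x * G x‖ = ‖a n x * (g n x - G x) + (a n x - A x) * G x‖ := by ring_nf
    _ ≤ ‖a n x * (g n x - G x)‖ + ‖(a n x - A x) * G x‖ := norm_add_le _ _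
    _ ≤ L * ‖g n x - G x‖ + ‖(a n x - A x) * G x‖ := by
      rw [norm_mul]
      gcongr
      exact haL n x

lemma IsTest.tendsto_integral_mul {ψ : Space N → ℝ} (hψ : IsTest ψ) {F : ℕ → Space N → ℝ}
    {G : Space N → ℝ} (hF : ∀ n, LocallyIntegrable (F n)) (hG : LocallyIntegrable G)
    (h : Tendsto (fun n => ∫ x in tsupport ψ, ‖F n x - G x‖) atTop (𝓝 0)) :
    Tendsto (fun n => ∫ x, F n x * ψ x) atTop (𝓝 (∫ x, G x * ψ x)) := by
  rw [← tendsto_sub_nhds_zero_iff]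
  obtain ⟨C, -, hC⟩ := hψ.exists_bound
  refine squeeze_zero_norm (fun n => ?_) (by simpa using h.const_mul C)
  calc ‖(∫ x, F n x * ψ x) - ∫ x, G x * ψ x‖ = ‖∫ x in tsupport ψ, (F n x - G x) * ψ x‖ := by
        rw [← integral_sub (hψ.integrable_mul (hF n)) (hψ.integrable_mul hG),
          setIntegral_eq_integral_of_forall_compl_eq_zero fun x hx => by
            rw [image_eq_zero_of_notMem_tsupport hx, mul_zero]]
        simp only [sub_mul]
    _ ≤ ∫ x in tsupport ψ, C * ‖F n x - G x‖ := by
        refine norm_integral_le_of_norm_le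
          ((((hF n).sub hG).integrableOn_isCompact hψ.compact).norm.const_mul C)
          (Eventually.of_forall fun x => ?_)
        rw [norm_mul, mul_comm]
        exact mul_le_mul_of_nonneg_right (hC x) (norm_nonneg _)
    _ = C * ∫ x in tsupport ψ, ‖F n x - G x‖ := integral_const_mul _ _

lemma IsTest.tendsto_integral_mul_of_dominated {ψ : Space N → ℝ} (hψ : IsTest ψ)
    {F : ℕ → Space N → ℝ} {G : Space N → ℝ} (hF : ∀ n, LocallyIntegrable (F n))
    (hG : LocallyIntegrable G) (hFG : ∀ n x, |F n x| ≤ |G x|)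
    (h : ∀ x, Tendsto (fun n => F n x) atTop (𝓝 (G x))) :
    Tendsto (fun n => ∫ x, F n x * ψ x) atTop (𝓝 (∫ x, G x * ψ x)) := by
  refine tendsto_integral_of_dominated_convergence (fun x => |G x * ψ x|)
    (fun n => (hψ.integrable_mul (hF n)).aestronglyMeasurable) (hψ.integrable_mul hG).abs
    (fun n => Eventually.of_forall fun x => ?_)
    (Eventually.of_forall fun x => (h x).mul_const _)
  rw [Real.norm_eq_abs, abs_mul, abs_mul]
  exact mul_le_mul_of_nonneg_right (hFG n x) (abs_nonneg _)

namespace HasWeakDeriv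

variable {v : Space N} {f f' g g' : Space N → ℝ} {h : ℝ → ℝ}

lemma of_tendsto {F F' : ℕ → Space N → ℝ} (hF : ∀ n, HasWeakDeriv v (F n) (F' n))
    (hf : LocallyIntegrable f) (hf' : LocallyIntegrable f')
    (h : ∀ ψ, IsTest ψ → Tendsto (fun n => ∫ x, F n x * ψ x) atTop (𝓝 (∫ x, f x * ψ x)))
    (h' : ∀ ψ, IsTest ψ → Tendsto (fun n => ∫ x, F' n x * ψ x) atTop (𝓝 (∫ x, f' x * ψ x))) :
    HasWeakDeriv v f f' := by
  refine ⟨hf, hf', fun ψ hψ => tendsto_nhds_unique (h _ (hψ.fderiv_apply v)) ?_⟩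
  simp only [(hF _).integral_eq ψ hψ]
  exact (h' ψ hψ).neg

lemma locallyIntegrable_comp (hf : LocallyIntegrable f) (hh : Differentiable ℝ h) {L : ℝ}
    (hL : ∀ t, ‖deriv h t‖ ≤ L) : LocallyIntegrable fun x => h (f x) := by
  refine (locallyIntegrable_iff.2 fun S hS => ?_ :
    LocallyIntegrable fun x => |h 0| + L * |f x|).mono
    (hh.continuous.comp_aestronglyMeasurable hf.aestronglyMeasurable)
    (Eventually.of_forall fun x => ?_)
  · exact (integrableOn_const hS.measure_ne_top).add
      ((hf.integrableOn_isCompact hS).abs.const_mul L)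
  · have growth : ‖h (f x) - h 0‖ ≤ L * ‖f x - 0‖ :=
      convex_univ.norm_image_sub_le_of_norm_deriv_le (fun t _ => hh t) (fun t _ => hL t)
        (mem_univ _) (mem_univ _)
    rw [sub_zero] at growth
    calc ‖h (f x)‖ ≤ ‖h 0‖ + ‖h (f x) - h 0‖ := norm_le_norm_add_norm_sub' _ _
      _ ≤ |h 0| + L * |f x| := add_le_add le_rfl growth
      _ ≤ ‖|h 0| + L * |f x|‖ := Real.le_norm_self _

lemma locallyIntegrable_deriv_comp_mul (hf : LocallyIntegrable f) (hf' : LocallyIntegrable f')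
    (hh : ContDiff ℝ 1 h) {L : ℝ} (hL : ∀ t, ‖deriv h t‖ ≤ L) :
    LocallyIntegrable fun x => deriv h (f x) * f' x :=
  (hf'.smul L).mono
    ((hh.continuous_deriv_one.comp_aestronglyMeasurable hf.aestronglyMeasurable).mul
      hf'.aestronglyMeasurable)
    (Eventually.of_forall fun x => by
      simp only [Pi.smul_apply, smul_eq_mul, norm_mul]
      exact mul_le_mul_of_nonneg_right ((hL _).trans (Real.le_norm_self L)) (norm_nonneg _))

lemma comp_mollify (hf : HasWeakDeriv v f f') (hh : ContDiff ℝ 1 h) (n : ℕ) :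
    HasWeakDeriv v (fun x => h (mollify volume n f x))
      fun x => deriv h (mollify volume n f x) * mollify volume n f' x := by
  have smooth_f : ContDiff ℝ ∞ (mollify volume n f) := contDiff_mollify n hf.locInt
  have smooth_f' : ContDiff ℝ ∞ (mollify volume n f') := contDiff_mollify n hf.locInt_deriv
  have hasFDerivAt_comp : ∀ x, HasFDerivAt (fun x => h (mollify volume n f x))
      (deriv h (mollify volume n f x) • fderiv ℝ (mollify volume n f) x) x := fun x =>
    (hh.differentiable one_ne_zero _).hasDerivAt.comp_hasFDerivAt x
      (smooth_f.differentiable (by simp) x).hasFDerivAt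
  have fderiv_comp : ∀ x, fderiv ℝ (fun x => h (mollify volume n f x)) x v
      = deriv h (mollify volume n f x) * mollify volume n f' x := fun x => by
    rw [(hasFDerivAt_comp x).fderiv, smul_apply, hf.fderiv_mollify n x, smul_eq_mul]
  have smooth_chain := hasWeakDeriv_of_differentiable (v := v)
    (fun x => (hasFDerivAt_comp x).differentiableAt) (by
      simp only [fderiv_comp]
      exact (hh.continuous_deriv_one.comp smooth_f.continuous).mul smooth_f'.continuous)
  simpa only [fderiv_comp] using smooth_chain

lemma comp_of_bounded_deriv (hf : HasWeakDeriv v f f') (hh : ContDiff ℝ 1 h) {L : ℝ}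
    (hL : ∀ t, ‖deriv h t‖ ≤ L) :
    HasWeakDeriv v (fun x => h (f x)) fun x => deriv h (f x) * f' x := by
  have differentiable_h : Differentiable ℝ h := hh.differentiable one_ne_zero
  have locInt_comp := locallyIntegrable_comp hf.locInt differentiable_h hL
  have locInt_deriv := locallyIntegrable_deriv_comp_mul hf.locInt hf.locInt_deriv hh hL
  have continuous_f : ∀ n, Continuous (mollify volume n f) := fun n =>
    (contDiff_mollify n hf.locInt).continuous
  have continuous_f' : ∀ n, Continuous (mollify volume n f') := fun n =>
    (contDiff_mollify n hf.locInt_deriv).continuous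
  refine of_tendsto (hf.comp_mollify hh) locInt_comp locInt_deriv (fun ψ hψ => ?_) fun ψ hψ => ?_
  · have tendsto_L1 := (tendsto_setIntegral_norm_mollify_sub hf.locInt hψ.compact).const_mul L
    rw [mul_zero] at tendsto_L1
    refine hψ.tendsto_integral_mul (fun n => (hf.comp_mollify hh n).locInt) locInt_comp
      (squeeze_zero (fun n => integral_nonneg fun _ => norm_nonneg _) (fun n => ?_) tendsto_L1)
    rw [← integral_const_mul]
    exact integral_mono_of_nonneg (Eventually.of_forall fun _ => norm_nonneg _)
      ((((continuous_f n).locallyIntegrable.sub hf.locInt).integrableOn_isCompact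
        hψ.compact).norm.const_mul L)
      (Eventually.of_forall fun x => convex_univ.norm_image_sub_le_of_norm_deriv_le
        (fun t _ => differentiable_h t) (fun t _ => hL t) (mem_univ _) (mem_univ _))
  · refine hψ.tendsto_integral_mul (fun n => (hf.comp_mollify hh n).locInt_deriv) locInt_deriv ?_
    exact tendsto_integral_norm_mul_sub
      (fun n => (hh.continuous_deriv_one.comp (continuous_f n)).aestronglyMeasurable)
      (fun n x => hL _)
      (ae_restrict_of_ae ((ae_tendsto_mollify hf.locInt).mono fun x hx =>
        (hh.continuous_deriv_one.tendsto _).comp hx))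
      (fun n => (continuous_f' n).locallyIntegrable.integrableOn_isCompact hψ.compact)
      (hf.locInt_deriv.integrableOn_isCompact hψ.compact)
      (tendsto_setIntegral_norm_mollify_sub hf.locInt_deriv hψ.compact)

end HasWeakDeriv

/-- The bounded smooth truncation `t ↦ (n + 1) arctan (t / (n + 1))`, which tends to the identity
and reduces unbounded nonlinearities to the chain rule with bounded derivative. -/
def smoothTrunc (n : ℕ) (t : ℝ) : ℝ := ((n : ℝ) + 1) * Real.arctan (t / ((n : ℝ) + 1))

lemma contDiff_smoothTrunc (n : ℕ) : ContDiff ℝ 1 (smoothTrunc n) :=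
  contDiff_const.mul (contDiff_id.div_const _).arctan

lemma deriv_smoothTrunc (n : ℕ) (t : ℝ) :
    deriv (smoothTrunc n) t = (1 + (t / ((n : ℝ) + 1)) ^ 2)⁻¹ := by
  have := ((Real.hasDerivAt_arctan' (t / ((n : ℝ) + 1))).comp t
    ((hasDerivAt_id t).div_const ((n : ℝ) + 1))).const_mul ((n : ℝ) + 1)
  rw [HasDerivAt.deriv (f := smoothTrunc n) this]
  field_simp

lemma norm_deriv_smoothTrunc_le (n : ℕ) (t : ℝ) : ‖deriv (smoothTrunc n) t‖ ≤ 1 := by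
  rw [deriv_smoothTrunc, Real.norm_of_nonneg (by positivity)]
  exact inv_le_one_of_one_le₀ (le_add_of_nonneg_right (sq_nonneg _))

lemma abs_smoothTrunc_le (n : ℕ) (t : ℝ) : |smoothTrunc n t| ≤ |t| := by
  have := convex_univ.norm_image_sub_le_of_norm_deriv_le
    (fun t _ => (contDiff_smoothTrunc n).differentiable one_ne_zero t)
    (fun t _ => norm_deriv_smoothTrunc_le n t) (mem_univ 0) (mem_univ t)
  simpa [smoothTrunc] using this

lemma abs_smoothTrunc_le_const (n : ℕ) (t : ℝ) :
    |smoothTrunc n t| ≤ ((n : ℝ) + 1) * (Real.pi / 2) := by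
  rw [smoothTrunc, abs_mul, abs_of_nonneg (by positivity : (0 : ℝ) ≤ (n : ℝ) + 1)]
  exact mul_le_mul_of_nonneg_left
    (abs_le.2 ⟨(Real.neg_pi_div_two_lt_arctan _).le, (Real.arctan_lt_pi_div_two _).le⟩)
    (by positivity)

lemma tendsto_smoothTrunc (t : ℝ) : Tendsto (fun n => smoothTrunc n t) atTop (𝓝 t) := by
  have scaled := (Real.hasDerivAt_arctan' 0).hasFDerivAt.lim t (c := fun n : ℕ => (n : ℝ) + 1)
    (l := atTop) (tendsto_norm_atTop_atTop.comp
      (tendsto_atTop_add_const_right _ _ tendsto_natCast_atTop_atTop))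
  simpa [smoothTrunc, div_eq_inv_mul] using scaled

lemma tendsto_deriv_smoothTrunc (t : ℝ) :
    Tendsto (fun n => deriv (smoothTrunc n) t) atTop (𝓝 1) := by
  have tendsto_div : Tendsto (fun n : ℕ => t / ((n : ℝ) + 1)) atTop (𝓝 0) :=
    tendsto_const_nhds.div_atTop
      (tendsto_atTop_add_const_right _ _ tendsto_natCast_atTop_atTop)
  simpa [deriv_smoothTrunc] using ((tendsto_div.pow 2).const_add 1).inv₀ (by norm_num)

namespace HasWeakDeriv

variable {v : Space N} {f f' g g' : Space N → ℝ} {h : ℝ → ℝ}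

lemma comp_smoothTrunc (hf : HasWeakDeriv v f f') (hh : ContDiff ℝ 1 h)
    (hm' : ∀ s t, |s| ≤ |t| → |deriv h s| ≤ |deriv h t|) (n : ℕ) :
    HasWeakDeriv v (fun x => h (smoothTrunc n (f x)))
      fun x => deriv h (smoothTrunc n (f x)) * deriv (smoothTrunc n) (f x) * f' x := by
  have deriv_comp : ∀ t, deriv (h ∘ smoothTrunc n) t
      = deriv h (smoothTrunc n t) * deriv (smoothTrunc n) t := fun t =>
    deriv_comp t (hh.differentiable one_ne_zero _)
      ((contDiff_smoothTrunc n).differentiable one_ne_zero _)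
  have chain := hf.comp_of_bounded_deriv (hh.comp (contDiff_smoothTrunc n))
    (L := |deriv h (((n : ℝ) + 1) * (Real.pi / 2))|) fun t => by
      rw [deriv_comp, norm_mul]
      exact (mul_le_of_le_one_right (norm_nonneg _) (norm_deriv_smoothTrunc_le n t)).trans
        (hm' _ _ ((abs_smoothTrunc_le_const n t).trans (le_abs_self _)))
  simpa only [deriv_comp, comp_apply] using chain

lemma comp_of_monotone (hf : HasWeakDeriv v f f') (hh : ContDiff ℝ 1 h)
    (hm : ∀ s t, |s| ≤ |t| → |h s| ≤ |h t|)
    (hm' : ∀ s t, |s| ≤ |t| → |deriv h s| ≤ |deriv h t|)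
    (locInt_comp : LocallyIntegrable fun x => h (f x))
    (locInt_deriv : LocallyIntegrable fun x => deriv h (f x) * f' x) :
    HasWeakDeriv v (fun x => h (f x)) fun x => deriv h (f x) * f' x := by
  have truncated := hf.comp_smoothTrunc hh hm'
  refine of_tendsto truncated locInt_comp locInt_deriv
    (fun ψ hψ => hψ.tendsto_integral_mul_of_dominated (fun n => (truncated n).locInt) locInt_comp
      (fun n x => hm _ _ (abs_smoothTrunc_le n _))
      (fun x => (hh.continuous.tendsto _).comp (tendsto_smoothTrunc _)))
    (fun ψ hψ => hψ.tendsto_integral_mul_of_dominated (fun n => (truncated n).locInt_deriv)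
      locInt_deriv (fun n x => ?_) (fun x => ?_))
  · simp only [abs_mul]
    refine mul_le_mul_of_nonneg_right ?_ (abs_nonneg _)
    exact (mul_le_of_le_one_right (abs_nonneg _) (norm_deriv_smoothTrunc_le n _)).trans
      (hm' _ _ (abs_smoothTrunc_le n _))
  · have := ((hh.continuous_deriv_one.tendsto _).comp (tendsto_smoothTrunc (f x))).mul
      (tendsto_deriv_smoothTrunc (f x))
    rw [mul_one] at this
    exact this.mul_const _

lemma abs_rpow (hf : HasWeakDeriv v f f') {r : ℝ} (hr : 1 < r)
    (locInt_rpow : LocallyIntegrable fun x => |f x| ^ r)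
    (locInt_deriv : LocallyIntegrable fun x => r * |f x| ^ (r - 2) * f x * f' x) :
    HasWeakDeriv v (fun x => |f x| ^ r) fun x => r * |f x| ^ (r - 2) * f x * f' x := by
  have deriv_eq : ∀ t : ℝ, deriv (fun t => |t| ^ r) t = r * |t| ^ (r - 2) * t := fun t =>
    (hasDerivAt_abs_rpow t hr).deriv
  have abs_deriv : ∀ t : ℝ, |deriv (fun t => |t| ^ r) t| = r * |t| ^ (r - 1) := by
    intro t
    rw [deriv_eq, abs_mul, abs_mul, abs_of_pos (by linarith : 0 < r),
      abs_of_nonneg (Real.rpow_nonneg (abs_nonneg _) _)]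
    rcases eq_or_ne t 0 with rfl | ht
    · simp [Real.zero_rpow (by linarith : r - 1 ≠ 0)]
    · rw [mul_assoc, ← Real.rpow_add_one (abs_ne_zero.2 ht)]
      ring_nf
  have chain := hf.comp_of_monotone (h := fun t => |t| ^ r) (contDiff_norm_rpow hr)
    (fun s t hst => by
      simp only [abs_of_nonneg (Real.rpow_nonneg (abs_nonneg _) _)]
      exact Real.rpow_le_rpow (abs_nonneg _) hst (by linarith))
    (fun s t hst => by
      simp only [abs_deriv]
      exact mul_le_mul_of_nonneg_left (Real.rpow_le_rpow (abs_nonneg _) hst (by linarith))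
        (by linarith))
    locInt_rpow (by simpa only [deriv_eq] using locInt_deriv)
  simpa only [deriv_eq] using chain

end HasWeakDeriv

namespace MemLpLoc

variable {f g : Space N → ℝ} {r : ENNReal}

lemma locallyIntegrable_mul (hf : MemLpLoc f 2) (hg : MemLpLoc g 2) :
    LocallyIntegrable fun x => f x * g x :=
  locallyIntegrable_iff.2 fun S hS => (hf S hS).integrable_mul (hg S hS)

lemma add (hf : MemLpLoc f r) (hg : MemLpLoc g r) : MemLpLoc (fun x => f x + g x) r :=
  fun S hS => (hf S hS).add (hg S hS)

lemma sub (hf : MemLpLoc f r) (hg : MemLpLoc g r) : MemLpLoc (fun x => f x - g x) r :=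
  fun S hS => (hf S hS).sub (hg S hS)

end MemLpLoc

namespace HasWeakDeriv

variable {v : Space N} {f f' g g' : Space N → ℝ}

lemma sq (hf : HasWeakDeriv v f f') (h : MemLpLoc f 2) (h' : MemLpLoc f' 2) :
    HasWeakDeriv v (fun x => f x ^ 2) fun x => 2 * f x * f' x := by
  have deriv_sq : ∀ t : ℝ, deriv (fun t => t ^ 2) t = 2 * t := fun t => by simp
  have chain := hf.comp_of_monotone (h := fun t => t ^ 2) (contDiff_id.pow 2)
    (fun s t hst => by simpa only [abs_pow] using pow_le_pow_left₀ (abs_nonneg _) hst 2)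
    (fun s t hst => by
      simpa only [deriv_sq, abs_mul] using mul_le_mul_of_nonneg_left hst (abs_nonneg _))
    (by simpa only [pow_two] using h.locallyIntegrable_mul h)
    (by
      simp only [deriv_sq, mul_assoc]
      exact (h.locallyIntegrable_mul h').smul (2 : ℝ))
  simpa only [deriv_sq] using chain

/-- Polarization reduces the product rule to the chain rule for squares. -/
lemma mul (hf : HasWeakDeriv v f f') (hg : HasWeakDeriv v g g') (memLp_f : MemLpLoc f 2)
    (memLp_f' : MemLpLoc f' 2) (memLp_g : MemLpLoc g 2) (memLp_g' : MemLpLoc g' 2) :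
    HasWeakDeriv v (fun x => f x * g x) fun x => f x * g' x + f' x * g x := by
  have sq_add := (hf.add hg).sq (memLp_f.add memLp_g) (memLp_f'.add memLp_g')
  have sq_sub := (hf.sub hg).sq (memLp_f.sub memLp_g) (memLp_f'.sub memLp_g')
  convert! (sq_add.sub sq_sub).const_mul (1 / 4) using 2 <;> ring

end HasWeakDeriv

/-! ### Power kernels and the diagonal Hardy–Littlewood–Sobolev inequality -/

section PowKernel

variable {E : Type*} [NormedAddCommGroup E]

/-- The kernel `(|z|² + ε²)^(-s/2)`: a regularisation of `|z|^(-s)`, which is the case `ε = 0`. -/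
def powKernel (s ε : ℝ) (z : E) : ℝ := (‖z‖ ^ 2 + ε ^ 2) ^ (-s / 2)

lemma powKernel_nonneg (s ε : ℝ) (z : E) : 0 ≤ powKernel s ε z := by
  unfold powKernel; positivity

lemma powKernel_pos (s : ℝ) {ε : ℝ} (hε : 0 < ε) (z : E) : 0 < powKernel s ε z := by
  unfold powKernel; positivity

lemma powKernel_sub_comm (s ε : ℝ) (x y : E) : powKernel s ε (x - y) = powKernel s ε (y - x) := by
  rw [powKernel, powKernel, norm_sub_rev]

lemma powKernel_zero (s : ℝ) (z : E) : powKernel s 0 z = ‖z‖ ^ (-s) := by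
  unfold powKernel
  rw [zero_pow two_ne_zero, add_zero, ← Real.rpow_natCast, ← Real.rpow_mul (norm_nonneg _)]
  congr 1
  push_cast
  ring

lemma powKernel_zero_rpow (s t : ℝ) (z : E) : powKernel s 0 z ^ t = powKernel (s * t) 0 z := by
  rw [powKernel_zero, powKernel_zero, ← Real.rpow_mul (norm_nonneg _), neg_mul]

lemma measurable_powKernel [MeasurableSpace E] [OpensMeasurableSpace E] (s ε : ℝ) :
    Measurable (powKernel s ε : E → ℝ) := by
  unfold powKernel
  exact ((measurable_norm.pow_const 2).add_const _).pow_const _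

lemma powKernel_le_powKernel_zero {s : ℝ} (hs : 0 ≤ s) (ε : ℝ) {z : E} (hz : z ≠ 0) :
    powKernel s ε z ≤ powKernel s 0 z := by
  have : 0 < ‖z‖ := norm_pos_iff.2 hz
  exact Real.rpow_le_rpow_of_nonpos (by positivity) (by nlinarith [sq_nonneg ε]) (by linarith)

lemma powKernel_smul [NormedSpace ℝ E] (s : ℝ) {ρ : ℝ} (hρ : 0 < ρ) (z : E) :
    powKernel s 0 (ρ • z) = ρ ^ (-s) * powKernel s 0 z := by
  rw [powKernel_zero, powKernel_zero, norm_smul, Real.norm_of_nonneg hρ.le,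
    Real.mul_rpow hρ.le (norm_nonneg _)]

lemma powKernel_mul_le_add (s : ℝ) (F : E → ℝ) (x y : E) :
    powKernel s 0 (x - y) * (F x * F y)
      ≤ F y * (min (F x) (F y) * powKernel s 0 (x - y))
        + F x * (min (F y) (F x) * powKernel s 0 (y - x)) := by
  have mul_le : F x * F y ≤ F y * min (F x) (F y) + F x * min (F x) (F y) := by
    rcases le_total (F x) (F y) with hxy | hxy
    · rw [min_eq_left hxy]; nlinarith [sq_nonneg (F x)]
    · rw [min_eq_right hxy]; nlinarith [sq_nonneg (F y)]
  rw [powKernel_sub_comm s 0 y x, min_comm (F y) (F x)]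
  calc _ ≤ powKernel s 0 (x - y) * (F y * min (F x) (F y) + F x * min (F x) (F y)) :=
        mul_le_mul_of_nonneg_left mul_le (powKernel_nonneg _ _ _)
    _ = _ := by ring

lemma weight_eq_powKernel (γ : ℝ) : (weight γ : Space N → ℝ) = powKernel γ 1 := by
  ext x
  simp [weight, powKernel, add_comm]

variable [MeasurableSpace E] [BorelSpace E]

lemma setLIntegral_comp_sub_right (μ : Measure E) [μ.IsAddRightInvariant] (k : E → ENNReal)
    (S : Set E) (y : E) : ∫⁻ x in (· - y) ⁻¹' S, k (x - y) ∂μ = ∫⁻ x in S, k x ∂μ :=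
  (measurePreserving_sub_right μ y).setLIntegral_comp_preimage_emb
    (MeasurableEquiv.subRight y).measurableEmbedding k S

variable [NormedSpace ℝ E] [FiniteDimensional ℝ E] {μ : Measure E} [μ.IsAddHaarMeasure]

open scoped Pointwise

lemma setLIntegral_smul_set (f : E → ENNReal) {ρ : ℝ} (hρ : 0 < ρ) (S : Set E) :
    ∫⁻ x in ρ • S, f x ∂μ = ENNReal.ofReal (ρ ^ finrank ℝ E) * ∫⁻ x in S, f (ρ • x) ∂μ := by
  have smul_embedding : MeasurableEmbedding (ρ • · : E → E) :=
    (MeasurableEquiv.smul₀ ρ hρ.ne').measurableEmbedding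
  have eq_smul_map : μ = ENNReal.ofReal (ρ ^ finrank ℝ E) • μ.map (ρ • ·) := by
    rw [Measure.map_addHaar_smul μ hρ.ne', smul_smul, ← ENNReal.ofReal_mul (by positivity),
      abs_of_pos (by positivity), mul_inv_cancel₀ (by positivity), ENNReal.ofReal_one, one_smul]
  conv_lhs => rw [eq_smul_map]
  rw [Measure.restrict_smul, lintegral_smul_measure, smul_eq_mul, smul_embedding.restrict_map,
    smul_embedding.lintegral_map, ← image_smul, preimage_image_eq _ smul_embedding.injective]

lemma setLIntegral_smul_powKernel (s : ℝ) {ρ : ℝ} (hρ : 0 < ρ) (S : Set E) :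
    ∫⁻ x in ρ • S, ENNReal.ofReal (powKernel s 0 x) ∂μ
      = ENNReal.ofReal (ρ ^ (finrank ℝ E - s))
        * ∫⁻ x in S, ENNReal.ofReal (powKernel s 0 x) ∂μ := by
  rw [setLIntegral_smul_set _ hρ]
  simp only [powKernel_smul s hρ, ENNReal.ofReal_mul (Real.rpow_nonneg hρ.le _)]
  rw [lintegral_const_mul' _ _ ENNReal.ofReal_ne_top, ← mul_assoc,
    ← ENNReal.ofReal_mul (by positivity), ← Real.rpow_natCast, ← Real.rpow_add hρ, sub_eq_add_neg]

lemma setLIntegral_powKernel_ball_lt_top {s : ℝ} (hs : s < finrank ℝ E) (hE : 0 < finrank ℝ E)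
    (ρ : ℝ) : ∫⁻ x in ball (0 : E) ρ, ENNReal.ofReal (powKernel s 0 x) ∂μ < ⊤ := by
  refine IntegrableOn.setLIntegral_lt_top (integrableOn_ball_of_norm_le_rpow (C := 1) hE hs
    (Eventually.of_forall fun x => ?_) (measurable_powKernel s 0).aestronglyMeasurable)
  rw [Real.norm_of_nonneg (powKernel_nonneg _ _ _), powKernel_zero, one_mul]

lemma setLIntegral_powKernel_compl_ball_lt_top {s : ℝ} (hs : finrank ℝ E < s) {ρ : ℝ}
    (hρ : 0 < ρ) : ∫⁻ x in (ball (0 : E) ρ)ᶜ, ENNReal.ofReal (powKernel s 0 x) ∂μ < ⊤ := by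
  refine IntegrableOn.setLIntegral_lt_top (Integrable.mono'
    ((integrable_one_add_norm hs).const_mul (((1 + ρ) / ρ) ^ s)).integrableOn
    (measurable_powKernel _ 0).aestronglyMeasurable ?_)
  refine (ae_restrict_iff' measurableSet_ball.compl).2 (Eventually.of_forall fun x hx => ?_)
  have le_norm : ρ ≤ ‖x‖ := by simpa using hx
  have norm_pos : 0 < ‖x‖ := hρ.trans_le le_norm
  rw [Real.norm_of_nonneg (powKernel_nonneg _ _ _), powKernel_zero, Real.rpow_neg norm_pos.le,
    Real.rpow_neg (by positivity), ← div_eq_mul_inv, ← Real.div_rpow (by positivity)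
    (by positivity), ← Real.inv_rpow norm_pos.le]
  refine Real.rpow_le_rpow (by positivity) ?_ ((Nat.cast_nonneg _).trans hs.le)
  rw [inv_eq_one_div, div_div, div_le_div_iff₀ norm_pos (by positivity)]
  nlinarith

variable (μ) in
lemma exists_setLIntegral_powKernel_ball {s : ℝ} (hs : s < finrank ℝ E) (hE : 0 < finrank ℝ E) :
    ∃ C : ENNReal, C ≠ ⊤ ∧ ∀ ρ : ℝ, 0 < ρ → ∀ y : E,
      ∫⁻ x in ball y ρ, ENNReal.ofReal (powKernel s 0 (x - y)) ∂μ
        = C * ENNReal.ofReal (ρ ^ (finrank ℝ E - s)) := by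
  refine ⟨_, (setLIntegral_powKernel_ball_lt_top (μ := μ) hs hE 1).ne, fun ρ hρ y => ?_⟩
  have preimage_ball : (· - y) ⁻¹' ball (0 : E) ρ = ball y ρ := by
    ext x; simp [dist_eq_norm]
  rw [mul_comm, ← setLIntegral_smul_powKernel s hρ, smul_unitBall_of_pos hρ, ← preimage_ball,
    setLIntegral_comp_sub_right μ fun x => ENNReal.ofReal (powKernel s 0 x)]

variable (μ) in
lemma exists_setLIntegral_powKernel_compl_ball {s : ℝ} (hs : finrank ℝ E < s) :
    ∃ C : ENNReal, C ≠ ⊤ ∧ ∀ ρ : ℝ, 0 < ρ → ∀ y : E,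
      ∫⁻ x in (ball y ρ)ᶜ, ENNReal.ofReal (powKernel s 0 (x - y)) ∂μ
        = C * ENNReal.ofReal (ρ ^ (finrank ℝ E - s)) := by
  refine ⟨_, (setLIntegral_powKernel_compl_ball_lt_top (μ := μ) hs one_pos).ne, fun ρ hρ y => ?_⟩
  have smul_compl_ball : ρ • (ball (0 : E) 1)ᶜ = (ball (0 : E) ρ)ᶜ := by
    rw [← smul_unitBall_of_pos hρ]
    exact smul_set_compl (a := Units.mk0 ρ hρ.ne')
  have preimage_compl_ball : (· - y) ⁻¹' (ball (0 : E) ρ)ᶜ = (ball y ρ)ᶜ := by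
    ext x; simp [dist_eq_norm]
  rw [mul_comm, ← setLIntegral_smul_powKernel s hρ, smul_compl_ball, ← preimage_compl_ball,
    setLIntegral_comp_sub_right μ fun x => ENNReal.ofReal (powKernel s 0 x)]

variable {s p : ℝ} {F : E → ℝ}

lemma exists_setLIntegral_min_mul_powKernel_compl_ball_le
    (hp : p.HolderConjugate (2 * finrank ℝ E / s)) (hF : Measurable F) (hF0 : ∀ x, 0 ≤ F x)
    (hFp : ∫⁻ x, ENNReal.ofReal (F x ^ p) ∂μ ≠ ⊤) :
    ∃ C : ENNReal, C ≠ ⊤ ∧ ∀ b : ℝ, 0 < b → ∀ ρ : ℝ, 0 < ρ → ∀ y : E,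
      ∫⁻ x in (ball y ρ)ᶜ,
          ENNReal.ofReal (min (F x) b) * ENNReal.ofReal (powKernel s 0 (x - y)) ∂μ
        ≤ C * ENNReal.ofReal (ρ ^ (-s / 2)) := by
  set t : ℝ := 2 * finrank ℝ E / s with ht
  have t_inv_nonneg : 0 ≤ 1 / t := hp.symm.one_div_nonneg
  have s_ne : s ≠ 0 := by rintro rfl; simpa [ht] using hp.symm.pos
  have mul_t : s * t = 2 * finrank ℝ E := mul_div_cancel₀ _ s_ne
  have dim_pos : (0 : ℝ) < finrank ℝ E := by
    refine (Nat.cast_nonneg _).lt_of_ne fun h => ?_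
    simpa [ht, ← h] using hp.symm.pos
  obtain ⟨C, hC, tail⟩ := exists_setLIntegral_powKernel_compl_ball μ (s := s * t) (by linarith)
  set M := ∫⁻ x, ENNReal.ofReal (F x ^ p) ∂μ
  refine ⟨M ^ (1 / p) * C ^ (1 / t), ENNReal.mul_ne_top
    (ENNReal.rpow_ne_top_of_nonneg hp.one_div_nonneg hFp)
    (ENNReal.rpow_ne_top_of_nonneg t_inv_nonneg hC), fun b hb ρ hρ y => ?_⟩
  calc ∫⁻ x in (ball y ρ)ᶜ,
        ENNReal.ofReal (min (F x) b) * ENNReal.ofReal (powKernel s 0 (x - y)) ∂μ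
      ≤ (∫⁻ x in (ball y ρ)ᶜ, ENNReal.ofReal (min (F x) b) ^ p ∂μ) ^ (1 / p)
        * (∫⁻ x in (ball y ρ)ᶜ, ENNReal.ofReal (powKernel s 0 (x - y)) ^ t ∂μ) ^ (1 / t) :=
        ENNReal.lintegral_mul_le_Lp_mul_Lq _ hp
          (hF.min measurable_const).ennreal_ofReal.aemeasurable
          ((measurable_powKernel s 0).comp (measurable_id.sub_const y)).ennreal_ofReal.aemeasurable
    _ ≤ M ^ (1 / p) * (C * ENNReal.ofReal (ρ ^ (finrank ℝ E - s * t))) ^ (1 / t) := by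
        gcongr ?_ ^ (1 / p) * ?_ ^ (1 / t)
        · exact hp.one_div_nonneg
        · refine (setLIntegral_le_lintegral _ _).trans (lintegral_mono fun x => ?_)
          rw [ENNReal.ofReal_rpow_of_nonneg (le_min (hF0 x) hb.le) hp.nonneg]
          exact ENNReal.ofReal_le_ofReal
            (Real.rpow_le_rpow (le_min (hF0 x) hb.le) (min_le_left _ _) hp.nonneg)
        · simp only [ENNReal.ofReal_rpow_of_nonneg (powKernel_nonneg _ _ _) hp.symm.nonneg,
            powKernel_zero_rpow]
          exact (tail ρ hρ y).le
    _ = M ^ (1 / p) * C ^ (1 / t) * ENNReal.ofReal (ρ ^ (-s / 2)) := by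
        rw [ENNReal.mul_rpow_of_nonneg _ _ t_inv_nonneg,
          ENNReal.ofReal_rpow_of_nonneg (by positivity) t_inv_nonneg, ← Real.rpow_mul hρ.le,
          show (finrank ℝ E - s * t) * (1 / t) = -s / 2 by rw [mul_t, ht]; field_simp; ring]
        ring

lemma exists_lintegral_min_mul_powKernel_le (hs : s < finrank ℝ E)
    (hp : p.HolderConjugate (2 * finrank ℝ E / s)) (hF : Measurable F) (hF0 : ∀ x, 0 ≤ F x)
    (hFp : ∫⁻ x, ENNReal.ofReal (F x ^ p) ∂μ ≠ ⊤) :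
    ∃ C : ENNReal, C ≠ ⊤ ∧ ∀ b : ℝ, 0 < b → ∀ y : E,
      ∫⁻ x, ENNReal.ofReal (min (F x) b) * ENNReal.ofReal (powKernel s 0 (x - y)) ∂μ
        ≤ C * ENNReal.ofReal (b ^ (p - 1)) := by
  have dim_pos : 0 < finrank ℝ E := by
    refine Nat.pos_of_ne_zero fun h => ?_
    simpa [h] using hp.symm.pos
  have exponent_eq : p * s / (2 * finrank ℝ E) = p - 1 := by
    have := hp.inv_add_inv_eq_one
    have := hp.ne_zero
    field_simp at *
    linarith
  obtain ⟨C₁, hC₁, near⟩ := exists_setLIntegral_powKernel_ball μ hs dim_pos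
  obtain ⟨C₂, hC₂, far⟩ :=
    exists_setLIntegral_min_mul_powKernel_compl_ball_le (μ := μ) hp hF hF0 hFp
  refine ⟨C₁ + C₂, ENNReal.add_ne_top.2 ⟨hC₁, hC₂⟩, fun b hb y => ?_⟩
  -- this radius balances the contributions of the ball and of its complement
  set ρ : ℝ := b ^ (-p / finrank ℝ E) with hρ
  have hρ0 : 0 < ρ := by positivity
  have near_scale : b * ρ ^ (finrank ℝ E - s) = b ^ (p - 1) := by
    nth_rewrite 1 [← Real.rpow_one b]
    rw [hρ, ← Real.rpow_mul hb.le, ← Real.rpow_add hb]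
    congr 1
    linear_combination (norm := (field_simp; ring)) 2 * exponent_eq
  have far_scale : ρ ^ (-s / 2) = b ^ (p - 1) := by
    rw [hρ, ← Real.rpow_mul hb.le, ← exponent_eq]
    congr 1
    field_simp
  rw [← lintegral_add_compl _ (measurableSet_ball (x := y) (ε := ρ)), add_mul]
  refine add_le_add ?_ ((far b hb ρ hρ0 y).trans_eq (by rw [far_scale]))
  calc ∫⁻ x in ball y ρ, ENNReal.ofReal (min (F x) b) * ENNReal.ofReal (powKernel s 0 (x - y)) ∂μ
      ≤ ∫⁻ x in ball y ρ, ENNReal.ofReal b * ENNReal.ofReal (powKernel s 0 (x - y)) ∂μ := by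
        refine lintegral_mono fun x => ?_
        gcongr
        exact min_le_right _ _
    _ = ENNReal.ofReal b * (C₁ * ENNReal.ofReal (ρ ^ (finrank ℝ E - s))) := by
        rw [lintegral_const_mul' _ _ ENNReal.ofReal_ne_top, near ρ hρ0 y]
    _ = C₁ * ENNReal.ofReal (b ^ (p - 1)) := by
        rw [← near_scale, ENNReal.ofReal_mul hb.le]
        ring

lemma lintegral_lintegral_mul_min_lt_top (hs : s < finrank ℝ E)
    (hp : p.HolderConjugate (2 * finrank ℝ E / s)) (hF : Measurable F) (hF0 : ∀ x, 0 ≤ F x)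
    (hFp : ∫⁻ x, ENNReal.ofReal (F x ^ p) ∂μ ≠ ⊤) :
    ∫⁻ y, ∫⁻ x, ENNReal.ofReal (F y) * (ENNReal.ofReal (min (F x) (F y))
      * ENNReal.ofReal (powKernel s 0 (x - y))) ∂μ ∂μ < ⊤ := by
  obtain ⟨C, hC, truncated_bound⟩ := exists_lintegral_min_mul_powKernel_le hs hp hF hF0 hFp
  calc _ ≤ ∫⁻ y, C * ENNReal.ofReal (F y ^ p) ∂μ := by
        refine lintegral_mono fun y => ?_
        rcases (hF0 y).eq_or_lt with zero_eq | pos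
        · simp [← zero_eq]
        calc _ = ENNReal.ofReal (F y) * ∫⁻ x, ENNReal.ofReal (min (F x) (F y))
                * ENNReal.ofReal (powKernel s 0 (x - y)) ∂μ :=
              lintegral_const_mul' _ _ ENNReal.ofReal_ne_top
          _ ≤ ENNReal.ofReal (F y) * (C * ENNReal.ofReal (F y ^ (p - 1))) := by
              gcongr
              exact truncated_bound _ pos y
          _ = C * ENNReal.ofReal (F y ^ p) := by
              rw [mul_left_comm, ← ENNReal.ofReal_mul pos.le, ← Real.rpow_one_add' pos.le
                (by linarith [hp.pos]), add_sub_cancel]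
    _ = C * ∫⁻ y, ENNReal.ofReal (F y ^ p) ∂μ := lintegral_const_mul' _ _ hC
    _ < ⊤ := ENNReal.mul_lt_top hC.lt_top hFp.lt_top

lemma measurable_powKernel_sub (s ε : ℝ) :
    Measurable fun z : E × E => powKernel s ε (z.1 - z.2) :=
  (measurable_powKernel s ε).comp (measurable_fst.sub measurable_snd)

lemma lintegral_lintegral_powKernel_lt_top (hs : s < finrank ℝ E)
    (hp : p.HolderConjugate (2 * finrank ℝ E / s)) (hF : Measurable F) (hF0 : ∀ x, 0 ≤ F x)
    (hFp : ∫⁻ x, ENNReal.ofReal (F x ^ p) ∂μ ≠ ⊤) :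
    ∫⁻ y, ∫⁻ x, ENNReal.ofReal (powKernel s 0 (x - y) * (F x * F y)) ∂μ ∂μ < ⊤ := by
  set P : E → E → ENNReal := fun x y => ENNReal.ofReal (F y)
    * (ENNReal.ofReal (min (F x) (F y)) * ENNReal.ofReal (powKernel s 0 (x - y))) with hP
  have measurable_P : Measurable (uncurry P) :=
    (hF.comp measurable_snd).ennreal_ofReal.mul
      (((hF.comp measurable_fst).min (hF.comp measurable_snd)).ennreal_ofReal.mul
        (measurable_powKernel_sub s 0).ennreal_ofReal)
  have le_P : ∀ x y, ENNReal.ofReal (powKernel s 0 (x - y) * (F x * F y)) ≤ P x y + P y x := by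
    intro x y
    refine (ENNReal.ofReal_le_ofReal (powKernel_mul_le_add s F x y)).trans
      (ENNReal.ofReal_add_le.trans_eq ?_)
    simp only [hP, ENNReal.ofReal_mul (hF0 _), ENNReal.ofReal_mul (le_min (hF0 _) (hF0 _))]
  have finite_P : ∫⁻ y, ∫⁻ x, P x y ∂μ ∂μ < ⊤ := lintegral_lintegral_mul_min_lt_top hs hp hF hF0 hFp
  calc ∫⁻ y, ∫⁻ x, ENNReal.ofReal (powKernel s 0 (x - y) * (F x * F y)) ∂μ ∂μ
      ≤ ∫⁻ y, ∫⁻ x, (P x y + P y x) ∂μ ∂μ :=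
        lintegral_mono fun y => lintegral_mono fun x => le_P x y
    _ = (∫⁻ y, ∫⁻ x, P x y ∂μ ∂μ) + ∫⁻ y, ∫⁻ x, P y x ∂μ ∂μ := by
        rw [← lintegral_add_left (Measurable.lintegral_prod_left measurable_P)]
        exact lintegral_congr fun y =>
          lintegral_add_left (measurable_P.comp measurable_prodMk_right) _
    _ = (∫⁻ y, ∫⁻ x, P x y ∂μ ∂μ) + ∫⁻ y, ∫⁻ x, P x y ∂μ ∂μ := by
        rw [lintegral_lintegral_swap measurable_P.aemeasurable]
    _ < ⊤ := ENNReal.add_lt_top.2 ⟨finite_P, finite_P⟩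

lemma integrable_powKernel_mul_self (hs : s < finrank ℝ E)
    (hp : p.HolderConjugate (2 * finrank ℝ E / s)) (hF : Measurable F) (hF0 : ∀ x, 0 ≤ F x)
    (hFp : MemLp F (ENNReal.ofReal p) μ) :
    Integrable (fun z : E × E => powKernel s 0 (z.1 - z.2) * (F z.1 * F z.2)) (μ.prod μ) := by
  have lintegral_rpow_ne_top : ∫⁻ x, ENNReal.ofReal (F x ^ p) ∂μ ≠ ⊤ := by
    have integrable_rpow := hFp.integrable_norm_rpow (by simpa using hp.pos) ENNReal.ofReal_ne_top
    rw [ENNReal.toReal_ofReal hp.nonneg] at integrable_rpow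
    simpa only [Real.norm_of_nonneg (hF0 _)] using integrable_rpow.lintegral_lt_top.ne
  have measurable_integrand : Measurable fun z : E × E =>
      powKernel s 0 (z.1 - z.2) * (F z.1 * F z.2) :=
    (measurable_powKernel_sub s 0).mul ((hF.comp measurable_fst).mul (hF.comp measurable_snd))
  refine ⟨measurable_integrand.aestronglyMeasurable, ?_⟩
  rw [hasFiniteIntegral_iff_ofReal (Eventually.of_forall fun z =>
    mul_nonneg (powKernel_nonneg _ _ _) (mul_nonneg (hF0 _) (hF0 _))),
    lintegral_prod_symm _ measurable_integrand.ennreal_ofReal.aemeasurable]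
  exact lintegral_lintegral_powKernel_lt_top hs hp hF hF0 lintegral_rpow_ne_top

/-- The Hardy–Littlewood–Sobolev inequality with equal exponents, in qualitative form. -/
theorem integrable_powKernel_mul (hs : s < finrank ℝ E)
    (hp : p.HolderConjugate (2 * finrank ℝ E / s)) {f g : E → ℝ}
    (hf : MemLp f (ENNReal.ofReal p) μ) (hg : MemLp g (ENNReal.ofReal p) μ) :
    Integrable (fun z : E × E => powKernel s 0 (z.1 - z.2) * (f z.1 * g z.2)) (μ.prod μ) := by
  set f₁ := hf.1.mk f
  set g₁ := hg.1.mk g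
  have measurable_f₁ : Measurable f₁ := hf.1.stronglyMeasurable_mk.measurable
  have measurable_g₁ : Measurable g₁ := hg.1.stronglyMeasurable_mk.measurable
  have f_ae_eq : f =ᵐ[μ] f₁ := hf.1.ae_eq_mk
  have g_ae_eq : g =ᵐ[μ] g₁ := hg.1.ae_eq_mk
  have majorant := integrable_powKernel_mul_self hs hp (F := fun x => |f₁ x| + |g₁ x|)
    (measurable_f₁.abs.add measurable_g₁.abs) (fun x => by positivity)
    (((memLp_congr_ae f_ae_eq).1 hf).abs.add ((memLp_congr_ae g_ae_eq).1 hg).abs)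
  have measurable_integrand : Measurable fun z : E × E =>
      powKernel s 0 (z.1 - z.2) * (f₁ z.1 * g₁ z.2) :=
    (measurable_powKernel_sub s 0).mul
      ((measurable_f₁.comp measurable_fst).mul (measurable_g₁.comp measurable_snd))
  refine (majorant.mono' measurable_integrand.aestronglyMeasurable
    (Eventually.of_forall fun z => ?_)).congr ?_
  · rw [Real.norm_eq_abs, abs_mul, abs_mul, abs_of_nonneg (powKernel_nonneg _ _ _)]
    refine mul_le_mul_of_nonneg_left ?_ (powKernel_nonneg _ _ _)
    exact mul_le_mul (le_add_of_nonneg_right (abs_nonneg _)) (le_add_of_nonneg_left (abs_nonneg _))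
      (abs_nonneg _) (by positivity)
  · filter_upwards [Measure.quasiMeasurePreserving_fst.ae f_ae_eq,
      Measure.quasiMeasurePreserving_snd.ae g_ae_eq] with z hfz hgz
    rw [hfz, hgz]

end PowKernel

section PowKernelCalculus

variable {E : Type*} [NormedAddCommGroup E]

lemma powKernel_add_two_mul {s ε : ℝ} {z : E} (h : 0 < ‖z‖ ^ 2 + ε ^ 2) :
    powKernel (s + 2) ε z * (‖z‖ ^ 2 + ε ^ 2) = powKernel s ε z := by
  unfold powKernel
  rw [← Real.rpow_add_one h.ne']
  congr 1
  ring

lemma powKernel_add_two_mul_norm_sq_le {s : ℝ} (ε : ℝ) {z : E} (hz : z ≠ 0) :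
    powKernel (s + 2) ε z * ‖z‖ ^ 2 ≤ powKernel s ε z := by
  have : 0 < ‖z‖ := norm_pos_iff.2 hz
  rw [← powKernel_add_two_mul (s := s) (ε := ε) (z := z) (by positivity)]
  exact mul_le_mul_of_nonneg_left (by nlinarith [sq_nonneg ε]) (powKernel_nonneg _ _ _)

lemma powKernel_add_two_mul_norm_le {s ε : ℝ} (hε : 0 < ε) (z : E) :
    powKernel (s + 2) ε z * ‖z‖ ≤ ε⁻¹ * powKernel s ε z := by
  rw [← powKernel_add_two_mul (s := s) (ε := ε) (z := z) (by positivity), mul_left_comm]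
  refine mul_le_mul_of_nonneg_left ?_ (powKernel_nonneg _ _ _)
  rw [inv_mul_eq_div, le_div_iff₀ hε]
  nlinarith [sq_nonneg (‖z‖ - ε), norm_nonneg z, mul_nonneg (norm_nonneg z) hε.le]

lemma tendsto_powKernel {s : ℝ} {z : E} (hz : z ≠ 0) {e : ℕ → ℝ} (he : Tendsto e atTop (𝓝 0)) :
    Tendsto (fun n => powKernel s (e n) z) atTop (𝓝 (powKernel s 0 z)) := by
  have : 0 < ‖z‖ := norm_pos_iff.2 hz
  exact ((he.pow 2).const_add _).rpow_const (Or.inl (by positivity))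

variable [InnerProductSpace ℝ E]

lemma contDiff_powKernel (s : ℝ) {ε : ℝ} (hε : 0 < ε) :
    ContDiff ℝ ∞ (powKernel s ε : E → ℝ) := by
  unfold powKernel
  refine ContDiff.rpow_const_of_ne ((contDiff_norm_sq ℝ).add contDiff_const) fun z => ?_
  positivity

lemma fderiv_powKernel (s : ℝ) {ε : ℝ} (hε : 0 < ε) (z v : E) :
    fderiv ℝ (powKernel s ε) z v = -s * powKernel (s + 2) ε z * inner ℝ z v := by
  have hasFDerivAt_base :
      HasFDerivAt (fun z : E => ‖z‖ ^ 2 + ε ^ 2) ((2 : ℝ) • innerSL ℝ z) z := by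
    simpa [two_smul] using (hasStrictFDerivAt_norm_sq z).hasFDerivAt.add_const (ε ^ 2)
  have hasFDerivAt_powKernel : HasFDerivAt (powKernel s ε) _ z :=
    hasFDerivAt_base.rpow_const (p := -s / 2) (Or.inl (by positivity))
  rw [hasFDerivAt_powKernel.fderiv]
  unfold powKernel
  simp only [FunLike.coe_smul, Pi.smul_apply, innerSL_apply_apply, smul_eq_mul]
  rw [show -(s + 2) / 2 = -s / 2 - 1 by ring]
  ring

end PowKernelCalculus

/-! ### The Euler vector field -/

lemma sum_coord_smul_basisFun (w : Space N) :
    ∑ i, w i • EuclideanSpace.basisFun (Fin N) ℝ i = w := by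
  simpa using (EuclideanSpace.basisFun (Fin N) ℝ).sum_repr w

lemma IsTest.mul_sub_coord {η : Space N → ℝ} (hη : IsTest η) (y : Space N) (i : Fin N) :
    IsTest fun x : Space N => η x * (x - y) i :=
  hη.mul_right ((EuclideanSpace.proj (𝕜 := ℝ) i : Space N →L[ℝ] ℝ).contDiff.comp
    (contDiff_id.sub contDiff_const))

lemma IsTest.fderiv_mul_sub_coord {η : Space N → ℝ} (hη : IsTest η) (x y v : Space N) (i : Fin N) :
    fderiv ℝ (fun x : Space N => η x * (x - y) i) x v = η x * v i + (x - y) i * fderiv ℝ η x v := by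
  have hasFDerivAt_coord : HasFDerivAt (fun x : Space N => (x - y) i)
      (EuclideanSpace.proj i : Space N →L[ℝ] ℝ) x :=
    ((EuclideanSpace.proj (𝕜 := ℝ) i).hasFDerivAt (x := x)).sub_const (y i)
  rw [HasFDerivAt.fderiv (f := fun x : Space N => η x * (x - y) i)
    ((hη.differentiable x).hasFDerivAt.mul hasFDerivAt_coord)]
  simp

lemma apply_eq_sum_basisFun (L : Space N →L[ℝ] ℝ) (w : Space N) :
    L w = ∑ i, w i * L (EuclideanSpace.basisFun (Fin N) ℝ i) := by
  conv_lhs => rw [← sum_coord_smul_basisFun w]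
  simp only [map_sum, map_smul, smul_eq_mul]

lemma IsTest.sum_fderiv_mul_sub_coord {η : Space N → ℝ} (hη : IsTest η) (x y : Space N) :
    ∑ i, fderiv ℝ (fun x : Space N => η x * (x - y) i) x (EuclideanSpace.basisFun (Fin N) ℝ i)
      = N * η x + fderiv ℝ η x (x - y) := by
  simp only [hη.fderiv_mul_sub_coord, Finset.sum_add_distrib,
    apply_eq_sum_basisFun (fderiv ℝ η x) (x - y)]
  simp

lemma sum_inner_basisFun_mul_coord (w z : Space N) :
    ∑ i, inner ℝ w (EuclideanSpace.basisFun (Fin N) ℝ i) * z i = inner ℝ w z := by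
  conv_rhs => rw [← sum_coord_smul_basisFun z]
  simp only [inner_sum, inner_smul_right, mul_comm]

lemma HasWeakGradient.integral_euler {F : Space N → ℝ} {Γ : Space N → Space N}
    (h : HasWeakGradient F Γ) {η : Space N → ℝ} (hη : IsTest η) (y : Space N) :
    ∫ x, F x * (N * η x + fderiv ℝ η x (x - y)) = -∫ x, η x * inner ℝ (Γ x) (x - y) := by
  have isTest_mul := hη.mul_sub_coord y
  have weakDeriv := fun i => h.hasWeakDeriv (EuclideanSpace.basisFun (Fin N) ℝ i)
  have inner_eq_sum : ∀ x, η x * inner ℝ (Γ x) (x - y) = ∑ i,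
      inner ℝ (Γ x) (EuclideanSpace.basisFun (Fin N) ℝ i) * (η x * (x - y) i) := fun x => by
    rw [← sum_inner_basisFun_mul_coord (Γ x), Finset.mul_sum]
    exact Finset.sum_congr rfl fun i _ => mul_left_comm _ _ _
  simp_rw [inner_eq_sum, ← hη.sum_fderiv_mul_sub_coord, Finset.mul_sum]
  rw [integral_finsetSum _ fun i _ => ((isTest_mul i).fderiv_apply _).integrable_mul h.locInt,
    integral_finsetSum _ fun i _ => (isTest_mul i).integrable_mul (weakDeriv i).locInt_deriv,
    ← Finset.sum_neg_distrib]
  exact Finset.sum_congr rfl fun i _ => (weakDeriv i).integral_eq _ (isTest_mul i)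

/-- The divergence of the vector field `x ↦ η x • x`. -/
def eulerDiv (η : Space N → ℝ) (x : Space N) : ℝ := N * η x + fderiv ℝ η x x

lemma HasWeakGradient.integral_eulerDiv {F : Space N → ℝ} {Γ : Space N → Space N}
    (h : HasWeakGradient F Γ) {η : Space N → ℝ} (hη : IsTest η) :
    ∫ x, F x * eulerDiv η x = -∫ x, η x * inner ℝ (Γ x) x := by
  simpa only [sub_zero] using! h.integral_euler hη 0

lemma IsTest.continuous_eulerDiv {η : Space N → ℝ} (hη : IsTest η) : Continuous (eulerDiv η) :=
  (continuous_const.mul hη.continuous).add (hη.continuous_fderiv.clm_apply continuous_id)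

lemma IsTest.compact_eulerDiv {η : Space N → ℝ} (hη : IsTest η) :
    HasCompactSupport (eulerDiv η) :=
  hη.compact.mul_left.add <| (hη.compact.fderiv ℝ).mono fun x hx h => hx (by simp [h])

/-! ### Cutoff functions -/

/-- The standard cutoff `x ↦ θ (x / (n + 1))`, where `θ` is a fixed bump function equal to `1` on
the unit ball and vanishing outside the ball of radius `2`. -/
def cutoff (N n : ℕ) (x : Space N) : ℝ :=
  (⟨1, 2, one_pos, one_lt_two⟩ : ContDiffBump (0 : Space N)) (((n : ℝ) + 1)⁻¹ • x)

lemma isTest_cutoff (n : ℕ) : IsTest (cutoff N n) := by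
  have inv_ne_zero : ((n : ℝ) + 1)⁻¹ ≠ 0 := by positivity
  exact ⟨(ContDiffBump.contDiff _).comp (contDiff_const_smul _),
    (ContDiffBump.hasCompactSupport _).comp_homeomorph (Homeomorph.smulOfNeZero _ inv_ne_zero)⟩

lemma cutoff_nonneg (n : ℕ) (x : Space N) : 0 ≤ cutoff N n x := ContDiffBump.nonneg _

lemma cutoff_le_one (n : ℕ) (x : Space N) : cutoff N n x ≤ 1 := ContDiffBump.le_one _

lemma eventually_cutoff_eventuallyEq_one (x : Space N) :
    ∀ᶠ n in atTop, cutoff N n =ᶠ[𝓝 x] fun _ => 1 := by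
  have tendsto_div : Tendsto (fun n : ℕ => (‖x‖ + 1) / ((n : ℝ) + 1)) atTop (𝓝 0) :=
    tendsto_const_nhds.div_atTop (tendsto_atTop_add_const_right _ _ tendsto_natCast_atTop_atTop)
  filter_upwards [tendsto_div.eventually (gt_mem_nhds zero_lt_one)] with n hn
  filter_upwards [ball_mem_nhds x one_pos] with y hy
  refine ContDiffBump.one_of_mem_closedBall _ ?_
  rw [mem_closedBall, dist_zero_right, norm_smul, Real.norm_of_nonneg (by positivity)]
  have norm_le : ‖y‖ ≤ ‖x‖ + 1 := by
    rw [mem_ball_iff_norm] at hy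
    linarith [norm_le_norm_add_norm_sub' y x]
  rw [inv_mul_eq_div]
  exact (div_le_div_of_nonneg_right norm_le (by positivity)).trans hn.le

lemma tendsto_cutoff (x : Space N) : Tendsto (fun n => cutoff N n x) atTop (𝓝 1) :=
  tendsto_const_nhds.congr' ((eventually_cutoff_eventuallyEq_one x).mono fun _ h =>
    h.self_of_nhds.symm)

lemma tendsto_fderiv_cutoff (x v : Space N) :
    Tendsto (fun n => fderiv ℝ (cutoff N n) x v) atTop (𝓝 0) :=
  tendsto_const_nhds.congr' ((eventually_cutoff_eventuallyEq_one x).mono fun _ h => by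
    simp [h.fderiv_eq])

lemma IsTest.exists_lipschitz_smul {θ : Space N → ℝ} (hθ : IsTest θ) :
    ∃ L : ℝ, 0 ≤ L ∧ ∀ x y, ‖θ x • x - θ y • y‖ ≤ L * ‖x - y‖ := by
  have smooth_smul : ContDiff ℝ ∞ fun x => θ x • x := hθ.smooth.smul contDiff_id
  obtain ⟨L, hL⟩ :=
    ContDiff.lipschitzWith_of_hasCompactSupport hθ.compact.smul_right smooth_smul (by simp)
  exact ⟨L, L.2, fun x y => by simpa [dist_eq_norm] using hL.dist_le_mul x y⟩

lemma exists_lipschitz_cutoff_smul (N : ℕ) :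
    ∃ L : ℝ, 0 ≤ L ∧ ∀ n (x y : Space N),
      ‖cutoff N n x • x - cutoff N n y • y‖ ≤ L * ‖x - y‖ := by
  set θ : ContDiffBump (0 : Space N) := ⟨1, 2, one_pos, one_lt_two⟩
  obtain ⟨L, hL0, hL⟩ := IsTest.exists_lipschitz_smul (θ := θ) ⟨θ.contDiff, θ.hasCompactSupport⟩
  refine ⟨L, hL0, fun n x y => ?_⟩
  have scale_pos : (0 : ℝ) < (n : ℝ) + 1 := by positivity
  have cutoff_smul_eq : ∀ x : Space N, cutoff N n x • x
      = ((n : ℝ) + 1) • (θ (((n : ℝ) + 1)⁻¹ • x) • ((n : ℝ) + 1)⁻¹ • x) := by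
    intro x
    rw [smul_comm, smul_inv_smul₀ scale_pos.ne']
    rfl
  rw [cutoff_smul_eq, cutoff_smul_eq, ← smul_sub, norm_smul, Real.norm_of_nonneg scale_pos.le]
  calc _ ≤ ((n : ℝ) + 1) * (L * ‖((n : ℝ) + 1)⁻¹ • x - ((n : ℝ) + 1)⁻¹ • y‖) := by
        gcongr
        exact hL _ _
    _ = L * ‖x - y‖ := by
        rw [← smul_sub, norm_smul, Real.norm_of_nonneg (by positivity)]
        field_simp

lemma exists_fderiv_cutoff_bound (N : ℕ) :
    ∃ M : ℝ, 0 ≤ M ∧ ∀ n (x : Space N),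
      ‖fderiv ℝ (cutoff N n) x‖ ≤ M ∧ ‖fderiv ℝ (cutoff N n) x‖ * ‖x‖ ≤ M := by
  set θ : ContDiffBump (0 : Space N) := ⟨1, 2, one_pos, one_lt_two⟩
  have isTest_θ : IsTest θ := ⟨θ.contDiff, θ.hasCompactSupport⟩
  have compact_fderiv : HasCompactSupport (fderiv ℝ θ) := isTest_θ.compact.fderiv ℝ
  obtain ⟨M₁, hM₁⟩ := compact_fderiv.exists_bound_of_continuous isTest_θ.continuous_fderiv
  obtain ⟨M₂, hM₂⟩ :=
    (compact_fderiv.smul_left (f := fun x : Space N => ‖x‖)).exists_bound_of_continuous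
      (continuous_norm.smul isTest_θ.continuous_fderiv)
  have M₁_nonneg : 0 ≤ M₁ := (norm_nonneg _).trans (hM₁ 0)
  refine ⟨max M₁ M₂, le_max_of_le_left M₁_nonneg, fun n x => ?_⟩
  have inv_pos : (0 : ℝ) < ((n : ℝ) + 1)⁻¹ := by positivity
  have inv_le_one : ((n : ℝ) + 1)⁻¹ ≤ 1 :=
    inv_le_one_of_one_le₀ (le_add_of_nonneg_left n.cast_nonneg)
  have fderiv_eq : fderiv ℝ (cutoff N n) x
      = ((n : ℝ) + 1)⁻¹ • fderiv ℝ θ (((n : ℝ) + 1)⁻¹ • x) := fderiv_comp_smul _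
  rw [fderiv_eq, norm_smul, Real.norm_of_nonneg inv_pos.le]
  constructor
  · exact le_max_of_le_left ((mul_le_mul_of_nonneg_left (hM₁ _) inv_pos.le).trans
      (mul_le_of_le_one_left M₁_nonneg inv_le_one))
  · have scaled_bound := hM₂ (((n : ℝ) + 1)⁻¹ • x)
    rw [Pi.smul_apply', norm_smul, norm_norm, norm_smul, Real.norm_of_nonneg inv_pos.le]
      at scaled_bound
    exact le_max_of_le_right (by linarith)

lemma tendsto_eulerDiv_cutoff (x : Space N) :
    Tendsto (fun n => eulerDiv (cutoff N n) x) atTop (𝓝 N) := by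
  simpa [eulerDiv] using! ((tendsto_cutoff x).const_mul (N : ℝ)).add (tendsto_fderiv_cutoff x x)

lemma exists_eulerDiv_cutoff_bound (N : ℕ) :
    ∃ M : ℝ, ∀ n (x : Space N), |eulerDiv (cutoff N n) x| ≤ M := by
  obtain ⟨M, -, hM⟩ := exists_fderiv_cutoff_bound N
  refine ⟨N + M, fun n x => (abs_add_le _ _).trans (add_le_add ?_ ?_)⟩
  · rw [abs_mul, Nat.abs_cast, abs_of_nonneg (cutoff_nonneg n x)]
    exact mul_le_of_le_one_right N.cast_nonneg (cutoff_le_one n x)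
  · exact ((fderiv ℝ (cutoff N n) x).le_opNorm x).trans (hM n x).2

lemma ae_fst_ne_snd (hN : 1 ≤ N) :
    ∀ᵐ z : Space N × Space N ∂(volume.prod volume), z.1 ≠ z.2 := by
  have : Nontrivial (Space N) :=
    Module.nontrivial_of_finrank_pos (R := ℝ) (by simpa using Nat.pos_of_ne_zero (by omega))
  have measurableSet_diagonal : MeasurableSet {z : Space N × Space N | ¬z.1 ≠ z.2} := by
    simpa only [not_not] using measurableSet_eq_fun measurable_fst measurable_snd
  rw [ae_iff, Measure.measure_prod_null measurableSet_diagonal]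
  exact Eventually.of_forall fun x => by simp

/-! ### The dilation identity for nonlocal energies -/

/-- The divergence in `x` of `powKernel s ε (x - y) • θ x • x`. -/
def powKernelHalfVar (s ε : ℝ) (θ : Space N → ℝ) (x y : Space N) : ℝ :=
  powKernel s ε (x - y) * eulerDiv θ x
    - s * (powKernel (s + 2) ε (x - y) * inner ℝ (x - y) (θ x • x))

/-- The first variation of the kernel `powKernel s ε (x - y)` under the flow of `x ↦ θ x • x`
acting on both variables. -/
def powKernelVar (s ε : ℝ) (θ : Space N → ℝ) (x y : Space N) : ℝ :=
  powKernelHalfVar s ε θ x y + powKernelHalfVar s ε θ y x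

lemma powKernelVar_eq (s ε : ℝ) (θ : Space N → ℝ) (x y : Space N) :
    powKernelVar s ε θ x y = powKernel s ε (x - y) * (eulerDiv θ x + eulerDiv θ y)
      - s * (powKernel (s + 2) ε (x - y) * inner ℝ (x - y) (θ x • x - θ y • y)) := by
  rw [powKernelVar, powKernelHalfVar, powKernelHalfVar, powKernel_sub_comm s ε y x,
    powKernel_sub_comm (s + 2) ε y x, inner_sub_right (x - y), ← neg_sub x y, inner_neg_left]
  ring

lemma IsTest.powKernel_sub_mul {θ : Space N → ℝ} (hθ : IsTest θ) (s : ℝ) {ε : ℝ} (hε : 0 < ε)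
    (y : Space N) : IsTest fun x => powKernel s ε (x - y) * θ x :=
  hθ.mul_left ((contDiff_powKernel s hε).comp (contDiff_id.sub contDiff_const))

lemma IsTest.fderiv_powKernel_sub_mul {θ : Space N → ℝ} (hθ : IsTest θ) (s : ℝ) {ε : ℝ}
    (hε : 0 < ε) (x y v : Space N) :
    fderiv ℝ (fun x => powKernel s ε (x - y) * θ x) x v
      = powKernel s ε (x - y) * fderiv ℝ θ x v
        - s * (powKernel (s + 2) ε (x - y) * inner ℝ (x - y) v) * θ x := by
  have hasFDerivAt_powKernel : HasFDerivAt (fun x => powKernel s ε (x - y))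
      (fderiv ℝ (powKernel s ε) (x - y)) x :=
    (hasFDerivAt_comp_sub y).2
      ((contDiff_powKernel s hε).differentiable (by simp) (x - y)).hasFDerivAt
  rw [HasFDerivAt.fderiv (f := fun x => powKernel s ε (x - y) * θ x)
    (hasFDerivAt_powKernel.mul (hθ.differentiable x).hasFDerivAt)]
  simp only [FunLike.coe_add, Pi.add_apply, FunLike.coe_smul, Pi.smul_apply, smul_eq_mul,
    fderiv_powKernel s hε]
  ring

lemma IsTest.eulerDiv_powKernel_sub_mul {θ : Space N → ℝ} (hθ : IsTest θ) (s : ℝ) {ε : ℝ}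
    (hε : 0 < ε) (x y : Space N) :
    eulerDiv (fun x => powKernel s ε (x - y) * θ x) x = powKernelHalfVar s ε θ x y := by
  rw [powKernelHalfVar, eulerDiv, eulerDiv, hθ.fderiv_powKernel_sub_mul s hε, inner_smul_right]
  ring

section Bounds

variable {s : ℝ} {θ : Space N → ℝ}

lemma abs_powKernelHalfVar_le (hs : 0 ≤ s) {ε : ℝ} (hε : 0 < ε) {M₁ M₂ : ℝ}
    (hM₁ : ∀ x, ‖eulerDiv θ x‖ ≤ M₁) (hM₂ : ∀ x, ‖θ x • x‖ ≤ M₂) {x y : Space N} (h : x ≠ y) :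
    |powKernelHalfVar s ε θ x y| ≤ (M₁ + s * (ε⁻¹ * M₂)) * powKernel s 0 (x - y) := by
  have := powKernel_nonneg s ε (x - y)
  have := powKernel_nonneg (s + 2) ε (x - y)
  have M₁_nonneg : 0 ≤ M₁ := (norm_nonneg _).trans (hM₁ 0)
  have M₂_nonneg : 0 ≤ M₂ := (norm_nonneg _).trans (hM₂ 0)
  have inner_term_le : powKernel (s + 2) ε (x - y) * |inner ℝ (x - y) (θ x • x)|
      ≤ ε⁻¹ * M₂ * powKernel s ε (x - y) :=
    calc _ ≤ powKernel (s + 2) ε (x - y) * (‖x - y‖ * M₂) := by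
          gcongr
          exact (abs_real_inner_le_norm _ _).trans
            (mul_le_mul_of_nonneg_left (hM₂ x) (norm_nonneg _))
      _ = powKernel (s + 2) ε (x - y) * ‖x - y‖ * M₂ := by ring
      _ ≤ ε⁻¹ * powKernel s ε (x - y) * M₂ :=
          mul_le_mul_of_nonneg_right (powKernel_add_two_mul_norm_le hε _) M₂_nonneg
      _ = _ := by ring
  calc _ ≤ powKernel s ε (x - y) * |eulerDiv θ x|
        + s * (powKernel (s + 2) ε (x - y) * |inner ℝ (x - y) (θ x • x)|) := by
        refine (abs_sub _ _).trans_eq ?_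
        rw [abs_mul, abs_mul, abs_mul, abs_of_nonneg hs, abs_of_nonneg (powKernel_nonneg _ _ _),
          abs_of_nonneg (powKernel_nonneg _ _ _)]
    _ ≤ powKernel s ε (x - y) * M₁ + s * (ε⁻¹ * M₂ * powKernel s ε (x - y)) := by
        gcongr
        exact hM₁ x
    _ = (M₁ + s * (ε⁻¹ * M₂)) * powKernel s ε (x - y) := by ring
    _ ≤ _ := by
        gcongr
        exact powKernel_le_powKernel_zero hs ε (sub_ne_zero.2 h)

lemma abs_powKernelVar_le (hs : 0 ≤ s) (ε : ℝ) {M L : ℝ} (hM : ∀ x, |eulerDiv θ x| ≤ M)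
    (hL0 : 0 ≤ L) (hL : ∀ x y, ‖θ x • x - θ y • y‖ ≤ L * ‖x - y‖) {x y : Space N} (h : x ≠ y) :
    |powKernelVar s ε θ x y| ≤ (2 * M + s * L) * powKernel s 0 (x - y) := by
  have := powKernel_nonneg s ε (x - y)
  have := powKernel_nonneg (s + 2) ε (x - y)
  have M_nonneg : 0 ≤ M := (abs_nonneg _).trans (hM 0)
  have sub_ne_zero : x - y ≠ 0 := sub_ne_zero.2 h
  have inner_term_le : powKernel (s + 2) ε (x - y) * |inner ℝ (x - y) (θ x • x - θ y • y)|
      ≤ L * powKernel s ε (x - y) :=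
    calc _ ≤ powKernel (s + 2) ε (x - y) * (‖x - y‖ * (L * ‖x - y‖)) := by
          gcongr
          exact (abs_real_inner_le_norm _ _).trans
            (mul_le_mul_of_nonneg_left (hL x y) (norm_nonneg _))
      _ = L * (powKernel (s + 2) ε (x - y) * ‖x - y‖ ^ 2) := by ring
      _ ≤ _ := mul_le_mul_of_nonneg_left (powKernel_add_two_mul_norm_sq_le ε sub_ne_zero) hL0
  calc _ ≤ powKernel s ε (x - y) * |eulerDiv θ x + eulerDiv θ y|
        + s * (powKernel (s + 2) ε (x - y) * |inner ℝ (x - y) (θ x • x - θ y • y)|) := by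
        rw [powKernelVar_eq]
        refine (abs_sub _ _).trans_eq ?_
        rw [abs_mul, abs_mul, abs_mul, abs_of_nonneg hs, abs_of_nonneg (powKernel_nonneg _ _ _),
          abs_of_nonneg (powKernel_nonneg _ _ _)]
    _ ≤ powKernel s ε (x - y) * (M + M) + s * (L * powKernel s ε (x - y)) := by
        gcongr
        exact (abs_add_le _ _).trans (add_le_add (hM x) (hM y))
    _ = (2 * M + s * L) * powKernel s ε (x - y) := by ring
    _ ≤ _ := by
        gcongr
        exact powKernel_le_powKernel_zero hs ε sub_ne_zero

lemma tendsto_powKernelVar (θ : Space N → ℝ) {x y : Space N} (h : x ≠ y)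
    {e : ℕ → ℝ} (he : Tendsto e atTop (𝓝 0)) :
    Tendsto (fun n => powKernelVar s (e n) θ x y) atTop (𝓝 (powKernelVar s 0 θ x y)) := by
  have sub_ne_zero : x - y ≠ 0 := sub_ne_zero.2 h
  simp only [powKernelVar_eq]
  exact ((tendsto_powKernel sub_ne_zero he).mul_const _).sub
    (((tendsto_powKernel sub_ne_zero he).mul_const _).const_mul _)

lemma tendsto_powKernelVar_cutoff {x y : Space N} (h : x ≠ y) :
    Tendsto (fun n => powKernelVar s 0 (cutoff N n) x y) atTop
      (𝓝 ((2 * N - s) * powKernel s 0 (x - y))) := by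
  have : 0 < ‖x - y‖ := norm_pos_iff.2 (sub_ne_zero.2 h)
  have powKernel_mul_norm_sq : powKernel (s + 2) 0 (x - y) * ‖x - y‖ ^ 2 = powKernel s 0 (x - y) :=
    by simpa using powKernel_add_two_mul (s := s) (ε := 0) (z := x - y) (by positivity)
  have tendsto_inner : Tendsto (fun n => inner ℝ (x - y) (cutoff N n x • x - cutoff N n y • y))
      atTop (𝓝 (‖x - y‖ ^ 2)) := by
    have := (((tendsto_cutoff x).smul_const x).sub ((tendsto_cutoff y).smul_const y)).inner
      (𝕜 := ℝ) (tendsto_const_nhds (x := x - y))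
    simpa [real_inner_comm, real_inner_self_eq_norm_sq] using this
  simp only [powKernelVar_eq]
  convert! (((tendsto_eulerDiv_cutoff x).add (tendsto_eulerDiv_cutoff y)).const_mul
    (powKernel s 0 (x - y))).sub
    ((tendsto_inner.const_mul (powKernel (s + 2) 0 (x - y))).const_mul s) using 2
  rw [powKernel_mul_norm_sq]
  ring

end Bounds

section Measurability

variable {θ : Space N → ℝ}

lemma IsTest.measurable_powKernelHalfVar (hθ : IsTest θ) (s ε : ℝ) :
    Measurable fun z : Space N × Space N => powKernelHalfVar s ε θ z.1 z.2 := by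
  refine ((measurable_powKernel_sub s ε).mul ?_).sub
    (((measurable_powKernel_sub (s + 2) ε).mul (Continuous.measurable ?_)).const_mul s)
  · exact hθ.continuous_eulerDiv.measurable.comp measurable_fst
  · exact (continuous_fst.sub continuous_snd).inner
      ((hθ.continuous.comp continuous_fst).smul continuous_fst)

lemma IsTest.measurable_powKernelVar (hθ : IsTest θ) (s ε : ℝ) :
    Measurable fun z : Space N × Space N => powKernelVar s ε θ z.1 z.2 := by
  have measurable_half := hθ.measurable_powKernelHalfVar s ε
  have measurable_swap : Measurable fun z : Space N × Space N => (z.2, z.1) := measurable_swap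
  have measurable_half_swap := measurable_half.comp measurable_swap
  exact measurable_half.add measurable_half_swap

end Measurability

section Domination

variable {s : ℝ} {W : Space N × Space N → ℝ}

lemma ae_norm_mul_le_of_le_powKernel (hN : 1 ≤ N) {V : Space N × Space N → ℝ} {C : ℝ}
    (hC : ∀ x y, x ≠ y → |V (x, y)| ≤ C * powKernel s 0 (x - y)) :
    ∀ᵐ z ∂(volume.prod volume), ‖V z * W z‖ ≤ C * ‖powKernel s 0 (z.1 - z.2) * W z‖ := by
  filter_upwards [ae_fst_ne_snd hN] with z hz
  rw [norm_mul, norm_mul, Real.norm_of_nonneg (powKernel_nonneg _ _ _), ← mul_assoc]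
  exact mul_le_mul_of_nonneg_right (hC z.1 z.2 hz) (norm_nonneg _)

lemma integrable_mul_of_le_powKernel (hN : 1 ≤ N) (hW : AEStronglyMeasurable W)
    (hsW : Integrable (fun z => powKernel s 0 (z.1 - z.2) * W z) (volume.prod volume))
    {V : Space N × Space N → ℝ} (hV : Measurable V) {C : ℝ}
    (hC : ∀ x y, x ≠ y → |V (x, y)| ≤ C * powKernel s 0 (x - y)) :
    Integrable (fun z => V z * W z) (volume.prod volume) :=
  (hsW.norm.const_mul C).mono' (hV.aestronglyMeasurable.mul hW)
    (ae_norm_mul_le_of_le_powKernel hN hC)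

lemma tendsto_integral_mul_of_le_powKernel (hN : 1 ≤ N) (hW : AEStronglyMeasurable W)
    (hsW : Integrable (fun z => powKernel s 0 (z.1 - z.2) * W z) (volume.prod volume))
    {V : ℕ → Space N × Space N → ℝ} (hV : ∀ n, Measurable (V n)) {C : ℝ}
    (hC : ∀ n x y, x ≠ y → |V n (x, y)| ≤ C * powKernel s 0 (x - y))
    {V' : Space N × Space N → ℝ}
    (hlim : ∀ x y, x ≠ y → Tendsto (fun n => V n (x, y)) atTop (𝓝 (V' (x, y)))) :
    Tendsto (fun n => ∫ z, V n z * W z ∂(volume.prod volume)) atTop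
      (𝓝 (∫ z, V' z * W z ∂(volume.prod volume))) := by
  refine tendsto_integral_of_dominated_convergence _
    (fun n => (hV n).aestronglyMeasurable.mul hW) (hsW.norm.const_mul C)
    (fun n => ae_norm_mul_le_of_le_powKernel hN (hC n)) ?_
  filter_upwards [ae_fst_ne_snd hN] with z hz
  exact (hlim z.1 z.2 hz).mul_const _

lemma abs_powKernel_le (hs : 0 ≤ s) (ε : ℝ) {x y : Space N} (h : x ≠ y) :
    |powKernel s ε (x - y)| ≤ 1 * powKernel s 0 (x - y) := by
  rw [abs_of_nonneg (powKernel_nonneg _ _ _), one_mul]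
  exact powKernel_le_powKernel_zero hs ε (sub_ne_zero.2 h)

lemma tendsto_integral_powKernel_sub_mul (hN : 1 ≤ N) (hs : 0 ≤ s) (hW : AEStronglyMeasurable W)
    (hsW : Integrable (fun z => powKernel s 0 (z.1 - z.2) * W z) (volume.prod volume))
    {e : ℕ → ℝ} (he : Tendsto e atTop (𝓝 0)) :
    Tendsto (fun n => ∫ z, powKernel s (e n) (z.1 - z.2) * W z ∂(volume.prod volume)) atTop
      (𝓝 (∫ z, powKernel s 0 (z.1 - z.2) * W z ∂(volume.prod volume))) :=
  tendsto_integral_mul_of_le_powKernel hN hW hsW (fun n => measurable_powKernel_sub s (e n))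
    (fun n _ _ => abs_powKernel_le hs (e n)) fun _ _ h => tendsto_powKernel (sub_ne_zero.2 h) he

end Domination

section Dilation

variable {s : ℝ} {F : Space N → ℝ} {Γ : Space N → Space N} {θ : Space N → ℝ}

lemma HasWeakGradient.aestronglyMeasurable_mul_euler (hF : HasWeakGradient F Γ) (hθ : IsTest θ) :
    AEStronglyMeasurable fun z : Space N × Space N => F z.2 * (θ z.1 * inner ℝ (Γ z.1) z.1) :=
  hF.locInt.aestronglyMeasurable.comp_snd.mul (hθ.continuous.aestronglyMeasurable.mul
    (hF.locInt_grad.aestronglyMeasurable.inner continuous_id.aestronglyMeasurable)).comp_fst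

lemma HasWeakGradient.aestronglyMeasurable_prod (hF : HasWeakGradient F Γ) :
    AEStronglyMeasurable fun z : Space N × Space N => F z.1 * F z.2 :=
  hF.locInt.aestronglyMeasurable.comp_fst.mul hF.locInt.aestronglyMeasurable.comp_snd

lemma integrable_powKernelHalfVar_mul (hN : 1 ≤ N) (hs : 0 ≤ s) (hF : HasWeakGradient F Γ)
    (hFF : Integrable (fun z : Space N × Space N => powKernel s 0 (z.1 - z.2) * (F z.1 * F z.2))
      (volume.prod volume))
    (hθ : IsTest θ) {ε : ℝ} (hε : 0 < ε) :
    Integrable (fun z : Space N × Space N => powKernelHalfVar s ε θ z.1 z.2 * (F z.1 * F z.2))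
      (volume.prod volume) := by
  obtain ⟨M₁, hM₁⟩ := hθ.compact_eulerDiv.exists_bound_of_continuous hθ.continuous_eulerDiv
  obtain ⟨M₂, hM₂⟩ := (hθ.compact.smul_right (f' := id)).exists_bound_of_continuous
    (hθ.continuous.smul continuous_id)
  exact integrable_mul_of_le_powKernel hN hF.aestronglyMeasurable_prod hFF
    (hθ.measurable_powKernelHalfVar s ε) fun _ _ => abs_powKernelHalfVar_le hs hε hM₁ hM₂

/-- For fixed `y`, integrate by parts in `x` against the test function
`powKernel s ε (x - y) * θ x`. -/
lemma integral_powKernel_mul_euler (hN : 1 ≤ N) (hs : 0 ≤ s) (hF : HasWeakGradient F Γ)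
    (hFF : Integrable (fun z : Space N × Space N => powKernel s 0 (z.1 - z.2) * (F z.1 * F z.2))
      (volume.prod volume))
    (hθ : IsTest θ)
    (hΓ : Integrable (fun z : Space N × Space N =>
      powKernel s 0 (z.1 - z.2) * (F z.2 * (θ z.1 * inner ℝ (Γ z.1) z.1))) (volume.prod volume))
    {ε : ℝ} (hε : 0 < ε) :
    ∫ z : Space N × Space N, powKernel s ε (z.1 - z.2) * (F z.2 * (θ z.1 * inner ℝ (Γ z.1) z.1))
        ∂(volume.prod volume)
      = -∫ z : Space N × Space N, powKernelHalfVar s ε θ z.1 z.2 * (F z.1 * F z.2)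
        ∂(volume.prod volume) := by
  have integrable_grad := integrable_mul_of_le_powKernel hN (hF.aestronglyMeasurable_mul_euler hθ)
    hΓ (measurable_powKernel_sub s ε) fun _ _ => abs_powKernel_le hs ε
  rw [integral_prod_symm _ integrable_grad,
    integral_prod_symm _ (integrable_powKernelHalfVar_mul hN hs hF hFF hθ hε), ← integral_neg]
  refine integral_congr_ae (Eventually.of_forall fun y => ?_)
  have by_parts := hF.integral_eulerDiv (hθ.powKernel_sub_mul s hε y)
  simp only [hθ.eulerDiv_powKernel_sub_mul s hε] at by_parts
  calc ∫ x, powKernel s ε (x - y) * (F y * (θ x * inner ℝ (Γ x) x))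
      = F y * ∫ x, powKernel s ε (x - y) * θ x * inner ℝ (Γ x) x := by
        rw [← integral_const_mul]
        congr 1 with x
        ring
    _ = -(F y * ∫ x, F x * powKernelHalfVar s ε θ x y) := by rw [by_parts, mul_neg, neg_neg]
    _ = -∫ x, powKernelHalfVar s ε θ x y * (F x * F y) := by
        rw [← integral_const_mul]
        congr 2 with x
        ring

lemma integral_powKernelVar_mul (hN : 1 ≤ N) (hs : 0 ≤ s) (hF : HasWeakGradient F Γ)
    (hFF : Integrable (fun z : Space N × Space N => powKernel s 0 (z.1 - z.2) * (F z.1 * F z.2))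
      (volume.prod volume))
    (hθ : IsTest θ) {ε : ℝ} (hε : 0 < ε) :
    ∫ z : Space N × Space N, powKernelVar s ε θ z.1 z.2 * (F z.1 * F z.2) ∂(volume.prod volume)
      = 2 * ∫ z : Space N × Space N, powKernelHalfVar s ε θ z.1 z.2 * (F z.1 * F z.2)
        ∂(volume.prod volume) := by
  have integrable_half := integrable_powKernelHalfVar_mul hN hs hF hFF hθ hε
  have integral_swap := integral_prod_swap (μ := (volume : Measure (Space N))) (ν := volume)
    fun z : Space N × Space N => powKernelHalfVar s ε θ z.1 z.2 * (F z.1 * F z.2)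
  rw [two_mul]
  nth_rewrite 2 [← integral_swap]
  refine Eq.trans ?_ (integral_add integrable_half integrable_half.swap)
  congr 1 with z
  simp only [powKernelVar, Prod.fst_swap, Prod.snd_swap]
  ring

lemma integral_powKernel_zero_mul_euler (hN : 1 ≤ N) (hs : 0 ≤ s) (hF : HasWeakGradient F Γ)
    (hFF : Integrable (fun z : Space N × Space N => powKernel s 0 (z.1 - z.2) * (F z.1 * F z.2))
      (volume.prod volume))
    (hθ : IsTest θ)
    (hΓ : Integrable (fun z : Space N × Space N =>
      powKernel s 0 (z.1 - z.2) * (F z.2 * (θ z.1 * inner ℝ (Γ z.1) z.1))) (volume.prod volume)) :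
    ∫ z : Space N × Space N, powKernel s 0 (z.1 - z.2) * (F z.2 * (θ z.1 * inner ℝ (Γ z.1) z.1))
        ∂(volume.prod volume)
      = -(1 / 2) * ∫ z : Space N × Space N, powKernelVar s 0 θ z.1 z.2 * (F z.1 * F z.2)
        ∂(volume.prod volume) := by
  obtain ⟨M, hM⟩ := hθ.compact_eulerDiv.exists_bound_of_continuous hθ.continuous_eulerDiv
  obtain ⟨L, hL0, hL⟩ := hθ.exists_lipschitz_smul
  set e : ℕ → ℝ := fun n => 1 / ((n : ℝ) + 1)
  have tendsto_e : Tendsto e atTop (𝓝 0) := tendsto_one_div_add_atTop_nhds_zero_nat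
  have tendsto_grad := tendsto_integral_powKernel_sub_mul hN hs
    (hF.aestronglyMeasurable_mul_euler hθ) hΓ tendsto_e
  have tendsto_var := tendsto_integral_mul_of_le_powKernel hN hF.aestronglyMeasurable_prod hFF
    (fun n => hθ.measurable_powKernelVar s (e n))
    (fun n _ _ => abs_powKernelVar_le hs (e n) hM hL0 hL)
    (V' := fun z => powKernelVar s 0 θ z.1 z.2)
    (fun _ _ h => tendsto_powKernelVar θ h tendsto_e)
  refine tendsto_nhds_unique tendsto_grad ((tendsto_var.const_mul (-(1 / 2))).congr fun n => ?_)
  have e_pos : 0 < e n := by positivity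
  rw [integral_powKernel_mul_euler hN hs hF hFF hθ hΓ e_pos,
    integral_powKernelVar_mul hN hs hF hFF hθ e_pos]
  ring

theorem tendsto_integral_powKernel_mul_euler_cutoff (hN : 1 ≤ N) (hs : 0 ≤ s)
    (hF : HasWeakGradient F Γ)
    (hFF : Integrable (fun z : Space N × Space N => powKernel s 0 (z.1 - z.2) * (F z.1 * F z.2))
      (volume.prod volume))
    (hΓ : ∀ n, Integrable (fun z : Space N × Space N =>
      powKernel s 0 (z.1 - z.2) * (F z.2 * (cutoff N n z.1 * inner ℝ (Γ z.1) z.1)))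
      (volume.prod volume)) :
    Tendsto (fun n => ∫ z : Space N × Space N,
        powKernel s 0 (z.1 - z.2) * (F z.2 * (cutoff N n z.1 * inner ℝ (Γ z.1) z.1))
          ∂(volume.prod volume)) atTop
      (𝓝 (-(N - s / 2) * ∫ z : Space N × Space N, powKernel s 0 (z.1 - z.2) * (F z.1 * F z.2)
        ∂(volume.prod volume))) := by
  obtain ⟨M, hM⟩ := exists_eulerDiv_cutoff_bound N
  obtain ⟨L, hL0, hL⟩ := exists_lipschitz_cutoff_smul N
  have tendsto_var := tendsto_integral_mul_of_le_powKernel hN hF.aestronglyMeasurable_prod hFF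
    (fun n => (isTest_cutoff n).measurable_powKernelVar s 0)
    (fun n _ _ => abs_powKernelVar_le hs 0 (hM n) hL0 (hL n))
    (V' := fun z => (2 * N - s) * powKernel s 0 (z.1 - z.2))
    fun _ _ => tendsto_powKernelVar_cutoff
  simp only [fun n =>
    integral_powKernel_zero_mul_euler hN hs hF hFF (isTest_cutoff n) (hΓ n)]
  convert! tendsto_var.const_mul (-(1 / 2)) using 2
  simp only [mul_assoc, integral_const_mul]
  ring

end Dilation

/-! ### Decay of the regularised kernels -/

section Comparison

variable {E : Type*} [NormedAddCommGroup E]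

lemma powKernel_mul_powKernel (s t : ℝ) {ε : ℝ} (hε : 0 < ε) (z : E) :
    powKernel s ε z * powKernel t ε z = powKernel (s + t) ε z := by
  rw [powKernel, powKernel, powKernel, ← Real.rpow_add (by positivity), neg_add, add_div]

lemma powKernel_one_zero (s : ℝ) : powKernel s 1 (0 : E) = 1 := by simp [powKernel]

lemma powKernel_le_of_le {s ε D : ℝ} (hs : 0 ≤ s) (hD : 0 < D) {z x : E}
    (h : 1 + ‖x‖ ^ 2 ≤ D * (‖z‖ ^ 2 + ε ^ 2)) :
    powKernel s ε z ≤ D ^ (s / 2) * powKernel s 1 x := by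
  have D_rpow : D ^ (s / 2) = D⁻¹ ^ (-s / 2) := by
    rw [Real.inv_rpow hD.le, ← Real.rpow_neg hD.le, neg_div, neg_neg]
  rw [powKernel, powKernel, D_rpow, ← Real.mul_rpow (by positivity) (by positivity)]
  refine Real.rpow_le_rpow_of_nonpos (by positivity) ?_ (by linarith)
  rw [inv_mul_le_iff₀ hD]
  linarith

lemma exists_powKernel_sub_le {s ε : ℝ} (hs : 0 ≤ s) (hε : 0 < ε) (R : ℝ) :
    ∃ C : ℝ, 0 ≤ C ∧ ∀ x y : E, ‖y‖ ≤ R → powKernel s ε (x - y) ≤ C * powKernel s 1 x := by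
  refine ⟨(2 + (1 + 2 * R ^ 2) / ε ^ 2) ^ (s / 2), by positivity, fun x y hy =>
    powKernel_le_of_le hs (by positivity) ?_⟩
  have norm_le : ‖x‖ ≤ ‖x - y‖ + ‖y‖ := by simpa using norm_add_le (x - y) y
  have norm_sq_le : ‖x‖ ^ 2 ≤ 2 * ‖x - y‖ ^ 2 + 2 * R ^ 2 := by
    nlinarith [sq_nonneg (‖x - y‖ - ‖y‖), norm_nonneg x, norm_nonneg y, norm_nonneg (x - y)]
  calc 1 + ‖x‖ ^ 2 ≤ 2 * ‖x - y‖ ^ 2 + (1 + 2 * R ^ 2) := by linarith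
    _ ≤ 2 * ‖x - y‖ ^ 2 + (1 + 2 * R ^ 2)
        + (2 * ε ^ 2 + (1 + 2 * R ^ 2) / ε ^ 2 * ‖x - y‖ ^ 2) :=
        le_add_of_nonneg_right (by positivity)
    _ = (2 + (1 + 2 * R ^ 2) / ε ^ 2) * (‖x - y‖ ^ 2 + ε ^ 2) := by field_simp; ring

lemma powKernel_smul_self [NormedSpace ℝ E] (s : ℝ) {ε : ℝ} (hε : 0 < ε) (z : E) :
    powKernel s ε (ε • z) = ε ^ (-s) * powKernel s 1 z := by
  rw [powKernel, powKernel, norm_smul, Real.norm_of_nonneg hε.le,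
    show (ε * ‖z‖) ^ 2 + ε ^ 2 = ε ^ 2 * (‖z‖ ^ 2 + 1 ^ 2) by ring,
    Real.mul_rpow (by positivity) (by positivity), ← Real.rpow_natCast_mul hε.le]
  congr 2
  push_cast
  ring

end Comparison

lemma integrable_powKernel_one {s : ℝ} (h : N < s) : Integrable (powKernel s 1 : Space N → ℝ) :=
  (integrable_rpow_neg_one_add_norm_sq (μ := volume) (by simpa using h)).congr
    (Eventually.of_forall fun x => by simp [powKernel, add_comm])

lemma memLp_powKernel_one {s t : ℝ} (ht : 0 < t) (h : N < s * t) :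
    MemLp (powKernel s 1 : Space N → ℝ) (ENNReal.ofReal t) := by
  rw [← integrable_norm_rpow_iff (measurable_powKernel s 1).aestronglyMeasurable (by simpa using ht)
    ENNReal.ofReal_ne_top, ENNReal.toReal_ofReal ht.le]
  refine (integrable_powKernel_one h).congr (Eventually.of_forall fun x => ?_)
  simp only [powKernel]
  rw [Real.norm_of_nonneg (by positivity),
    ← Real.rpow_mul (by positivity)]
  congr 1
  ring

lemma memLp_two_powKernel_one {s : ℝ} (h : N < 2 * s) :
    MemLp (powKernel s 1 : Space N → ℝ) 2 := by
  simpa using memLp_powKernel_one (t := 2) two_pos (by linarith)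

/-- A rescaled integrable profile of mass `∫ powKernel (N + 2) 1`, hence an approximate identity as
`ε → 0`; up to the factor `(N - 2) * N` it is the negative Laplacian of `powKernel (N - 2) ε`. -/
def approxDelta (ε : ℝ) (z : Space N) : ℝ := ε ^ 2 * powKernel (N + 2) ε z

lemma integral_mul_approxDelta_eq {ε : ℝ} (hε : 0 < ε) (ψ : Space N → ℝ) (x : Space N) :
    ∫ y, ψ y * approxDelta ε (x - y) = ∫ z, ψ (x - ε • z) * powKernel (N + 2) 1 z := by
  have approxDelta_smul (z : Space N) :
      approxDelta ε (ε • z) = (ε ^ N)⁻¹ * powKernel (N + 2) 1 z := by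
    rw [approxDelta, powKernel_smul_self _ hε, Real.rpow_neg hε.le, Real.rpow_add hε,
      Real.rpow_natCast, Real.rpow_two]
    field_simp
  have rescaled := Measure.integral_comp_smul volume
    (fun z : Space N => ψ (x - z) * approxDelta ε z) ε
  rw [finrank_euclideanSpace_fin, abs_of_pos (by positivity), smul_eq_mul,
    eq_inv_mul_iff_mul_eq₀ (by positivity), ← integral_const_mul] at rescaled
  calc ∫ y, ψ y * approxDelta ε (x - y)
      = ∫ z : Space N, ψ (x - z) * approxDelta ε z := by
        rw [← integral_sub_left_eq_self _ volume x]
        simp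
    _ = ∫ z, ψ (x - ε • z) * powKernel (N + 2) 1 z := by
        rw [← rescaled]
        congr 1 with z
        rw [approxDelta_smul]
        field_simp

lemma IsTest.exists_radius {ψ : Space N → ℝ} (hψ : IsTest ψ) :
    ∃ R : ℝ, 1 ≤ R ∧ ∀ y, ψ y ≠ 0 → ‖y‖ ≤ R := by
  obtain ⟨R, hR⟩ := hψ.compact.isCompact.isBounded.subset_closedBall (0 : Space N)
  refine ⟨max 1 R, le_max_left _ _, fun y hy => le_max_of_le_right ?_⟩
  simpa using hR (subset_tsupport ψ hy)

lemma abs_integral_mul_approxDelta_le {ψ : Space N → ℝ} {M ε : ℝ} (hψ : ∀ x, |ψ x| ≤ M)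
    (hε : 0 < ε) (x : Space N) :
    |∫ y, ψ y * approxDelta ε (x - y)| ≤ M * ∫ z : Space N, powKernel (N + 2) 1 z := by
  rw [integral_mul_approxDelta_eq hε, ← integral_const_mul, ← Real.norm_eq_abs]
  refine norm_integral_le_of_norm_le ((integrable_powKernel_one (by linarith)).const_mul M)
    (Eventually.of_forall fun z => ?_)
  rw [norm_mul, Real.norm_of_nonneg (powKernel_nonneg _ _ _)]
  exact mul_le_mul_of_nonneg_right (hψ _) (powKernel_nonneg _ _ _)

lemma approxDelta_sub_le {R ε : ℝ} (hR : 1 ≤ R) (hε : 0 < ε) (hε1 : ε ≤ 1) {x y : Space N}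
    (hx : 2 * R < ‖x‖) (hy : ‖y‖ ≤ R) :
    approxDelta ε (x - y) ≤ 8 ^ (((N : ℝ) + 2) / 2) * powKernel (N + 2) 1 x := by
  have norm_le : ‖x‖ ≤ ‖x - y‖ + ‖y‖ := by simpa using norm_add_le (x - y) y
  have half_norm_sq_le : (‖x‖ / 2) ^ 2 ≤ ‖x - y‖ ^ 2 :=
    pow_le_pow_left₀ (by positivity) (by linarith) 2
  have one_le_norm_sq : 1 ≤ ‖x‖ ^ 2 := one_le_pow₀ (by linarith)
  calc approxDelta ε (x - y) ≤ powKernel (N + 2) ε (x - y) :=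
        mul_le_of_le_one_left (powKernel_nonneg _ _ _) (pow_le_one₀ hε.le hε1)
    _ ≤ _ := powKernel_le_of_le (by positivity) (by norm_num) (by linarith [sq_nonneg ε])

lemma abs_integral_mul_approxDelta_le_of_lt_norm {ψ : Space N → ℝ} (hψ : Integrable ψ) {R ε : ℝ}
    (hR : 1 ≤ R) (hψR : ∀ y, ψ y ≠ 0 → ‖y‖ ≤ R) (hε : 0 < ε) (hε1 : ε ≤ 1) {x : Space N}
    (hx : 2 * R < ‖x‖) :
    |∫ y, ψ y * approxDelta ε (x - y)|
      ≤ (∫ y, |ψ y|) * (8 ^ (((N : ℝ) + 2) / 2) * powKernel (N + 2) 1 x) := by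
  rw [← integral_mul_const, ← Real.norm_eq_abs]
  refine norm_integral_le_of_norm_le (hψ.abs.mul_const _) (Eventually.of_forall fun y => ?_)
  have approxDelta_nonneg : 0 ≤ approxDelta ε (x - y) :=
    mul_nonneg (by positivity) (powKernel_nonneg _ _ _)
  rw [norm_mul, Real.norm_eq_abs, Real.norm_of_nonneg approxDelta_nonneg]
  rcases eq_or_ne (ψ y) 0 with hy | hy
  · simp [hy]
  · exact mul_le_mul_of_nonneg_left (approxDelta_sub_le hR hε hε1 hx (hψR y hy)) (abs_nonneg _)

lemma IsTest.exists_integral_mul_approxDelta_le {ψ : Space N → ℝ} (hψ : IsTest ψ) :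
    ∃ C : ℝ, 0 ≤ C ∧ ∀ ε : ℝ, 0 < ε → ε ≤ 1 → ∀ x,
      |∫ y, ψ y * approxDelta ε (x - y)| ≤ C * powKernel (N + 2) 1 x := by
  obtain ⟨R, one_le_R, hR⟩ := hψ.exists_radius
  obtain ⟨M, M_nonneg, hM⟩ := hψ.exists_bound
  have mass_nonneg : 0 ≤ ∫ z : Space N, powKernel (N + 2) 1 z :=
    integral_nonneg fun z => powKernel_nonneg _ _ _
  have near_nonneg : 0 ≤ (M * ∫ z : Space N, powKernel (N + 2) 1 z)
      * (1 + 4 * R ^ 2) ^ (((N : ℝ) + 2) / 2) := by positivity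
  have far_nonneg : 0 ≤ (∫ y, |ψ y|) * 8 ^ (((N : ℝ) + 2) / 2) :=
    mul_nonneg (integral_nonneg fun _ => abs_nonneg _) (by positivity)
  refine ⟨_, add_nonneg near_nonneg far_nonneg, fun ε hε hε1 x => ?_⟩
  have decay_nonneg := powKernel_nonneg (N + 2) 1 x
  rcases le_or_gt ‖x‖ (2 * R) with hx | hx
  · have norm_sq_le : ‖x‖ ^ 2 ≤ (2 * R) ^ 2 := pow_le_pow_left₀ (norm_nonneg x) hx 2
    have one_le : 1 ≤ (1 + 4 * R ^ 2) ^ (((N : ℝ) + 2) / 2) * powKernel (N + 2) 1 x := by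
      have base_le : 1 + ‖x‖ ^ 2 ≤ (1 + 4 * R ^ 2) * (‖(0 : Space N)‖ ^ 2 + 1 ^ 2) := by
        rw [norm_zero]
        linarith
      simpa only [powKernel_one_zero] using
        powKernel_le_of_le (s := N + 2) (by positivity) (by positivity) base_le
    calc _ ≤ M * ∫ z : Space N, powKernel (N + 2) 1 z := abs_integral_mul_approxDelta_le hM hε x
      _ ≤ _ := le_mul_of_one_le_right (mul_nonneg M_nonneg mass_nonneg) one_le
      _ = _ := (mul_assoc _ _ _).symm
      _ ≤ _ := mul_le_mul_of_nonneg_right (le_add_of_nonneg_right far_nonneg) decay_nonneg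
  · calc _ ≤ _ :=
          abs_integral_mul_approxDelta_le_of_lt_norm hψ.integrable one_le_R hR hε hε1 hx
      _ = _ := (mul_assoc _ _ _).symm
      _ ≤ _ := mul_le_mul_of_nonneg_right (le_add_of_nonneg_left near_nonneg) decay_nonneg

lemma IsTest.tendsto_integral_mul_approxDelta {ψ : Space N → ℝ} (hψ : IsTest ψ) {e : ℕ → ℝ}
    (he0 : ∀ n, 0 < e n) (he : Tendsto e atTop (𝓝 0)) (x : Space N) :
    Tendsto (fun n => ∫ y, ψ y * approxDelta (e n) (x - y)) atTop
      (𝓝 (ψ x * ∫ z : Space N, powKernel (N + 2) 1 z)) := by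
  obtain ⟨M, -, hM⟩ := hψ.exists_bound
  simp only [fun n => integral_mul_approxDelta_eq (he0 n) ψ x]
  rw [← integral_const_mul]
  refine tendsto_integral_of_dominated_convergence (fun z => M * powKernel (N + 2) 1 z)
    (fun n => ?_) ((integrable_powKernel_one (by linarith)).const_mul M)
    (fun n => Eventually.of_forall fun z => ?_) (Eventually.of_forall fun z => ?_)
  · exact (hψ.continuous.comp
      (continuous_const.sub (continuous_const_smul _))).aestronglyMeasurable.mul
      (measurable_powKernel _ _).aestronglyMeasurable
  · rw [norm_mul, Real.norm_of_nonneg (powKernel_nonneg _ _ _)]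
    exact mul_le_mul_of_nonneg_right (hM _) (powKernel_nonneg _ _ _)
  · have points_tendsto : Tendsto (fun n => x - e n • z) atTop (𝓝 x) := by
      simpa using (he.smul_const z).const_sub x
    exact ((hψ.continuous.tendsto x).comp points_tendsto).mul_const _

/-! ### Removal of cutoffs -/

lemma integrable_inner_of_hasCompactSupport {G V : Space N → Space N} (hG : LocallyIntegrable G)
    (hV : Continuous V) (hc : HasCompactSupport V) : Integrable fun x => inner ℝ (G x) (V x) :=
  (LocallyIntegrable.integrable_smul_left_of_hasCompactSupport
    (fun x => (hG x).norm) hV.norm hc.norm).mono'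
    (hG.aestronglyMeasurable.inner hV.aestronglyMeasurable)
    (Eventually.of_forall fun _ => (norm_inner_le_norm _ _).trans_eq (mul_comm _ _))

lemma IsTest.integrable_fderiv_apply {θ : Space N → ℝ} (hθ : IsTest θ) {G : Space N → Space N}
    (hG : LocallyIntegrable G) : Integrable fun x => fderiv ℝ θ x (G x) := by
  simpa only [inner_gradient_right, conj_trivial] using
    integrable_inner_of_hasCompactSupport hG hθ.continuous_gradient hθ.compact_gradient

lemma IsTest.aestronglyMeasurable_fderiv_apply {θ : Space N → ℝ} (hθ : IsTest θ)
    {G : Space N → Space N} (hG : AEStronglyMeasurable G) :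
    AEStronglyMeasurable fun x => fderiv ℝ θ x (G x) := by
  simpa only [inner_gradient_right, conj_trivial] using
    hG.inner (𝕜 := ℝ) hθ.continuous_gradient.aestronglyMeasurable

lemma tendsto_integral_mul_cutoff {f : Space N → ℝ} (hf : Integrable f) :
    Tendsto (fun n => ∫ x, f x * cutoff N n x) atTop (𝓝 (∫ x, f x)) := by
  refine tendsto_integral_of_dominated_convergence (fun x => ‖f x‖)
    (fun n => hf.1.mul (isTest_cutoff n).continuous.aestronglyMeasurable) hf.norm
    (fun n => Eventually.of_forall fun x => ?_) (Eventually.of_forall fun x => ?_)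
  · rw [norm_mul, Real.norm_of_nonneg (cutoff_nonneg n x)]
    exact mul_le_of_le_one_right (norm_nonneg _) (cutoff_le_one n x)
  · simpa using (tendsto_cutoff x).const_mul (f x)

lemma tendsto_integral_mul_eulerDiv_cutoff {f : Space N → ℝ} (hf : Integrable f) :
    Tendsto (fun n => ∫ x, f x * eulerDiv (cutoff N n) x) atTop (𝓝 (N * ∫ x, f x)) := by
  obtain ⟨M, hM⟩ := exists_eulerDiv_cutoff_bound N
  rw [← integral_const_mul]
  refine tendsto_integral_of_dominated_convergence (fun x => ‖f x‖ * M)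
    (fun n => hf.1.mul (isTest_cutoff n).continuous_eulerDiv.aestronglyMeasurable)
    (hf.norm.mul_const _)
    (fun n => Eventually.of_forall fun x => ?_) (Eventually.of_forall fun x => ?_)
  · rw [norm_mul]
    exact mul_le_mul_of_nonneg_left (hM n x) (norm_nonneg _)
  · simpa only [mul_comm] using (tendsto_eulerDiv_cutoff x).const_mul (f x)

lemma one_le_mul_powKernel_one {E : Type*} [NormedAddCommGroup E] (x : E) :
    1 ≤ (1 + ‖x‖) * powKernel 1 1 x := by
  have powKernel_eq : powKernel 1 1 x = (Real.sqrt (‖x‖ ^ 2 + 1 ^ 2))⁻¹ := by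
    rw [powKernel, Real.sqrt_eq_rpow, ← Real.rpow_neg (by positivity), neg_div]
  rw [powKernel_eq, ← div_eq_mul_inv, one_le_div (by positivity),
    Real.sqrt_le_left (by positivity)]
  nlinarith [norm_nonneg x]

lemma exists_norm_fderiv_cutoff_le_powKernel (N : ℕ) :
    ∃ C : ℝ, ∀ n (x : Space N), ‖fderiv ℝ (cutoff N n) x‖ ≤ C * powKernel 1 1 x := by
  obtain ⟨M, -, hM⟩ := exists_fderiv_cutoff_bound N
  refine ⟨2 * M, fun n x => ?_⟩
  calc ‖fderiv ℝ (cutoff N n) x‖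
      ≤ ‖fderiv ℝ (cutoff N n) x‖ * ((1 + ‖x‖) * powKernel 1 1 x) :=
        le_mul_of_one_le_right (norm_nonneg _) (one_le_mul_powKernel_one x)
    _ = (‖fderiv ℝ (cutoff N n) x‖ + ‖fderiv ℝ (cutoff N n) x‖ * ‖x‖) * powKernel 1 1 x := by ring
    _ ≤ 2 * M * powKernel 1 1 x :=
        mul_le_mul_of_nonneg_right (by linarith [(hM n x).1, (hM n x).2]) (powKernel_nonneg _ _ _)

lemma tendsto_integral_fderiv_cutoff {G : Space N → Space N} (hG : AEStronglyMeasurable G)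
    (hi : Integrable fun x => powKernel 1 1 x * ‖G x‖) :
    Tendsto (fun n => ∫ x, fderiv ℝ (cutoff N n) x (G x)) atTop (𝓝 0) := by
  obtain ⟨C, hC⟩ := exists_norm_fderiv_cutoff_le_powKernel N
  rw [← integral_zero (Space N) ℝ]
  refine tendsto_integral_of_dominated_convergence (fun x => C * (powKernel 1 1 x * ‖G x‖))
    (fun n => (isTest_cutoff n).aestronglyMeasurable_fderiv_apply hG) (hi.const_mul _)
    (fun n => Eventually.of_forall fun x => ?_)
    (Eventually.of_forall fun x => tendsto_fderiv_cutoff x (G x))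
  rw [← mul_assoc]
  exact (ContinuousLinearMap.le_opNorm _ _).trans
    (mul_le_mul_of_nonneg_right (hC n x) (norm_nonneg _))

lemma integrable_powKernel_one_mul_norm {G : Space N → Space N} (hG : Integrable G) :
    Integrable fun x => powKernel 1 1 x * ‖G x‖ := by
  refine hG.norm.bdd_mul (c := 1) (measurable_powKernel _ _).aestronglyMeasurable
    (Eventually.of_forall fun x => ?_)
  rw [Real.norm_of_nonneg (powKernel_nonneg _ _ _)]
  exact Real.rpow_le_one_of_one_le_of_nonpos (by nlinarith [sq_nonneg ‖x‖]) (by norm_num)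

/-! ### Representation of solutions of the Poisson equation -/

/-- `φ` is a weak solution of `-Δφ = S` on `ℝᴺ`, with weak gradient `H`. -/
structure IsPoissonSolution (φ S : Space N → ℝ) (H : Space N → Space N) : Prop where
  hasWeakGradient : HasWeakGradient φ H
  integral_inner_gradient : ∀ ψ : Space N → ℝ, IsTest ψ →
    ∫ x, inner ℝ (H x) (∇ ψ x) = ∫ x, S x * ψ x

section Truncated

variable {φ S θ : Space N → ℝ} {H : Space N → Space N} {ε : ℝ}

lemma IsPoissonSolution.integral_mul_powKernel_mul (h : IsPoissonSolution φ S H) (hε : 0 < ε)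
    (y : Space N) (hθ : IsTest θ) :
    ∫ x, S x * (powKernel (N - 2) ε (x - y) * θ x)
      = (∫ x, fderiv ℝ θ x (powKernel (N - 2) ε (x - y) • H x))
        - (N - 2) * ∫ x, powKernel N ε (x - y) * θ x * inner ℝ (H x) (x - y) := by
  have continuous_powKernel (s : ℝ) : Continuous fun x : Space N => powKernel s ε (x - y) :=
    (contDiff_powKernel s hε).continuous.comp (continuous_id.sub continuous_const)
  have integrable_cutoff :
      Integrable fun x => fderiv ℝ θ x (powKernel (N - 2) ε (x - y) • H x) := by
    refine (integrable_inner_of_hasCompactSupport h.hasWeakGradient.locInt_grad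
      (V := fun x => powKernel (N - 2) ε (x - y) • ∇ θ x) ?_ ?_).congr
      (Eventually.of_forall fun x => ?_)
    · exact (continuous_powKernel (N - 2)).smul hθ.continuous_gradient
    · exact hθ.compact_gradient.mono fun x hx hx0 => hx (by simp only [hx0, smul_zero])
    · simp only [inner_smul_right, inner_gradient_right, conj_trivial, map_smul, smul_eq_mul]
  have integrable_kernel :
      Integrable fun x => powKernel N ε (x - y) * θ x * inner ℝ (H x) (x - y) := by
    refine (integrable_inner_of_hasCompactSupport h.hasWeakGradient.locInt_grad
      (V := fun x => (powKernel N ε (x - y) * θ x) • (x - y)) ?_ ?_).congr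
      (Eventually.of_forall fun x => inner_smul_right _ _ _)
    · exact (hθ.powKernel_sub_mul N hε y).continuous.smul (continuous_id.sub continuous_const)
    · exact (hθ.powKernel_sub_mul N hε y).compact.smul_right
  rw [← h.integral_inner_gradient _ (hθ.powKernel_sub_mul (N - 2) hε y), ← integral_const_mul,
    ← integral_sub integrable_cutoff (integrable_kernel.const_mul _)]
  congr 1 with x
  rw [inner_gradient_right, conj_trivial, hθ.fderiv_powKernel_sub_mul _ hε, sub_add_cancel,
    real_inner_comm, map_smul, smul_eq_mul]
  ring

lemma HasWeakGradient.integral_mul_approxDelta_mul (h : HasWeakGradient φ H) (hε : 0 < ε)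
    (y : Space N) (hθ : IsTest θ) :
    -∫ x, powKernel N ε (x - y) * θ x * inner ℝ (H x) (x - y)
      = N * (∫ x, φ x * approxDelta ε (x - y) * θ x)
        + ∫ x, fderiv ℝ θ x ((φ x * powKernel N ε (x - y)) • (x - y)) := by
  have continuous_powKernel (s : ℝ) : Continuous fun x : Space N => powKernel s ε (x - y) :=
    (contDiff_powKernel s hε).continuous.comp (continuous_id.sub continuous_const)
  have integrable_delta : Integrable fun x => φ x * approxDelta ε (x - y) * θ x := by
    refine ((hθ.powKernel_sub_mul (N + 2) hε y).integrable_mul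
      h.locInt).const_mul (ε ^ 2) |>.congr (Eventually.of_forall fun x => ?_)
    simp only [approxDelta]
    ring
  have integrable_cutoff :
      Integrable fun x => fderiv ℝ θ x ((φ x * powKernel N ε (x - y)) • (x - y)) := by
    refine (h.locInt.integrable_smul_right_of_hasCompactSupport
      (g := fun x => powKernel N ε (x - y) * fderiv ℝ θ x (x - y)) ?_ ?_).congr
      (Eventually.of_forall fun x => ?_)
    · exact (continuous_powKernel N).mul
        (hθ.continuous_fderiv.clm_apply (continuous_id.sub continuous_const))
    · exact ((hθ.compact.fderiv ℝ).mono fun x hx h0 => hx (by simp [h0]))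
    · simp only [map_smul, smul_eq_mul]
      ring
  rw [← h.integral_euler (hθ.powKernel_sub_mul N hε y) y, ← integral_const_mul,
    ← integral_add (integrable_delta.const_mul _) integrable_cutoff]
  congr 1 with x
  have powKernel_eq := powKernel_add_two_mul (s := N) (ε := ε) (z := x - y) (by positivity)
  rw [hθ.fderiv_powKernel_sub_mul _ hε, real_inner_self_eq_norm_sq, map_smul, smul_eq_mul,
    approxDelta]
  linear_combination -N * φ x * θ x * powKernel_eq

end Truncated

lemma integrable_mul_powKernel_sub {f : Space N → ℝ} {s ε : ℝ} (hs : 0 ≤ s) (hε : 0 < ε)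
    (y : Space N) (hf : AEStronglyMeasurable f) (hi : Integrable fun x => f x * powKernel s 1 x) :
    Integrable fun x => f x * powKernel s ε (x - y) := by
  obtain ⟨C, -, hC⟩ := exists_powKernel_sub_le (E := Space N) hs hε ‖y‖
  refine (hi.norm.const_mul C).mono' (hf.mul (((measurable_powKernel s ε).comp
    (measurable_id.sub_const y)).aestronglyMeasurable)) (Eventually.of_forall fun x => ?_)
  rw [norm_mul, norm_mul, Real.norm_of_nonneg (powKernel_nonneg _ _ _),
    Real.norm_of_nonneg (powKernel_nonneg _ _ _), mul_left_comm]
  exact mul_le_mul_of_nonneg_left (hC x y le_rfl) (norm_nonneg _)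

lemma integrable_mul_powKernel_one_of_memLp_two {f : Space N → ℝ} {s : ℝ} (hs : N < 2 * s)
    (hf : MemLp f 2) : Integrable fun x => f x * powKernel s 1 x :=
  hf.integrable_mul (memLp_two_powKernel_one hs)

lemma integrable_mul_powKernel_one_of_memLp (hN : 3 ≤ N) {S : Space N → ℝ}
    (hS : MemLp S (ENNReal.ofReal (2 * N / (N + 2)))) :
    Integrable fun x => S x * powKernel (N - 2) 1 x := by
  have three_le : (3 : ℝ) ≤ N := by exact_mod_cast hN
  have sub_ne_zero : (N : ℝ) - 2 ≠ 0 := by linarith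
  have one_lt : (1 : ℝ) < 2 * N / (N + 2) := by
    rw [lt_div_iff₀ (by positivity)]
    linarith
  have holderConjugate : (2 * N / (N + 2) : ℝ).HolderConjugate (2 * N / (N - 2)) := by
    refine Real.holderConjugate_iff.2 ⟨one_lt, ?_⟩
    field_simp
    ring
  have := holderConjugate.ennrealOfReal
  refine hS.integrable_mul (q := ENNReal.ofReal (2 * N / (N - 2))) ?_
  refine memLp_powKernel_one holderConjugate.symm.pos ?_
  field_simp
  linarith

lemma integrable_powKernel_one_mul_powKernel_sub (hN : 3 ≤ N) {f : Space N → ℝ} (hf : MemLp f 2)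
    {ε : ℝ} (hε : 0 < ε) (y : Space N) :
    Integrable fun x => powKernel 1 1 x * f x * powKernel (N - 2) ε (x - y) := by
  have three_le : (3 : ℝ) ≤ N := by exact_mod_cast hN
  refine integrable_mul_powKernel_sub (by linarith) hε y
    ((measurable_powKernel _ _).aestronglyMeasurable.mul hf.1) ?_
  refine (integrable_mul_powKernel_one_of_memLp_two (s := 1 + (N - 2)) (by linarith) hf).congr
    (Eventually.of_forall fun x => ?_)
  simp only [← powKernel_mul_powKernel _ _ one_pos]
  ring

section Regularized

variable {φ S : Space N → ℝ} {H : Space N → Space N} {ε : ℝ}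

lemma tendsto_integral_fderiv_cutoff_powKernel_smul (hN : 3 ≤ N) (hH : MemLp H 2) (hε : 0 < ε)
    (y : Space N) :
    Tendsto (fun n => ∫ x, fderiv ℝ (cutoff N n) x (powKernel (N - 2) ε (x - y) • H x)) atTop
      (𝓝 0) := by
  refine tendsto_integral_fderiv_cutoff ((((measurable_powKernel _ _).comp
    (measurable_id.sub_const y)).aestronglyMeasurable).smul hH.1) ?_
  refine (integrable_powKernel_one_mul_powKernel_sub hN hH.norm hε y).congr
    (Eventually.of_forall fun x => ?_)
  simp only [norm_smul, Real.norm_of_nonneg (powKernel_nonneg _ _ _)]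
  ring

lemma tendsto_integral_fderiv_cutoff_mul_smul (hN : 3 ≤ N) (hφ : MemLp φ 2) (hε : 0 < ε)
    (y : Space N) :
    Tendsto (fun n => ∫ x, fderiv ℝ (cutoff N n) x ((φ x * powKernel N ε (x - y)) • (x - y)))
      atTop (𝓝 0) := by
  have measurable_field : AEStronglyMeasurable fun x : Space N =>
      (φ x * powKernel N ε (x - y)) • (x - y) :=
    (hφ.1.mul (((measurable_powKernel _ _).comp
      (measurable_id.sub_const y)).aestronglyMeasurable)).smul
      (continuous_id.sub continuous_const).aestronglyMeasurable
  refine tendsto_integral_fderiv_cutoff measurable_field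
    (((integrable_powKernel_one_mul_powKernel_sub hN hφ.norm hε y).const_mul ε⁻¹).mono'
      ((measurable_powKernel _ _).aestronglyMeasurable.mul measurable_field.norm)
      (Eventually.of_forall fun x => ?_))
  have kernel_le : powKernel N ε (x - y) * ‖x - y‖ ≤ ε⁻¹ * powKernel (N - 2) ε (x - y) := by
    simpa only [sub_add_cancel] using powKernel_add_two_mul_norm_le (s := N - 2) hε (x - y)
  rw [norm_mul, norm_norm, norm_smul, norm_mul, Real.norm_of_nonneg (powKernel_nonneg _ _ _),
    Real.norm_of_nonneg (powKernel_nonneg _ _ _)]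
  calc powKernel 1 1 x * (‖φ x‖ * powKernel N ε (x - y) * ‖x - y‖)
      = powKernel 1 1 x * ‖φ x‖ * (powKernel N ε (x - y) * ‖x - y‖) := by ring
    _ ≤ powKernel 1 1 x * ‖φ x‖ * (ε⁻¹ * powKernel (N - 2) ε (x - y)) :=
        mul_le_mul_of_nonneg_left kernel_le (mul_nonneg (powKernel_nonneg _ _ _) (norm_nonneg _))
    _ = ε⁻¹ * (powKernel 1 1 x * ‖φ x‖ * powKernel (N - 2) ε (x - y)) := by ring

lemma integrable_mul_approxDelta (hφ : MemLp φ 2) (hε : 0 < ε) (y : Space N) :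
    Integrable fun x => φ x * approxDelta ε (x - y) := by
  refine ((integrable_mul_powKernel_sub (s := N + 2) (by positivity) hε y hφ.1
    (integrable_mul_powKernel_one_of_memLp_two (by linarith) hφ)).const_mul (ε ^ 2)).congr
    (Eventually.of_forall fun x => ?_)
  simp only [approxDelta]
  ring

lemma IsPoissonSolution.integral_mul_powKernel (h : IsPoissonSolution φ S H) (hN : 3 ≤ N)
    (hφ : MemLp φ 2) (hH : MemLp H 2) (hS : MemLp S (ENNReal.ofReal (2 * N / (N + 2))))
    (hε : 0 < ε) (y : Space N) :
    ∫ x, S x * powKernel (N - 2) ε (x - y)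
      = (N - 2) * N * ∫ x, φ x * approxDelta ε (x - y) := by
  have three_le : (3 : ℝ) ≤ N := by exact_mod_cast hN
  have tendsto_source := tendsto_integral_mul_cutoff (integrable_mul_powKernel_sub (by linarith)
    hε y hS.1 (integrable_mul_powKernel_one_of_memLp hN hS))
  have tendsto_delta := tendsto_integral_mul_cutoff (integrable_mul_approxDelta hφ hε y)
  have tendsto_right := (tendsto_integral_fderiv_cutoff_powKernel_smul hN hH hε y).add
    (((tendsto_delta.const_mul (N : ℝ)).add
      (tendsto_integral_fderiv_cutoff_mul_smul hN hφ hε y)).const_mul ((N : ℝ) - 2))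
  have truncated (n : ℕ) :
      ∫ x, S x * powKernel (N - 2) ε (x - y) * cutoff N n x
        = (∫ x, fderiv ℝ (cutoff N n) x (powKernel (N - 2) ε (x - y) • H x))
          + (N - 2) * (N * (∫ x, φ x * approxDelta ε (x - y) * cutoff N n x)
            + ∫ x, fderiv ℝ (cutoff N n) x ((φ x * powKernel N ε (x - y)) • (x - y))) := by
    rw [← h.hasWeakGradient.integral_mul_approxDelta_mul hε y (isTest_cutoff n), mul_neg,
      ← sub_eq_add_neg, ← h.integral_mul_powKernel_mul hε y (isTest_cutoff n)]
    simp only [mul_assoc]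
  simp only [truncated] at tendsto_source
  rw [tendsto_nhds_unique tendsto_source tendsto_right]
  ring

end Regularized

/-! ### Potentials -/

/-- The convolution of `F` with `|x| ^ (-s)`: up to a constant factor, the Riesz potential of order
`N - s`, and the Newton potential when `s = N - 2`. -/
def powPotential (s : ℝ) (F : Space N → ℝ) (x : Space N) : ℝ := ∫ y, powKernel s 0 (x - y) * F y

section Potential

variable {s β : ℝ} {F m : Space N → ℝ}

lemma powPotential_mul (s : ℝ) (F m : Space N → ℝ) (x : Space N) :
    powPotential s F x * m x = ∫ y, powKernel s 0 (x - y) * (F y * m x) := by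
  simp only [powPotential, ← integral_mul_const, mul_assoc]

lemma integrable_powPotential_mul
    (h : Integrable (fun z : Space N × Space N => powKernel s 0 (z.1 - z.2) * (F z.2 * m z.1))
      (volume.prod volume)) : Integrable fun x => powPotential s F x * m x := by
  simpa only [powPotential_mul] using h.integral_prod_left

lemma integral_powPotential_mul
    (h : Integrable (fun z : Space N × Space N => powKernel s 0 (z.1 - z.2) * (F z.2 * m z.1))
      (volume.prod volume)) :
    ∫ x, powPotential s F x * m x
      = ∫ z : Space N × Space N, powKernel s 0 (z.1 - z.2) * (F z.2 * m z.1)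
          ∂(volume.prod volume) := by
  simp only [powPotential_mul, integral_prod _ h]

lemma integrable_powKernel_sub_mul (hβ : 0 < β) (hβN : β < N)
    (hF : MemLp F (ENNReal.ofReal (2 * N / (N + β))))
    (hm : MemLp m (ENNReal.ofReal (2 * N / (N + β)))) :
    Integrable (fun z : Space N × Space N => powKernel (N - β) 0 (z.1 - z.2) * (F z.2 * m z.1))
      (volume.prod volume) := by
  have : (0 : ℝ) < N - β := sub_pos.2 hβN
  have cast_pos : (0 : ℝ) < N := hβ.trans hβN
  have holderConjugate : (2 * N / (N + β) : ℝ).HolderConjugate (2 * N / (N - β)) := by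
    refine Real.holderConjugate_iff.2 ⟨by rw [lt_div_iff₀ (by positivity)]; linarith, ?_⟩
    field_simp
    ring
  have hls := integrable_powKernel_mul (E := Space N) (μ := volume) (s := N - β)
    (p := 2 * N / (N + β)) (by rw [finrank_euclideanSpace_fin]; linarith)
    (by rwa [finrank_euclideanSpace_fin]) hm hF
  simpa only [mul_comm (m _)] using hls

lemma locallyIntegrable_powPotential (hβ : 0 < β) (hβN : β < N)
    (hF : MemLp F (ENNReal.ofReal (2 * N / (N + β)))) :
    LocallyIntegrable (powPotential (N - β) F) := by
  refine locallyIntegrable_iff.2 fun K hK => ?_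
  have hK' := integrable_powPotential_mul (integrable_powKernel_sub_mul hβ hβN hF
    (memLp_indicator_const _ hK.measurableSet 1 (Or.inr hK.measure_lt_top.ne)))
  rw [← integrable_indicator_iff hK.measurableSet]
  refine hK'.congr (Eventually.of_forall fun x => ?_)
  by_cases hx : x ∈ K <;> simp [hx]

end Potential

lemma integral_powKernel_one_pos (N : ℕ) : 0 < ∫ z : Space N, powKernel (N + 2) 1 z := by
  rw [integral_pos_iff_support_of_nonneg (fun z => powKernel_nonneg _ _ _)
    (integrable_powKernel_one (by linarith))]
  have support_eq : support (powKernel (N + 2) 1 : Space N → ℝ) = univ :=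
    eq_univ_of_forall fun z => (powKernel_pos _ one_pos z).ne'
  rw [support_eq]
  exact Measure.measure_univ_pos.2 (NeZero.ne _)

section Newton

variable {φ S ψ : Space N → ℝ} {H : Space N → Space N} {ε : ℝ}

lemma IsTest.integrable_mul_approxDelta_prod (hψ : IsTest ψ) (hφ : MemLp φ 2) (hε : 0 < ε) :
    Integrable (fun z : Space N × Space N => φ z.1 * (ψ z.2 * approxDelta ε (z.1 - z.2)))
      (volume.prod volume) := by
  obtain ⟨R, -, hR⟩ := hψ.exists_radius
  obtain ⟨C, -, hC⟩ := exists_powKernel_sub_le (E := Space N) (s := N + 2) (by positivity) hε R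
  have majorant := integrable_mul_powKernel_one_of_memLp_two (s := N + 2) (by linarith) hφ.norm
  refine ((majorant.mul_prod hψ.integrable.norm).const_mul (ε ^ 2 * C)).mono'
    (hφ.1.comp_fst.mul (hψ.continuous.aestronglyMeasurable.comp_snd.mul
      ((measurable_powKernel_sub _ _).aestronglyMeasurable.const_mul _)))
    (Eventually.of_forall fun z => ?_)
  rcases eq_or_ne (ψ z.2) 0 with h0 | h0
  · simp [h0]
  rw [approxDelta, norm_mul, norm_mul, norm_mul, Real.norm_of_nonneg (powKernel_nonneg _ _ _),
    Real.norm_of_nonneg (sq_nonneg ε)]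
  calc ‖φ z.1‖ * (‖ψ z.2‖ * (ε ^ 2 * powKernel (N + 2) ε (z.1 - z.2)))
      ≤ ‖φ z.1‖ * (‖ψ z.2‖ * (ε ^ 2 * (C * powKernel (N + 2) 1 z.1))) := by
        gcongr
        exact hC z.1 z.2 (hR _ h0)
    _ = ε ^ 2 * C * (‖φ z.1‖ * powKernel (N + 2) 1 z.1 * ‖ψ z.2‖) := by ring

lemma IsTest.tendsto_integral_mul_integral_approxDelta (hψ : IsTest ψ) (hφ : MemLp φ 2)
    {e : ℕ → ℝ} (he0 : ∀ n, 0 < e n) (he1 : ∀ n, e n ≤ 1) (he : Tendsto e atTop (𝓝 0)) :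
    Tendsto (fun n => ∫ x, φ x * ∫ y, ψ y * approxDelta (e n) (x - y)) atTop
      (𝓝 (∫ x, φ x * (ψ x * ∫ z : Space N, powKernel (N + 2) 1 z))) := by
  obtain ⟨C, -, hC⟩ := hψ.exists_integral_mul_approxDelta_le
  have majorant := integrable_mul_powKernel_one_of_memLp_two (s := N + 2) (by linarith) hφ.norm
  refine tendsto_integral_of_dominated_convergence
    (fun x => C * (‖φ x‖ * powKernel (N + 2) 1 x)) (fun n => ?_) (majorant.const_mul C)
    (fun n => Eventually.of_forall fun x => ?_)
    (Eventually.of_forall fun x => (hψ.tendsto_integral_mul_approxDelta he0 he x).const_mul _)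
  · simpa only [integral_const_mul] using
      (hψ.integrable_mul_approxDelta_prod hφ (he0 n)).integral_prod_left.aestronglyMeasurable
  · rw [norm_mul, mul_left_comm]
    exact mul_le_mul_of_nonneg_left (hC _ (he0 n) (he1 n) x) (norm_nonneg _)

lemma IsPoissonSolution.integral_powKernel_mul (h : IsPoissonSolution φ S H) (hN : 3 ≤ N)
    (hφ : MemLp φ 2) (hH : MemLp H 2) (hS : MemLp S (ENNReal.ofReal (2 * N / (N + 2))))
    (hψ : IsTest ψ) (hε : 0 < ε) :
    ∫ z : Space N × Space N, powKernel (N - 2) ε (z.1 - z.2) * (S z.2 * ψ z.1)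
        ∂(volume.prod volume)
      = (N - 2) * N * ∫ x, φ x * ∫ y, ψ y * approxDelta ε (x - y) := by
  have three_le : (3 : ℝ) ≤ N := by exact_mod_cast hN
  have integrable_kernel := integrable_mul_of_le_powKernel
    (W := fun z : Space N × Space N => S z.2 * ψ z.1) (by omega)
    (hS.1.comp_snd.mul hψ.continuous.aestronglyMeasurable.comp_fst)
    (integrable_powKernel_sub_mul two_pos (by linarith) hS (hψ.memLp _))
    (measurable_powKernel_sub (N - 2) ε) fun _ _ => abs_powKernel_le (by linarith) ε
  have fubini : ∫ x, φ x * ∫ y, ψ y * approxDelta ε (x - y)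
      = ∫ y, ψ y * ∫ x, φ x * approxDelta ε (x - y) := by
    simp only [← integral_const_mul]
    rw [integral_integral_swap (hψ.integrable_mul_approxDelta_prod hφ hε)]
    simp only [mul_left_comm]
  rw [fubini, integral_prod _ integrable_kernel, ← integral_const_mul]
  congr 1 with y
  calc ∫ x, powKernel (N - 2) ε (y - x) * (S x * ψ y)
      = ψ y * ∫ x, S x * powKernel (N - 2) ε (x - y) := by
        rw [← integral_const_mul]
        congr 1 with x
        rw [powKernel_sub_comm]
        ring
    _ = (N - 2) * N * (ψ y * ∫ x, φ x * approxDelta ε (x - y)) := by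
        rw [h.integral_mul_powKernel hN hφ hH hS hε y]
        ring

lemma IsPoissonSolution.integral_powPotential_mul (h : IsPoissonSolution φ S H) (hN : 3 ≤ N)
    (hφ : MemLp φ 2) (hH : MemLp H 2) (hS : MemLp S (ENNReal.ofReal (2 * N / (N + 2))))
    (hψ : IsTest ψ) :
    ∫ x, powPotential (N - 2) S x * ψ x
      = (N - 2) * N * (∫ z : Space N, powKernel (N + 2) 1 z) * ∫ x, φ x * ψ x := by
  have three_le : (3 : ℝ) ≤ N := by exact_mod_cast hN
  have tendsto_e : Tendsto (fun n : ℕ => 1 / ((n : ℝ) + 1)) atTop (𝓝 0) :=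
    tendsto_one_div_add_atTop_nhds_zero_nat
  have e_pos (n : ℕ) : 0 < 1 / ((n : ℝ) + 1) := by positivity
  have e_le_one (n : ℕ) : 1 / ((n : ℝ) + 1) ≤ 1 :=
    div_le_one_of_le₀ (by linarith [(n.cast_nonneg : (0 : ℝ) ≤ n)]) (by positivity)
  have integrable_kernel := integrable_powKernel_sub_mul two_pos (by linarith) hS (hψ.memLp _)
  have tendsto_left := tendsto_integral_powKernel_sub_mul
    (W := fun z : Space N × Space N => S z.2 * ψ z.1) (by omega) (by linarith)
    (hS.1.comp_snd.mul hψ.continuous.aestronglyMeasurable.comp_fst) integrable_kernel tendsto_e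
  have tendsto_right :=
    hψ.tendsto_integral_mul_integral_approxDelta hφ e_pos e_le_one tendsto_e
  simp only [fun n => h.integral_powKernel_mul hN hφ hH hS hψ (e_pos n)] at tendsto_left
  rw [ChoquardPoisson.integral_powPotential_mul integrable_kernel,
    tendsto_nhds_unique tendsto_left (tendsto_right.const_mul _)]
  simp only [← mul_assoc, integral_mul_const]
  ring

theorem IsPoissonSolution.exists_eq_powPotential (h : IsPoissonSolution φ S H) (hN : 3 ≤ N)
    (hφ : MemLp φ 2) (hH : MemLp H 2) (hS : MemLp S (ENNReal.ofReal (2 * N / (N + 2)))) :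
    ∃ c : ℝ, 0 < c ∧ ∀ᵐ x, φ x = c * powPotential (N - 2) S x := by
  have three_le : (3 : ℝ) ≤ N := by exact_mod_cast hN
  set C : ℝ := (N - 2) * N * ∫ z : Space N, powKernel (N + 2) 1 z
  have C_pos : 0 < C :=
    mul_pos (mul_pos (by linarith) (by linarith)) (integral_powKernel_one_pos N)
  refine ⟨C⁻¹, inv_pos.2 C_pos, ?_⟩
  have potential_eq : ∀ᵐ x, powPotential (N - 2) S x = C * φ x := by
    refine ae_eq_of_integral_contDiff_smul_eq
      (locallyIntegrable_powPotential two_pos (by linarith) hS)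
      ((hφ.locallyIntegrable (by norm_num)).smul C) fun ψ hψ hc => ?_
    simp only [smul_eq_mul, mul_comm (ψ _), mul_assoc, integral_const_mul]
    exact h.integral_powPotential_mul hN hφ hH hS ⟨hψ, hc⟩
  filter_upwards [potential_eq] with x hx
  rw [hx, inv_mul_cancel_left₀ C_pos.ne']

end Newton

/-! ### Second-order weak derivatives -/

lemma inner_eq_sum_coord_mul (v w : Space N) : inner ℝ v w = ∑ i, v i * w i := by
  simp only [PiLp.inner_apply, RCLike.inner_apply, conj_trivial, mul_comm]

lemma HasWeakGradient.hasWeakDeriv_coord {u : Space N → ℝ} {G : Space N → Space N}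
    (h : HasWeakGradient u G) (i : Fin N) :
    HasWeakDeriv (EuclideanSpace.basisFun (Fin N) ℝ i) u fun x => G x i := by
  simpa only [EuclideanSpace.inner_basisFun_real] using
    h.hasWeakDeriv (EuclideanSpace.basisFun (Fin N) ℝ i)

lemma hasWeakGradient_of_hasWeakDeriv {u : Space N → ℝ} {G : Space N → Space N}
    (hu : LocallyIntegrable u) (hG : LocallyIntegrable G)
    (h : ∀ i, HasWeakDeriv (EuclideanSpace.basisFun (Fin N) ℝ i) u fun x => G x i) :
    HasWeakGradient u G := by
  refine ⟨hu, hG, fun ψ hψ => ?_⟩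
  have integrable_left : Integrable fun x => u x • ∇ ψ x :=
    hu.integrable_smul_right_of_hasCompactSupport hψ.continuous_gradient hψ.compact_gradient
  have integrable_right : Integrable fun x => ψ x • G x :=
    hG.integrable_smul_left_of_hasCompactSupport hψ.continuous hψ.compact
  ext i
  rw [← EuclideanSpace.inner_basisFun_real, ← EuclideanSpace.inner_basisFun_real, inner_neg_left,
    real_inner_comm, ← integral_inner integrable_left, real_inner_comm,
    ← integral_inner integrable_right]
  simpa only [inner_smul_right, inner_gradient_right, conj_trivial, real_inner_comm,
    EuclideanSpace.inner_basisFun_real, mul_comm (ψ _)] using (h i).integral_eq ψ hψ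

lemma HasWeakGradient.ae_unique {u : Space N → ℝ} {G G' : Space N → Space N}
    (h : HasWeakGradient u G) (h' : HasWeakGradient u G') : G =ᵐ[volume] G' := by
  have coord_eq := fun i => (h.hasWeakDeriv_coord i).ae_unique (h'.hasWeakDeriv_coord i)
  filter_upwards [ae_all_iff.2 coord_eq] with x hx
  exact PiLp.ext hx

lemma HasWeakDeriv.sum {v : Space N} {ι : Type*} (s : Finset ι) {f f' : ι → Space N → ℝ}
    (h : ∀ i ∈ s, HasWeakDeriv v (f i) (f' i)) :
    HasWeakDeriv v (fun x => ∑ i ∈ s, f i x) fun x => ∑ i ∈ s, f' i x := by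
  refine ⟨locallyIntegrable_finsetSum s fun i hi => (h i hi).locInt,
    locallyIntegrable_finsetSum s fun i hi => (h i hi).locInt_deriv, fun ψ hψ => ?_⟩
  simp only [Finset.sum_mul]
  rw [integral_finsetSum _ fun i hi => (hψ.fderiv_apply v).integrable_mul (h i hi).locInt,
    integral_finsetSum _ fun i hi => hψ.integrable_mul (h i hi).locInt_deriv,
    ← Finset.sum_neg_distrib]
  exact Finset.sum_congr rfl fun i hi => (h i hi).integral_eq ψ hψ

lemma HasWeakDeriv.integral_deriv_mul {v : Space N} {f f' g g' η : Space N → ℝ}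
    (hf : HasWeakDeriv v f f') (hg : HasWeakDeriv v g g') (memLp_f : MemLpLoc f 2)
    (memLp_f' : MemLpLoc f' 2) (memLp_g : MemLpLoc g 2) (memLp_g' : MemLpLoc g' 2)
    (hη : IsTest η) :
    ∫ x, f' x * g x * η x
      = -(∫ x, f x * g x * fderiv ℝ η x v) - ∫ x, f x * g' x * η x := by
  have by_parts := (hf.mul hg memLp_f memLp_f' memLp_g memLp_g').integral_eq η hη
  simp only [add_mul] at by_parts
  rw [integral_add (hη.integrable_mul (memLp_f.locallyIntegrable_mul memLp_g'))
    (hη.integrable_mul (memLp_f'.locallyIntegrable_mul memLp_g))] at by_parts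
  linarith

lemma MemLpLoc.coord {G : Space N → Space N} {r : ENNReal} (h : MemLpLoc G r) (i : Fin N) :
    MemLpLoc (fun x => G x i) r := fun S hS =>
  (h S hS).mono ((EuclideanSpace.proj (𝕜 := ℝ) i : Space N →L[ℝ] ℝ).continuous
    |>.comp_aestronglyMeasurable (h S hS).1) (.of_forall fun x => PiLp.norm_apply_le (G x) i)

lemma memLpLoc_of_memLp {F : Type*} [NormedAddCommGroup F] {f : Space N → F} {r : ENNReal}
    (h : MemLp f r) : MemLpLoc f r := fun _ _ => h.restrict _

lemma MemLpLoc.locallyIntegrable_smul {f : Space N → ℝ} {G : Space N → Space N}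
    (hf : MemLpLoc f 2) (hG : MemLpLoc G 2) : LocallyIntegrable fun x => f x • G x :=
  locallyIntegrable_iff.2 fun S hS => memLp_one_iff_integrable.1 ((hG S hS).smul (hf S hS))

lemma MemLpLoc.locallyIntegrable_norm_sq {G : Space N → Space N} (hG : MemLpLoc G 2) :
    LocallyIntegrable fun x => ‖G x‖ ^ 2 :=
  locallyIntegrable_iff.2 fun S hS => (memLp_two_iff_integrable_sq_norm (hG S hS).1).1 (hG S hS)

lemma HasWeakGradient.sq {u : Space N → ℝ} {G : Space N → Space N} (h : HasWeakGradient u G)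
    (hu : MemLpLoc u 2) (hG : MemLpLoc G 2) :
    HasWeakGradient (fun x => u x ^ 2) fun x => (2 * u x) • G x := by
  refine hasWeakGradient_of_hasWeakDeriv ?_ ?_ fun i =>
    (h.hasWeakDeriv_coord i).sq hu (hG.coord i)
  · simpa only [pow_two] using hu.locallyIntegrable_mul hu
  · exact MemLpLoc.locallyIntegrable_smul (fun S hS => (hu S hS).const_mul 2) hG

section MulCoord

variable {θ : Space N → ℝ}

lemma IsTest.mul_coord (hθ : IsTest θ) (j : Fin N) : IsTest fun x => θ x * x j := by
  simpa only [sub_zero] using hθ.mul_sub_coord 0 j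

lemma IsTest.sum_fderiv_mul_coord (hθ : IsTest θ) (x : Space N) :
    ∑ j, fderiv ℝ (fun x => θ x * x j) x (EuclideanSpace.basisFun (Fin N) ℝ j)
      = eulerDiv θ x := by
  simpa only [sub_zero, eulerDiv] using hθ.sum_fderiv_mul_sub_coord x 0

lemma IsTest.fderiv_inner_smul (hθ : IsTest θ) (x w : Space N) :
    fderiv ℝ θ x (inner ℝ w x • w)
      = (∑ j, w j * fderiv ℝ (fun x => θ x * x j) x w) - ‖w‖ ^ 2 * θ x := by
  have fderiv_mul_coord : ∀ j,
      fderiv ℝ (fun x => θ x * x j) x w = θ x * w j + x j * fderiv ℝ θ x w := fun j => by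
    simpa only [sub_zero] using hθ.fderiv_mul_sub_coord x 0 w j
  simp only [fderiv_mul_coord, mul_add, Finset.sum_add_distrib, ← mul_assoc, ← Finset.sum_mul,
    map_smul, smul_eq_mul, inner_eq_sum_coord_mul, EuclideanSpace.real_norm_sq_eq]
  simp only [mul_right_comm _ (θ x), ← Finset.sum_mul, pow_two]
  ring

end MulCoord

/-- `G ∈ L²_loc` is the weak gradient of `u`, and `D i ∈ L²_loc` is the weak gradient of `Gᵢ`:
the rows `D i` form the weak Hessian of `u`. -/
structure HasWeakHessian (u : Space N → ℝ) (G : Space N → Space N)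
    (D : Fin N → Space N → Space N) : Prop where
  hasWeakGradient : HasWeakGradient u G
  hasWeakGradient_coord : ∀ i, HasWeakGradient (fun x => G x i) (D i)
  memLpLoc_grad : MemLpLoc G 2
  memLpLoc : ∀ i, MemLpLoc (D i) 2

/-- The weak Laplacian of a function with weak Hessian `D`. -/
def hessianTrace (D : Fin N → Space N → Space N) (x : Space N) : ℝ := ∑ i, D i x i

lemma IsTest.fderiv_fderiv_apply_comm {ψ : Space N → ℝ} (hψ : IsTest ψ) (v w x : Space N) :
    fderiv ℝ (fun y => fderiv ℝ ψ y v) x w = fderiv ℝ (fun y => fderiv ℝ ψ y w) x v := by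
  have differentiableAt_fderiv : DifferentiableAt ℝ (fderiv ℝ ψ) x :=
    (hψ.smooth.fderiv_right (m := ∞) (by simp)).differentiable (by simp) x
  have second_deriv_symm : IsSymmSndFDerivAt ℝ ψ x :=
    hψ.smooth.contDiffAt.isSymmSndFDerivAt
      (minSmoothness_of_isRCLikeNormedField.trans_le (WithTop.coe_le_coe.2 le_top))
  have fderiv_apply_eq : ∀ v w,
      fderiv ℝ (fun y => fderiv ℝ ψ y v) x w = fderiv ℝ (fderiv ℝ ψ) x w v := fun v w => by
    rw [fderiv_clm_apply differentiableAt_fderiv (differentiableAt_const v)]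
    simp
  rw [fderiv_apply_eq, fderiv_apply_eq, second_deriv_symm.eq]

namespace HasWeakHessian

variable {u : Space N → ℝ} {G : Space N → Space N} {D : Fin N → Space N → Space N}

lemma symm (h : HasWeakHessian u G D) (i j : Fin N) :
    (fun x => D i x j) =ᵐ[volume] fun x => D j x i := by
  have deriv_deriv := fun i j => (h.hasWeakGradient_coord i).hasWeakDeriv_coord j
  have integral_eq_fderiv_fderiv : ∀ {ψ : Space N → ℝ}, IsTest ψ → ∀ i j,
      ∫ x, D i x j * ψ x = ∫ x, u x * fderiv ℝ (fun y => fderiv ℝ ψ y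
        (EuclideanSpace.basisFun (Fin N) ℝ j)) x (EuclideanSpace.basisFun (Fin N) ℝ i) := by
    intro ψ hψ i j
    rw [(h.hasWeakGradient.hasWeakDeriv_coord i).integral_eq _ (hψ.fderiv_apply _),
      (deriv_deriv i j).integral_eq ψ hψ, neg_neg]
  refine ae_eq_of_integral_contDiff_smul_eq (deriv_deriv i j).locInt_deriv
    (deriv_deriv j i).locInt_deriv fun ψ smooth compact => ?_
  have hψ : IsTest ψ := ⟨smooth, compact⟩
  simp only [smul_eq_mul, mul_comm (ψ _)]
  rw [integral_eq_fderiv_fderiv hψ, integral_eq_fderiv_fderiv hψ]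
  simp only [hψ.fderiv_fderiv_apply_comm (EuclideanSpace.basisFun (Fin N) ℝ i)]

lemma locallyIntegrable_hessianTrace (h : HasWeakHessian u G D) :
    LocallyIntegrable (hessianTrace D) :=
  locallyIntegrable_finsetSum _ fun i _ =>
    ((h.hasWeakGradient_coord i).hasWeakDeriv_coord i).locInt_deriv

lemma memLpLoc_hessianTrace (h : HasWeakHessian u G D) : MemLpLoc (hessianTrace D) 2 :=
  fun S hS => memLp_finsetSum _ fun i _ => (h.memLpLoc i).coord i S hS

lemma integral_inner_gradient (h : HasWeakHessian u G D) {ψ : Space N → ℝ} (hψ : IsTest ψ) :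
    ∫ x, inner ℝ (G x) (∇ ψ x) = -∫ x, hessianTrace D x * ψ x := by
  have deriv_coord := fun i => (h.hasWeakGradient_coord i).hasWeakDeriv_coord i
  simp only [hessianTrace, inner_gradient_right, conj_trivial, Finset.sum_mul,
    fun x => apply_eq_sum_basisFun (fderiv ℝ ψ x) (G x)]
  rw [integral_finsetSum _ fun i _ => (hψ.fderiv_apply _).integrable_mul (deriv_coord i).locInt,
    integral_finsetSum _ fun i _ => hψ.integrable_mul (deriv_coord i).locInt_deriv,
    ← Finset.sum_neg_distrib]
  exact Finset.sum_congr rfl fun i _ => (deriv_coord i).integral_eq ψ hψ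

lemma integral_hessianTrace_mul (h : HasWeakHessian u G D) {g : Space N → ℝ}
    {Γ : Space N → Space N} (hg : HasWeakGradient g Γ) (memLp_g : MemLpLoc g 2)
    (memLp_Γ : MemLpLoc Γ 2) {η : Space N → ℝ} (hη : IsTest η) :
    ∫ x, hessianTrace D x * g x * η x
      = -(∫ x, g x * fderiv ℝ η x (G x)) - ∫ x, inner ℝ (G x) (Γ x) * η x := by
  have memLp_G := h.memLpLoc_grad.coord
  have memLp_D := fun i => (h.memLpLoc i).coord i
  have gradient_term : ∀ x, g x * fderiv ℝ η x (G x)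
      = ∑ i, G x i * g x * fderiv ℝ η x (EuclideanSpace.basisFun (Fin N) ℝ i) := fun x => by
    rw [apply_eq_sum_basisFun (fderiv ℝ η x), Finset.mul_sum]
    exact Finset.sum_congr rfl fun i _ => by ring
  simp only [hessianTrace, gradient_term, inner_eq_sum_coord_mul, Finset.sum_mul]
  rw [integral_finsetSum _ fun i _ => hη.integrable_mul ((memLp_D i).locallyIntegrable_mul memLp_g),
    integral_finsetSum _ fun i _ =>
      (hη.fderiv_apply _).integrable_mul ((memLp_G i).locallyIntegrable_mul memLp_g),
    integral_finsetSum _ fun i _ =>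
      hη.integrable_mul ((memLp_G i).locallyIntegrable_mul (memLp_Γ.coord i)),
    ← Finset.sum_neg_distrib, ← Finset.sum_sub_distrib]
  exact Finset.sum_congr rfl fun i _ => ((h.hasWeakGradient_coord i).hasWeakDeriv_coord i)
    |>.integral_deriv_mul (hg.hasWeakDeriv_coord i) (memLp_G i) (memLp_D i) memLp_g
      (memLp_Γ.coord i) hη

lemma hasWeakDeriv_norm_sq (h : HasWeakHessian u G D) (j : Fin N) :
    HasWeakDeriv (EuclideanSpace.basisFun (Fin N) ℝ j) (fun x => ‖G x‖ ^ 2)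
      fun x => 2 * inner ℝ (G x) (D j x) := by
  have sum_sq := HasWeakDeriv.sum Finset.univ fun i _ =>
    ((h.hasWeakGradient_coord i).hasWeakDeriv_coord j).sq (h.memLpLoc_grad.coord i)
      ((h.memLpLoc i).coord j)
  simp only [← EuclideanSpace.real_norm_sq_eq] at sum_sq
  refine sum_sq.congr_right ?_
  filter_upwards [ae_all_iff.2 fun i => h.symm i j] with x hx
  simp only [hx, inner_eq_sum_coord_mul, Finset.mul_sum, mul_assoc]

lemma integral_hessianTrace_mul_coord (h : HasWeakHessian u G D) (j : Fin N) {η : Space N → ℝ}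
    (hη : IsTest η) :
    ∫ x, hessianTrace D x * G x j * η x
      = -(∫ x, G x j * fderiv ℝ η x (G x))
        + 1 / 2 * ∫ x, ‖G x‖ ^ 2 * fderiv ℝ η x (EuclideanSpace.basisFun (Fin N) ℝ j) := by
  rw [h.integral_hessianTrace_mul (h.hasWeakGradient_coord j) (h.memLpLoc_grad.coord j)
    (h.memLpLoc j) hη, (h.hasWeakDeriv_norm_sq j).integral_eq η hη]
  simp only [mul_assoc, integral_const_mul]
  ring

/-- The Rellich–Pohozaev identity. -/
lemma integral_hessianTrace_mul_euler (h : HasWeakHessian u G D) {θ : Space N → ℝ}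
    (hθ : IsTest θ) :
    ∫ x, hessianTrace D x * (θ x * inner ℝ (G x) x)
      = -(∫ x, fderiv ℝ θ x (inner ℝ (G x) x • G x)) - (∫ x, ‖G x‖ ^ 2 * θ x)
        + 1 / 2 * ∫ x, ‖G x‖ ^ 2 * eulerDiv θ x := by
  have memLp_G := h.memLpLoc_grad.coord
  have laplacian_term : ∀ x, hessianTrace D x * (θ x * inner ℝ (G x) x)
      = ∑ j, hessianTrace D x * G x j * (θ x * x j) := fun x => by
    rw [inner_eq_sum_coord_mul, Finset.mul_sum, Finset.mul_sum]
    exact Finset.sum_congr rfl fun j _ => by ring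
  have integrable_fderiv : ∀ j,
      Integrable fun x => G x j * fderiv ℝ (fun x => θ x * x j) x (G x) := fun j => by
    simpa only [map_smul, smul_eq_mul] using (hθ.mul_coord j).integrable_fderiv_apply
      ((memLp_G j).locallyIntegrable_smul h.memLpLoc_grad)
  have locInt_mul_coord : ∀ j, LocallyIntegrable fun x => hessianTrace D x * G x j := fun j => by
    simp only [hessianTrace, Finset.sum_mul]
    exact locallyIntegrable_finsetSum _ fun i _ =>
      ((h.memLpLoc i).coord i).locallyIntegrable_mul (memLp_G j)
  have locInt_norm_sq := h.memLpLoc_grad.locallyIntegrable_norm_sq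
  simp only [laplacian_term, hθ.fderiv_inner_smul, ← hθ.sum_fderiv_mul_coord, Finset.mul_sum]
  rw [integral_finsetSum _ fun j _ => (hθ.mul_coord j).integrable_mul (locInt_mul_coord j),
    integral_finsetSum _ fun j _ =>
      ((hθ.mul_coord j).fderiv_apply _).integrable_mul locInt_norm_sq,
    integral_sub (integrable_finsetSum _ fun j _ => integrable_fderiv j)
      (hθ.integrable_mul locInt_norm_sq),
    integral_finsetSum _ fun j _ => integrable_fderiv j]
  simp only [h.integral_hessianTrace_mul_coord _ (hθ.mul_coord _), Finset.sum_add_distrib,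
    Finset.sum_neg_distrib, Finset.mul_sum]
  ring

end HasWeakHessian

/-! ### Removing the cutoffs -/

lemma powKernel_one_mul_norm_rpow_le_one {E : Type*} [NormedAddCommGroup E] {s : ℝ} (hs : 0 ≤ s)
    (x : E) : powKernel s 1 x * ‖x‖ ^ s ≤ 1 := by
  have norm_rpow_eq : ‖x‖ ^ s = (‖x‖ ^ 2) ^ (s / 2) := by
    rw [← Real.rpow_natCast, ← Real.rpow_mul (norm_nonneg x)]
    congr 1
    push_cast
    ring
  rw [powKernel, neg_div, Real.rpow_neg (by positivity), inv_mul_le_one₀ (by positivity),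
    norm_rpow_eq]
  exact Real.rpow_le_rpow (by positivity) (by linarith) (by linarith)

lemma powKernel_one_mul_norm_le_one {E : Type*} [NormedAddCommGroup E] (x : E) :
    powKernel 1 1 x * ‖x‖ ≤ 1 := by
  simpa only [Real.rpow_one] using powKernel_one_mul_norm_rpow_le_one zero_le_one x

lemma integrable_norm_sq {F : Type*} [NormedAddCommGroup F] {f : Space N → F} (h : MemLp f 2) :
    Integrable fun x => ‖f x‖ ^ 2 :=
  (memLp_two_iff_integrable_sq_norm h.1).1 h

namespace HasWeakHessian

variable {u : Space N → ℝ} {G : Space N → Space N} {D : Fin N → Space N → Space N}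

lemma tendsto_integral_hessianTrace_mul_self (h : HasWeakHessian u G D) (hu : MemLp u 2)
    (hG : MemLp G 2) :
    Tendsto (fun n => ∫ x, hessianTrace D x * u x * cutoff N n x) atTop (𝓝 (-∫ x, ‖G x‖ ^ 2)) := by
  have gradient_term := tendsto_integral_fderiv_cutoff (hu.1.smul hG.1)
    (integrable_powKernel_one_mul_norm (memLp_one_iff_integrable.1 (hG.smul hu)))
  have energy_term := tendsto_integral_mul_cutoff (integrable_norm_sq hG)
  simpa [h.integral_hessianTrace_mul h.hasWeakGradient (memLpLoc_of_memLp hu) h.memLpLoc_grad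
    (isTest_cutoff _)] using gradient_term.neg.sub energy_term

lemma tendsto_integral_hessianTrace_mul_euler (h : HasWeakHessian u G D) (hG : MemLp G 2) :
    Tendsto (fun n => ∫ x, hessianTrace D x * (cutoff N n x * inner ℝ (G x) x)) atTop
      (𝓝 ((N / 2 - 1) * ∫ x, ‖G x‖ ^ 2)) := by
  have measurable_inner_smul : AEStronglyMeasurable fun x => inner ℝ (G x) x • G x :=
    (hG.1.inner (𝕜 := ℝ) continuous_id.aestronglyMeasurable).smul hG.1
  have weighted_le : ∀ x, powKernel 1 1 x * ‖inner ℝ (G x) x • G x‖ ≤ ‖G x‖ ^ 2 := fun x => calc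
    powKernel 1 1 x * ‖inner ℝ (G x) x • G x‖
      ≤ powKernel 1 1 x * (‖G x‖ * ‖x‖ * ‖G x‖) := by
        rw [norm_smul]
        exact mul_le_mul_of_nonneg_left (mul_le_mul_of_nonneg_right (norm_inner_le_norm _ _)
          (norm_nonneg _)) (powKernel_nonneg _ _ _)
    _ = powKernel 1 1 x * ‖x‖ * ‖G x‖ ^ 2 := by ring
    _ ≤ ‖G x‖ ^ 2 := mul_le_of_le_one_left (sq_nonneg _) (powKernel_one_mul_norm_le_one x)
  have integrable_weighted : Integrable fun x => powKernel 1 1 x * ‖inner ℝ (G x) x • G x‖ :=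
    (integrable_norm_sq hG).mono'
      ((measurable_powKernel _ _).aestronglyMeasurable.mul measurable_inner_smul.norm)
      (.of_forall fun x => by
        rw [Real.norm_of_nonneg (mul_nonneg (powKernel_nonneg _ _ _) (norm_nonneg _))]
        exact weighted_le x)
  have fderiv_term := tendsto_integral_fderiv_cutoff measurable_inner_smul integrable_weighted
  have energy_term := tendsto_integral_mul_cutoff (integrable_norm_sq hG)
  have divergence_term := tendsto_integral_mul_eulerDiv_cutoff (integrable_norm_sq hG)
  simp only [h.integral_hessianTrace_mul_euler (isTest_cutoff _)]
  convert! (fderiv_term.neg.sub energy_term).add (divergence_term.const_mul (1 / 2)) using 2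
  ring

end HasWeakHessian

lemma HasWeakGradient.tendsto_integral_mul_euler {u : Space N → ℝ} {G : Space N → Space N}
    (h : HasWeakGradient u G) (hu : MemLp u 2) (hG : MemLp G 2) :
    Tendsto (fun n => ∫ x, u x * (cutoff N n x * inner ℝ (G x) x)) atTop
      (𝓝 (-(N / 2) * ∫ x, u x ^ 2)) := by
  have integral_eq : ∀ n, ∫ x, u x * (cutoff N n x * inner ℝ (G x) x)
      = -(1 / 2) * ∫ x, u x ^ 2 * eulerDiv (cutoff N n) x := fun n => by
    rw [(h.sq (memLpLoc_of_memLp hu) (memLpLoc_of_memLp hG)).integral_eulerDiv (isTest_cutoff n),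
      neg_mul_neg, ← integral_const_mul]
    congr 1 with x
    rw [real_inner_smul_left]
    ring
  simp only [integral_eq]
  convert! (tendsto_integral_mul_eulerDiv_cutoff hu.integrable_sq).const_mul (-(1 / 2)) using 2
  ring

/-! ### The nonlinear terms -/

lemma powPotential_nonneg {s : ℝ} {F : Space N → ℝ} (hF : ∀ x, 0 ≤ F x) (x : Space N) :
    0 ≤ powPotential s F x :=
  integral_nonneg fun _ => mul_nonneg (powKernel_nonneg _ _ _) (hF _)

lemma exists_rieszPotential_eq (N : ℕ) (α : ℝ) :
    ∃ a : ℝ, ∀ (F : Space N → ℝ) (x : Space N),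
      rieszPotential α F x = a * powPotential (N - α) F x := by
  refine ⟨Real.Gamma ((N - α) / 2) / (Real.Gamma (α / 2) * Real.pi ^ ((N : ℝ) / 2) * 2 ^ α),
    fun F x => ?_⟩
  rw [rieszPotential, powPotential, ← integral_const_mul]
  congr 1 with y
  rw [rieszKernel, powKernel_zero, Real.rpow_neg (norm_nonneg _), div_eq_mul_inv _ (‖_‖ ^ _),
    mul_assoc]

lemma integrable_powKernel_prod_of_powPotential {s : ℝ} {F m : Space N → ℝ} (hF : ∀ x, 0 ≤ F x)
    (mF : AEStronglyMeasurable F) (mm : AEStronglyMeasurable m)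
    (hex : ∀ᵐ x, Integrable fun y => powKernel s 0 (x - y) * F y)
    (hi : Integrable fun x => powPotential s F x * m x) :
    Integrable (fun z : Space N × Space N => powKernel s 0 (z.1 - z.2) * (F z.2 * m z.1))
      (volume.prod volume) := by
  have measurable_integrand : AEStronglyMeasurable (fun z : Space N × Space N =>
      powKernel s 0 (z.1 - z.2) * (F z.2 * m z.1)) (volume.prod volume) :=
    (measurable_powKernel_sub s 0).aestronglyMeasurable.mul (mF.comp_snd.mul mm.comp_fst)
  refine (integrable_prod_iff measurable_integrand).2 ⟨?_, ?_⟩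
  · filter_upwards [hex] with x hx
    simpa only [mul_assoc] using hx.mul_const (m x)
  · refine hi.abs.congr (Eventually.of_forall fun x => ?_)
    simp only [abs_mul, abs_of_nonneg (powPotential_nonneg hF x), norm_mul, Real.norm_eq_abs,
      abs_of_nonneg (powKernel_nonneg _ _ _), abs_of_nonneg (hF _)]
    exact powPotential_mul s F (fun x => |m x|) x

lemma tendsto_integral_powPotential_mul_euler {s : ℝ} {F : Space N → ℝ} {Γ : Space N → Space N}
    (hN : 1 ≤ N) (hs : 0 ≤ s) (hF : HasWeakGradient F Γ)
    (hFF : Integrable (fun z : Space N × Space N => powKernel s 0 (z.1 - z.2) * (F z.2 * F z.1))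
      (volume.prod volume))
    (hΓ : ∀ n, Integrable (fun z : Space N × Space N =>
      powKernel s 0 (z.1 - z.2) * (F z.2 * (cutoff N n z.1 * inner ℝ (Γ z.1) z.1)))
      (volume.prod volume)) :
    Tendsto (fun n => ∫ x, powPotential s F x * (cutoff N n x * inner ℝ (Γ x) x)) atTop
      (𝓝 (-(N - s / 2) * ∫ x, powPotential s F x * F x)) := by
  have integral_euler (n : ℕ) := integral_powPotential_mul (F := F)
    (m := fun x => cutoff N n x * inner ℝ (Γ x) x) (hΓ n)
  simp only [integral_euler, integral_powPotential_mul hFF, mul_comm (F (Prod.snd _)) (F _)]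
  exact tendsto_integral_powKernel_mul_euler_cutoff hN hs hF
    (by simpa only [mul_comm (F (Prod.snd _))] using hFF) hΓ

lemma exists_setIntegral_closedBall_pos {S : Space N → ℝ} (hS : ∀ x, 0 ≤ S x)
    (hSl : LocallyIntegrable S) (hne : ¬ S =ᵐ[volume] 0) :
    ∃ n : ℕ, 0 < ∫ x in closedBall (0 : Space N) n, S x := by
  by_contra! hc
  have ae_ball (n : ℕ) : ∀ᵐ x, x ∈ closedBall (0 : Space N) n → S x = 0 := by
    have h := le_antisymm (hc n) (integral_nonneg hS)
    rw [integral_eq_zero_iff_of_nonneg hS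
      (hSl.integrableOn_isCompact (isCompact_closedBall _ _))] at h
    exact (ae_restrict_iff' measurableSet_closedBall).1 h
  refine hne ?_
  filter_upwards [ae_all_iff.2 ae_ball] with x hx
  obtain ⟨n, hn⟩ := exists_nat_ge ‖x‖
  exact hx n (mem_closedBall_zero_iff.2 hn)

lemma exists_powPotential_lower_bound {s : ℝ} (hs : 0 ≤ s) (hN : 1 ≤ N) {S : Space N → ℝ}
    (hS : ∀ x, 0 ≤ S x) (hSl : LocallyIntegrable S) (hne : ¬ S =ᵐ[volume] 0)
    (hex : ∀ᵐ x, Integrable fun y => powKernel s 0 (x - y) * S y) (R : ℝ) :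
    ∃ δ : ℝ, 0 < δ ∧ ∀ᵐ x, ‖x‖ ≤ R → δ ≤ powPotential s S x := by
  have : Nontrivial (Space N) :=
    Module.nontrivial_of_finrank_pos (R := ℝ) (by simpa using Nat.lt_of_succ_le hN)
  obtain ⟨n, hn⟩ := exists_setIntegral_closedBall_pos hS hSl hne
  refine ⟨(|R| + n + 1) ^ (-s) * ∫ x in closedBall (0 : Space N) n, S x, by positivity, ?_⟩
  filter_upwards [hex] with x hx hxR
  have kernel_bound : ∀ᵐ y ∂volume.restrict (closedBall (0 : Space N) n),
      (|R| + n + 1) ^ (-s) ≤ powKernel s 0 (x - y) := by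
    filter_upwards [ae_restrict_of_ae (Measure.ae_ne volume x),
      ae_restrict_mem measurableSet_closedBall] with y hyx hy
    rw [powKernel_zero]
    refine Real.rpow_le_rpow_of_nonpos (norm_pos_iff.2 (sub_ne_zero.2 hyx.symm)) ?_ (by linarith)
    linarith [norm_sub_le x y, le_abs_self R, mem_closedBall_zero_iff.1 hy]
  calc (|R| + n + 1) ^ (-s) * ∫ x in closedBall (0 : Space N) n, S x
      = ∫ y in closedBall (0 : Space N) n, (|R| + n + 1) ^ (-s) * S y :=
        (integral_const_mul _ _).symm
    _ ≤ ∫ y in closedBall (0 : Space N) n, powKernel s 0 (x - y) * S y := by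
        refine integral_mono_ae ((hSl.integrableOn_isCompact
          (isCompact_closedBall _ _)).const_mul _) hx.integrableOn ?_
        filter_upwards [kernel_bound] with y hy
        exact mul_le_mul_of_nonneg_right hy (hS y)
    _ ≤ powPotential s S x :=
        setIntegral_le_integral hx
          (Eventually.of_forall fun _ => mul_nonneg (powKernel_nonneg _ _ _) (hS _))

lemma abs_rpow_sub_two_mul {t r : ℝ} (hr : 1 < r) : |(|t| ^ (r - 2) * t)| = |t| ^ (r - 1) := by
  rw [abs_mul, abs_of_nonneg (by positivity)]
  rcases eq_or_ne t 0 with rfl | ht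
  · simp [Real.zero_rpow (by linarith : r - 1 ≠ 0)]
  · rw [← Real.rpow_add_one (abs_ne_zero.2 ht)]
    ring_nf

lemma abs_rpow_sub_two_mul_mul_self {t r : ℝ} (hr : 1 < r) : |t| ^ (r - 2) * t * t = |t| ^ r := by
  rcases eq_or_ne t 0 with rfl | ht
  · simp [Real.zero_rpow (by linarith : r ≠ 0)]
  · rw [mul_assoc, ← pow_two, ← sq_abs, ← Real.rpow_add_natCast (abs_ne_zero.2 ht)]
    norm_num

lemma abs_rpow_sub_two_mul_mul_le {r : ℝ} (hr : 1 < r) (a b : ℝ) :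
    |(|a| ^ (r - 2) * a * b)| ≤ |a| ^ r + |b| ^ r := by
  have rpow_sub_one_mul {t : ℝ} (ht : 0 ≤ t) : t ^ (r - 1) * t = t ^ r := by
    rw [← Real.rpow_add_one' ht (by linarith), sub_add_cancel]
  rw [abs_mul, abs_rpow_sub_two_mul hr]
  have : 0 ≤ r - 1 := by linarith
  rcases le_total |a| |b| with h | h
  · calc |a| ^ (r - 1) * |b| ≤ |b| ^ (r - 1) * |b| := by gcongr
      _ = |b| ^ r := rpow_sub_one_mul (abs_nonneg _)
      _ ≤ |a| ^ r + |b| ^ r := le_add_of_nonneg_left (by positivity)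
  · calc |a| ^ (r - 1) * |b| ≤ |a| ^ (r - 1) * |a| := by gcongr
      _ = |a| ^ r := rpow_sub_one_mul (abs_nonneg _)
      _ ≤ |a| ^ r + |b| ^ r := le_add_of_nonneg_right (by positivity)

section Powers

variable {X : Type*} [MeasurableSpace X] {ν : Measure X} {u w : X → ℝ} {p s : ℝ}

lemma aestronglyMeasurable_abs_rpow (hu : AEStronglyMeasurable u ν) (r : ℝ) :
    AEStronglyMeasurable (fun x => |u x| ^ r) ν :=
  (hu.aemeasurable.abs.pow_const r).aestronglyMeasurable

lemma memLp_abs_rpow (hp : 0 < p) (hs : 0 < s) (hu : MemLp u (ENNReal.ofReal (p * s)) ν) :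
    MemLp (fun x => |u x| ^ p) (ENNReal.ofReal s) ν := by
  rw [← integrable_norm_rpow_iff (aestronglyMeasurable_abs_rpow hu.1 p) (by simpa using hs)
    ENNReal.ofReal_ne_top, ENNReal.toReal_ofReal hs.le]
  have h := hu.integrable_norm_rpow (by simpa using mul_pos hp hs) ENNReal.ofReal_ne_top
  rw [ENNReal.toReal_ofReal (mul_pos hp hs).le] at h
  refine h.congr (Eventually.of_forall fun x => ?_)
  simp only [Real.norm_eq_abs, Real.abs_rpow_of_nonneg (abs_nonneg _), abs_abs,
    Real.rpow_mul (abs_nonneg _)]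

lemma memLp_abs_rpow_sub_two_mul_mul (hp : 1 < p) (hs : 0 < s)
    (hu : MemLp u (ENNReal.ofReal (p * s)) ν) (hw : MemLp w (ENNReal.ofReal (p * s)) ν) :
    MemLp (fun x => |u x| ^ (p - 2) * u x * w x) (ENNReal.ofReal s) ν := by
  refine ((memLp_abs_rpow (by linarith) hs hu).add (memLp_abs_rpow (by linarith) hs hw)).mono
    (((aestronglyMeasurable_abs_rpow hu.1 _).mul hu.1).mul hw.1) (Eventually.of_forall fun x => ?_)
  rw [Real.norm_eq_abs, Pi.add_apply, Real.norm_of_nonneg (by positivity)]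
  exact abs_rpow_sub_two_mul_mul_le hp _ _

end Powers

lemma locallyIntegrable_mul_inner {h : Space N → ℝ} {G : Space N → Space N}
    (mh : AEStronglyMeasurable h) (mG : AEStronglyMeasurable G)
    (hi : LocallyIntegrable fun x => h x * ‖G x‖) :
    LocallyIntegrable fun x => h x * inner ℝ (G x) x := by
  have hi' : LocallyIntegrable fun x => ‖x‖ * (h x * ‖G x‖) := hi.continuous_mul continuous_norm
  refine hi'.mono (mh.mul (mG.inner continuous_id.aestronglyMeasurable))
    (Eventually.of_forall fun x => ?_)
  simp only [norm_mul, norm_norm]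
  calc ‖h x‖ * ‖inner ℝ (G x) x‖ ≤ ‖h x‖ * (‖G x‖ * ‖x‖) := by
        gcongr
        exact norm_inner_le_norm _ _
    _ = ‖x‖ * (‖h x‖ * ‖G x‖) := by ring

lemma locallyIntegrable_smul {h : Space N → ℝ} {G : Space N → Space N}
    (mh : AEStronglyMeasurable h) (mG : AEStronglyMeasurable G)
    (hi : LocallyIntegrable fun x => h x * ‖G x‖) : LocallyIntegrable fun x => h x • G x :=
  hi.mono (mh.smul mG) (Eventually.of_forall fun x => by simp [norm_smul])

lemma HasWeakGradient.abs_rpow {u : Space N → ℝ} {G : Space N → Space N} {r : ℝ}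
    (hG : HasWeakGradient u G) (hr : 1 < r) (hu : LocallyIntegrable fun x => |u x| ^ r)
    (huG : LocallyIntegrable fun x => r * |u x| ^ (r - 2) * u x * ‖G x‖) :
    HasWeakGradient (fun x => |u x| ^ r) fun x => (r * |u x| ^ (r - 2) * u x) • G x := by
  have mu := hG.locInt.aestronglyMeasurable
  have measurable_factor : AEStronglyMeasurable fun x => r * |u x| ^ (r - 2) * u x :=
    ((aestronglyMeasurable_abs_rpow mu _).const_mul r).mul mu
  have locInt_grad :=
    locallyIntegrable_smul measurable_factor hG.locInt_grad.aestronglyMeasurable huG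
  refine hasWeakGradient_of_hasWeakDeriv hu locInt_grad fun i =>
    (hG.hasWeakDeriv_coord i).abs_rpow hr hu (huG.mono (measurable_factor.mul
      (hG.hasWeakDeriv_coord i).locInt_deriv.aestronglyMeasurable)
        (Eventually.of_forall fun x => ?_))
  rw [norm_mul _ (G x i), norm_mul _ ‖G x‖, norm_norm]
  gcongr
  exact PiLp.norm_apply_le (G x) i

lemma IsTest.memLp_mul_inner {G : Space N → Space N} {r : ENNReal} {θ : Space N → ℝ}
    (hθ : IsTest θ) (hG : MemLpLoc G r) (mG : AEStronglyMeasurable G) :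
    MemLp (fun x => θ x * inner ℝ (G x) x) r := by
  obtain ⟨M, hM⟩ := (hθ.compact.smul_right (f' := id)).exists_bound_of_continuous
    (hθ.continuous.smul continuous_id)
  have h : MemLp ((tsupport θ).indicator fun x => ‖G x‖) r :=
    (memLp_indicator_iff_restrict hθ.compact.isCompact.measurableSet).2
      (hG _ hθ.compact.isCompact).norm
  refine h.of_le_mul (c := M) (hθ.continuous.aestronglyMeasurable.mul
    (mG.inner continuous_id.aestronglyMeasurable)) (Eventually.of_forall fun x => ?_)
  by_cases hx : x ∈ tsupport θ
  · rw [indicator_of_mem hx, norm_norm, ← real_inner_smul_right, mul_comm]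
    exact (norm_inner_le_norm _ _).trans (by gcongr; exact hM x)
  · simp [image_eq_zero_of_notMem_tsupport hx, indicator_of_notMem hx]

section Choquard

variable {α p : ℝ} {u w : Space N → ℝ} {G : Space N → Space N}

lemma integrable_choquard_energy_prod (hα₀ : 0 < α) (hαN : α < N) (hp : 0 < p)
    (hu : MemLp u (ENNReal.ofReal (p * (2 * N / (N + α))))) :
    Integrable (fun z : Space N × Space N =>
      powKernel (N - α) 0 (z.1 - z.2) * (|u z.2| ^ p * |u z.1| ^ p)) (volume.prod volume) := by
  have hN : (0 : ℝ) < N := hα₀.trans hαN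
  have h := memLp_abs_rpow hp (by positivity) hu
  exact integrable_powKernel_sub_mul hα₀ hαN h h

lemma integrable_choquard_energy (hα₀ : 0 < α) (hαN : α < N) (hp : 0 < p)
    (hu : MemLp u (ENNReal.ofReal (p * (2 * N / (N + α))))) :
    Integrable fun x => powPotential (N - α) (fun y => |u y| ^ p) x * |u x| ^ p :=
  integrable_powPotential_mul (integrable_choquard_energy_prod hα₀ hαN hp hu)

lemma integrable_choquard_mul_prod (hα₀ : 0 < α) (hαN : α < N) (hp : 1 < p)
    (hu : MemLp u (ENNReal.ofReal (p * (2 * N / (N + α)))))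
    (hw : MemLp w (ENNReal.ofReal (p * (2 * N / (N + α))))) :
    Integrable (fun z : Space N × Space N => powKernel (N - α) 0 (z.1 - z.2)
      * (|u z.2| ^ p * (|u z.1| ^ (p - 2) * u z.1 * w z.1))) (volume.prod volume) := by
  have hN : (0 : ℝ) < N := hα₀.trans hαN
  exact integrable_powKernel_sub_mul hα₀ hαN (memLp_abs_rpow (by linarith) (by positivity) hu)
    (memLp_abs_rpow_sub_two_mul_mul hp (by positivity) hu hw)

lemma MemLpLoc.hasWeakGradient_abs_rpow {s : ℝ} (hu : MemLpLoc u (ENNReal.ofReal (p * s)))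
    (hGp : MemLpLoc G (ENNReal.ofReal (p * s))) (hG : HasWeakGradient u G) (hp : 1 < p)
    (hs : 1 ≤ s) :
    HasWeakGradient (fun x => |u x| ^ p) fun x => (p * |u x| ^ (p - 2) * u x) • G x := by
  have one_le : 1 ≤ ENNReal.ofReal s := ENNReal.one_le_ofReal.2 hs
  refine hG.abs_rpow hp (locallyIntegrable_iff.2 fun S hS => ?_)
    (locallyIntegrable_iff.2 fun S hS => ?_) <;>
    have : IsFiniteMeasure (volume.restrict S) := ⟨by simpa using hS.measure_lt_top⟩
  · exact (memLp_abs_rpow (by linarith) (by linarith) (hu S hS)).integrable one_le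
  · simpa only [mul_assoc] using! ((memLp_abs_rpow_sub_two_mul_mul hp (by linarith) (hu S hS)
      (hGp S hS).norm).integrable one_le).const_mul p

lemma locallyIntegrable_choquard_mul_norm (hα₀ : 0 < α) (hαN : α < N) (hp : 1 < p)
    (hu : MemLp u (ENNReal.ofReal (p * (2 * N / (N + α)))))
    (hGp : MemLpLoc G (ENNReal.ofReal (p * (2 * N / (N + α))))) :
    LocallyIntegrable fun x =>
      powPotential (N - α) (fun y => |u y| ^ p) x * (|u x| ^ (p - 2) * u x) * ‖G x‖ := by
  refine locallyIntegrable_iff.2 fun S hS => ?_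
  have hw : MemLp (S.indicator fun x => ‖G x‖) (ENNReal.ofReal (p * (2 * N / (N + α)))) :=
    (memLp_indicator_iff_restrict hS.measurableSet).2 (hGp S hS).norm
  refine ((integrable_powPotential_mul (F := fun y => |u y| ^ p)
    (m := fun x => |u x| ^ (p - 2) * u x * S.indicator (fun x => ‖G x‖) x)
    (integrable_choquard_mul_prod hα₀ hαN hp hu hw)).integrableOn (s := S)).congr ?_
  filter_upwards [ae_restrict_mem hS.measurableSet] with x hx
  simp only [indicator_of_mem hx, mul_assoc]

lemma tendsto_integral_choquard_mul_euler (hα₀ : 0 < α) (hαN : α < N) (hp : 1 < p)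
    (hu : MemLp u (ENNReal.ofReal (p * (2 * N / (N + α))))) (hG : HasWeakGradient u G)
    (hGp : MemLpLoc G (ENNReal.ofReal (p * (2 * N / (N + α))))) :
    Tendsto (fun n => ∫ x, powPotential (N - α) (fun y => |u y| ^ p) x
        * (|u x| ^ (p - 2) * u x * (cutoff N n x * inner ℝ (G x) x))) atTop
      (𝓝 (-((N + α) / (2 * p)) *
        ∫ x, powPotential (N - α) (fun y => |u y| ^ p) x * |u x| ^ p)) := by
  have hN : (0 : ℝ) < N := hα₀.trans hαN
  have hs : (1 : ℝ) ≤ 2 * N / (N + α) := by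
    rw [le_div_iff₀ (by positivity)]
    linarith
  have integrable_euler (n : ℕ) := integrable_choquard_mul_prod hα₀ hαN hp hu
    ((isTest_cutoff n).memLp_mul_inner hGp hG.locInt_grad.aestronglyMeasurable)
  have pull_out (n : ℕ) (x : Space N) :
      cutoff N n x * inner ℝ ((p * |u x| ^ (p - 2) * u x) • G x) x
        = p * (|u x| ^ (p - 2) * u x * (cutoff N n x * inner ℝ (G x) x)) := by
    rw [real_inner_smul_left]
    ring
  have dilation := tendsto_integral_powPotential_mul_euler (s := N - α)
    (by exact_mod_cast hN) (by linarith)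
    ((memLpLoc_of_memLp hu).hasWeakGradient_abs_rpow hGp hG hp hs)
    (integrable_choquard_energy_prod hα₀ hαN (by linarith) hu)
    (fun n => by simpa only [pull_out, mul_left_comm _ p] using (integrable_euler n).const_mul p)
  simp only [pull_out, mul_left_comm _ p, integral_const_mul] at dilation
  convert! dilation.const_mul p⁻¹ using 2
  · field_simp
  · field_simp
    ring

end Choquard

/-! ### The equations almost everywhere and the coupling term -/

lemma ae_integrable_powKernel_mul {β : ℝ} (hβ : 0 < β) (hβN : β < N) {S : Space N → ℝ}
    (hS : MemLp S (ENNReal.ofReal (2 * N / (N + β)))) :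
    ∀ᵐ x, Integrable fun y => powKernel (N - β) 0 (x - y) * S y := by
  have cutoff_integrable (n : ℕ) := (integrable_powKernel_sub_mul hβ hβN hS
    ((isTest_cutoff (N := N) n).memLp _)).prod_right_ae
  filter_upwards [ae_all_iff.2 cutoff_integrable] with x hx
  obtain ⟨n, hn⟩ := (eventually_cutoff_eventuallyEq_one x).exists
  simpa [hn.self_of_nhds] using hx n

lemma integral_neg_add_add_mul {X : Type*} [MeasurableSpace X] {ν : Measure X} {f u g w : X → ℝ}
    (hf : Integrable (fun x => f x * w x) ν) (hu : Integrable (fun x => u x * w x) ν)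
    (hg : Integrable (fun x => g x * w x) ν) :
    ∫ x, (-f x + u x + g x) * w x ∂ν
      = -(∫ x, f x * w x ∂ν) + (∫ x, u x * w x ∂ν) + ∫ x, g x * w x ∂ν := by
  have integrable_neg : Integrable (fun x => -(f x * w x)) ν := hf.neg
  have integrable_sum : Integrable (fun x => -(f x * w x) + u x * w x) ν := integrable_neg.add hu
  rw [← integral_neg, ← integral_add integrable_neg hu, ← integral_add integrable_sum hg]
  congr 1 with x
  ring

lemma HasWeakHessian.ae_equation {u g f : Space N → ℝ} {G : Space N → Space N}
    {D : Fin N → Space N → Space N} (h : HasWeakHessian u G D)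
    (hg : LocallyIntegrable g) (hf : LocallyIntegrable f)
    (heq : ∀ ψ : Space N → ℝ, IsTest ψ →
      (∫ x, inner ℝ (G x) (∇ ψ x)) + (∫ x, u x * ψ x) + (∫ x, g x * ψ x) = ∫ x, f x * ψ x) :
    ∀ᵐ x, -hessianTrace D x + u x + g x = f x := by
  have hL := h.locallyIntegrable_hessianTrace
  have hu := h.hasWeakGradient.locInt
  refine ae_eq_of_integral_contDiff_smul_eq ((hL.neg.add hu).add hg) hf fun ψ smooth compact => ?_
  have hψ : IsTest ψ := ⟨smooth, compact⟩
  simp only [smul_eq_mul, mul_comm (ψ _), ← heq ψ hψ, h.integral_inner_gradient hψ]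
  exact integral_neg_add_add_mul (hψ.integrable_mul hL) (hψ.integrable_mul hu)
    (hψ.integrable_mul hg)

lemma gradient_powKernel (s : ℝ) {ε : ℝ} (hε : 0 < ε) (z : Space N) :
    ∇ (powKernel s ε) z = (-s * powKernel (s + 2) ε z) • z := by
  refine ext_inner_right ℝ fun v => ?_
  rw [inner_gradient_left, fderiv_powKernel s hε, real_inner_smul_left]

lemma HasWeakGradient.mul_smooth {f η : Space N → ℝ} {Γ : Space N → Space N}
    (h : HasWeakGradient f Γ) (hη : ContDiff ℝ ∞ η) :
    HasWeakGradient (fun x => η x * f x) fun x => η x • Γ x + f x • ∇ η x := by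
  have continuous_gradient : Continuous (∇ η) :=
    (InnerProductSpace.toDual ℝ (Space N)).symm.continuous.comp (hη.continuous_fderiv (by simp))
  refine hasWeakGradient_of_hasWeakDeriv (h.locInt.continuous_mul hη.continuous)
    ((h.locInt_grad.continuous_smul hη.continuous).add
      (h.locInt.smul_continuous continuous_gradient)) fun i =>
    ((h.hasWeakDeriv_coord i).mul_smooth hη).congr_right (Eventually.of_forall fun x => ?_)
  change η x * Γ x i + fderiv ℝ η x (EuclideanSpace.basisFun (Fin N) ℝ i) * f x
    = (η x • Γ x + f x • ∇ η x) i
  rw [← inner_gradient_left, EuclideanSpace.inner_basisFun_real,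
    PiLp.add_apply, PiLp.smul_apply, PiLp.smul_apply, smul_eq_mul, smul_eq_mul, mul_comm (f x)]

lemma locallyIntegrable_of_mul_of_le {f φ : Space N → ℝ} (mf : AEStronglyMeasurable f)
    (hφ : ∀ R : ℝ, ∃ δ : ℝ, 0 < δ ∧ ∀ᵐ x, ‖x‖ ≤ R → δ ≤ φ x)
    (hφf : LocallyIntegrable fun x => φ x * f x) : LocallyIntegrable f := by
  refine locallyIntegrable_iff.2 fun Q hQ => ?_
  obtain ⟨R, hR⟩ := hQ.isBounded.subset_closedBall (0 : Space N)
  obtain ⟨δ, hδ, hφδ⟩ := hφ R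
  refine ((hφf.integrableOn_isCompact hQ).norm.const_mul δ⁻¹).mono' mf.restrict ?_
  filter_upwards [ae_restrict_mem hQ.measurableSet, ae_restrict_of_ae hφδ] with x hxQ hx
  have le_phi := hx (mem_closedBall_zero_iff.1 (hR hxQ))
  rw [norm_mul, le_inv_mul_iff₀ hδ]
  gcongr
  exact le_phi.trans (le_abs_self _)

/-- The right-hand side `K |u|^q` of the Poisson equation, with `K = powKernel γ 1`. -/
def poissonSource (γ q : ℝ) (u : Space N → ℝ) (x : Space N) : ℝ := powKernel γ 1 x * |u x| ^ q

lemma poissonSource_nonneg (γ q : ℝ) (u : Space N → ℝ) (x : Space N) : 0 ≤ poissonSource γ q u x :=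
  mul_nonneg (powKernel_nonneg _ _ _) (by positivity)

lemma powKernel_neg_mul_cancel (γ t : ℝ) (x : Space N) :
    powKernel (-γ) 1 x * (powKernel γ 1 x * t) = t := by
  rw [← mul_assoc, powKernel_mul_powKernel _ _ one_pos]
  simp [powKernel]

lemma powKernel_two_mul_norm_sq_nonneg (x : Space N) : 0 ≤ powKernel 2 1 x * ‖x‖ ^ 2 :=
  mul_nonneg (powKernel_nonneg _ _ _) (sq_nonneg _)

lemma powKernel_two_mul_norm_sq_le_one (x : Space N) : powKernel 2 1 x * ‖x‖ ^ 2 ≤ 1 := by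
  simpa only [Real.rpow_two] using powKernel_one_mul_norm_rpow_le_one zero_le_two x

lemma integrable_mul_powKernel_two_mul_norm_sq {f : Space N → ℝ} (hf : Integrable f) :
    Integrable fun x => f x * (powKernel 2 1 x * ‖x‖ ^ 2) := by
  refine hf.mul_bdd (c := 1) (((contDiff_powKernel 2 one_pos).continuous.mul
    (continuous_norm.pow 2)).aestronglyMeasurable) (Eventually.of_forall fun x => ?_)
  rw [Real.norm_of_nonneg (powKernel_two_mul_norm_sq_nonneg x)]
  exact powKernel_two_mul_norm_sq_le_one x

section Coupling

variable {γ q c : ℝ} {u φ : Space N → ℝ} {G : Space N → Space N}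

lemma hasWeakGradient_poissonSource (hq : 1 < q) (hG : HasWeakGradient u G)
    (hS : LocallyIntegrable (poissonSource γ q u))
    (huG : LocallyIntegrable fun x => q * |u x| ^ (q - 2) * u x * ‖G x‖) :
    HasWeakGradient (poissonSource γ q u) fun x =>
      powKernel γ 1 x • (q * |u x| ^ (q - 2) * u x) • G x
        + |u x| ^ q • (-γ * powKernel (γ + 2) 1 x) • x := by
  have locInt_rpow : LocallyIntegrable fun x => |u x| ^ q := by
    simpa only [poissonSource, powKernel_neg_mul_cancel] using
      hS.continuous_mul (contDiff_powKernel (-γ) one_pos).continuous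
  simpa only [gradient_powKernel γ one_pos] using!
    (hG.abs_rpow hq locInt_rpow huG).mul_smooth (contDiff_powKernel γ one_pos)

lemma locallyIntegrable_rpow_mul_norm (hN : 3 ≤ N) (hc : 0 < c) (hG : HasWeakGradient u G)
    (hS : MemLp (poissonSource γ q u) (ENNReal.ofReal (2 * N / (N + 2))))
    (hSl : LocallyIntegrable (poissonSource γ q u)) (hne : ¬ poissonSource γ q u =ᵐ[volume] 0)
    (hφ : ∀ᵐ x, φ x = c * powPotential (N - 2) (poissonSource γ q u) x)
    (hg : LocallyIntegrable fun x => powKernel γ 1 x * φ x * |u x| ^ (q - 2) * u x * ‖G x‖) :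
    LocallyIntegrable fun x => q * |u x| ^ (q - 2) * u x * ‖G x‖ := by
  have cast_N : (3 : ℝ) ≤ N := by exact_mod_cast hN
  have mu := hG.locInt.aestronglyMeasurable
  refine locallyIntegrable_of_mul_of_le (φ := φ)
    ((((aestronglyMeasurable_abs_rpow mu _).const_mul q).mul mu).mul
      hG.locInt_grad.aestronglyMeasurable.norm) (fun R => ?_) ?_
  · obtain ⟨δ, hδ, hδ_le⟩ := exists_powPotential_lower_bound (by linarith) (by lia)
      (poissonSource_nonneg γ q u) hSl hne
      (ae_integrable_powKernel_mul two_pos (by linarith) hS) R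
    refine ⟨c * δ, by positivity, ?_⟩
    filter_upwards [hφ, hδ_le] with x hx hle hxR
    rw [hx]
    exact mul_le_mul_of_nonneg_left (hle hxR) hc.le
  · refine ((hg.continuous_mul (contDiff_powKernel (-γ) one_pos).continuous).smul q).congr
      (Eventually.of_forall fun x => ?_)
    simp only [mul_assoc, powKernel_neg_mul_cancel, Pi.smul_apply, smul_eq_mul]
    ring

lemma tendsto_integral_mul_euler_of_eq_powPotential {β : ℝ} (hβ : 0 < β) (hβN : β < N) (hc : c ≠ 0)
    {S : Space N → ℝ} {Γ : Space N → Space N} (hS : ∀ x, 0 ≤ S x)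
    (hSp : MemLp S (ENNReal.ofReal (2 * N / (N + β)))) (hΓ : HasWeakGradient S Γ)
    (hφ : ∀ᵐ x, φ x = c * powPotential (N - β) S x)
    (hφΓ : ∀ n, Integrable fun x => φ x * (cutoff N n x * inner ℝ (Γ x) x)) :
    Tendsto (fun n => ∫ x, φ x * (cutoff N n x * inner ℝ (Γ x) x)) atTop
      (𝓝 (-((N + β) / 2) * ∫ x, φ x * S x)) := by
  have phi_mul (m : Space N → ℝ) :
      (fun x => φ x * m x) =ᵐ[volume] fun x => c * (powPotential (N - β) S x * m x) := by
    filter_upwards [hφ] with x hx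
    rw [hx, mul_assoc]
  have integrable_euler (n : ℕ) : Integrable (fun z : Space N × Space N =>
      powKernel (N - β) 0 (z.1 - z.2) * (S z.2 * (cutoff N n z.1 * inner ℝ (Γ z.1) z.1)))
      (volume.prod volume) := by
    refine integrable_powKernel_prod_of_powPotential hS hSp.1
      (m := fun x => cutoff N n x * inner ℝ (Γ x) x)
      ((isTest_cutoff n).continuous.aestronglyMeasurable.mul
        (hΓ.locInt_grad.aestronglyMeasurable.inner continuous_id.aestronglyMeasurable))
      (ae_integrable_powKernel_mul hβ hβN hSp) ?_
    simpa [hc] using ((hφΓ n).congr (phi_mul _)).const_mul c⁻¹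
  have cast_pos : (0 : ℝ) < N := hβ.trans hβN
  convert! (tendsto_integral_powPotential_mul_euler (by exact_mod_cast cast_pos) (by linarith) hΓ
    (integrable_powKernel_sub_mul hβ hβN hSp hSp) integrable_euler).const_mul c using 2
  · rw [← integral_const_mul, integral_congr_ae (phi_mul _)]
  · rw [integral_congr_ae (phi_mul S), integral_const_mul]
    ring

lemma tendsto_integral_coupling_mul_euler (hN : 3 ≤ N) (hq : 1 < q) (hc : 0 < c)
    (hG : HasWeakGradient u G)
    (hS : MemLp (poissonSource γ q u) (ENNReal.ofReal (2 * N / (N + 2))))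
    (hSl : LocallyIntegrable (poissonSource γ q u)) (hne : ¬ poissonSource γ q u =ᵐ[volume] 0)
    (hφ : ∀ᵐ x, φ x = c * powPotential (N - 2) (poissonSource γ q u) x)
    (hφS : Integrable fun x => φ x * poissonSource γ q u x)
    (hg : LocallyIntegrable fun x => powKernel γ 1 x * φ x * |u x| ^ (q - 2) * u x * ‖G x‖)
    (mg : AEStronglyMeasurable fun x => powKernel γ 1 x * φ x * |u x| ^ (q - 2) * u x) :
    Tendsto (fun n => ∫ x, powKernel γ 1 x * φ x * |u x| ^ (q - 2) * u x
        * (cutoff N n x * inner ℝ (G x) x)) atTop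
      (𝓝 (q⁻¹ * (-((N + 2) / 2) * (∫ x, φ x * poissonSource γ q u x)
        + γ * ∫ x, φ x * poissonSource γ q u x * (powKernel 2 1 x * ‖x‖ ^ 2)))) := by
  have cast_N : (3 : ℝ) ≤ N := by exact_mod_cast hN
  have source_gradient := hasWeakGradient_poissonSource hq hG hSl
    (locallyIntegrable_rpow_mul_norm hN hc hG hS hSl hne hφ hg)
  have integrable_weight := integrable_mul_powKernel_two_mul_norm_sq hφS
  have integrable_coupling (n : ℕ) : Integrable fun x =>
      powKernel γ 1 x * φ x * |u x| ^ (q - 2) * u x * (cutoff N n x * inner ℝ (G x) x) := by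
    simpa only [mul_assoc, mul_comm (cutoff N n _)] using (isTest_cutoff n).integrable_mul
      (locallyIntegrable_mul_inner mg hG.locInt_grad.aestronglyMeasurable hg)
  have integrable_weight_cutoff (n : ℕ) :=
    (isTest_cutoff n).integrable_mul integrable_weight.locallyIntegrable
  have integrand_eq (n : ℕ) (x : Space N) :
      φ x * (cutoff N n x * inner ℝ (powKernel γ 1 x • (q * |u x| ^ (q - 2) * u x) • G x
        + |u x| ^ q • (-γ * powKernel (γ + 2) 1 x) • x) x)
      = q * (powKernel γ 1 x * φ x * |u x| ^ (q - 2) * u x * (cutoff N n x * inner ℝ (G x) x))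
        - γ * (φ x * poissonSource γ q u x * (powKernel 2 1 x * ‖x‖ ^ 2) * cutoff N n x) := by
    simp only [poissonSource, inner_add_left, real_inner_smul_left, real_inner_self_eq_norm_sq,
      ← powKernel_mul_powKernel γ 2 one_pos]
    ring
  have euler_limit := tendsto_integral_mul_euler_of_eq_powPotential two_pos (by linarith) hc.ne'
    (poissonSource_nonneg γ q u) hS source_gradient hφ fun n => by
      simpa only [integrand_eq] using!
        ((integrable_coupling n).const_mul q).sub ((integrable_weight_cutoff n).const_mul γ)
  convert! (euler_limit.add
    ((tendsto_integral_mul_cutoff integrable_weight).const_mul γ)).const_mul q⁻¹ using 2 with n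
  simp only [integrand_eq]
  rw [integral_sub ((integrable_coupling n).const_mul q) ((integrable_weight_cutoff n).const_mul γ),
    integral_const_mul, integral_const_mul, sub_add_cancel, inv_mul_cancel_left₀ (by linarith)]

end Coupling

/-! ### The Pohozaev identity -/

/-- A regular solution of the system in strong form: `∇u = G`, the Hessian of `u` is `D`, the first
equation holds almost everywhere, and the second one is replaced by the Newton potential. The Riesz
kernel is `a |x|^(α-N)` and the fundamental solution of `-Δ` is `c |x|^(2-N)`; the values of `a` and
`c` do not matter. -/
structure IsStrongSolution (α p q γ a c : ℝ) (u φ : Space N → ℝ) (G : Space N → Space N)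
    (D : Fin N → Space N → Space N) : Prop where
  hasWeakHessian : HasWeakHessian u G D
  memLp : MemLp u 2
  memLp_critical : MemLp u (ENNReal.ofReal (p * (2 * N / (N + α))))
  memLp_grad : MemLp G 2
  memLpLoc_grad : MemLpLoc G (ENNReal.ofReal (p * (2 * N / (N + α))))
  memLp_source : MemLp (poissonSource γ q u) (ENNReal.ofReal (2 * N / (N + 2)))
  locallyIntegrable_source : LocallyIntegrable (poissonSource γ q u)
  locallyIntegrable_coupling :
    LocallyIntegrable fun x => powKernel γ 1 x * φ x * |u x| ^ (q - 2) * u x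
  ae_eq_potential : ∀ᵐ x, φ x = c * powPotential (N - 2) (poissonSource γ q u) x
  ae_equation : ∀ᵐ x, -hessianTrace D x + u x + powKernel γ 1 x * φ x * |u x| ^ (q - 2) * u x
    = a * (powPotential (N - α) (fun y => |u y| ^ p) x * (|u x| ^ (p - 2) * u x))

section WeakSolution

variable {α p q γ : ℝ} {u φ : Space N → ℝ}

lemma IsWeakSolution.exists_eq_powPotential (hs : IsWeakSolution α p q (powKernel γ 1) u φ)
    (hr : IsRegular α p q (powKernel γ 1) u φ) (hN : 3 ≤ N) :
    ∃ c : ℝ, 0 < c ∧ ∀ᵐ x, φ x = c * powPotential (N - 2) (poissonSource γ q u) x := by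
  obtain ⟨memLp_phi, H', hasWeakGradient', memLp_grad⟩ := hr.phi_H1
  obtain ⟨H, hasWeakGradient, integral_inner_gradient⟩ := hs.second_eq
  have poisson : IsPoissonSolution φ (poissonSource γ q u) H :=
    ⟨hasWeakGradient, integral_inner_gradient⟩
  exact poisson.exists_eq_powPotential hN memLp_phi
    (memLp_grad.ae_eq (hasWeakGradient'.ae_unique hasWeakGradient)) hr.source_Lp

lemma IsWeakSolution.exists_isStrongSolution (hs : IsWeakSolution α p q (powKernel γ 1) u φ)
    (hr : IsRegular α p q (powKernel γ 1) u φ) (hN : 3 ≤ N) :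
    ∃ a c : ℝ, 0 < c ∧ ∃ G D, IsStrongSolution α p q γ a c u φ G D := by
  obtain ⟨a, rieszPotential_eq⟩ := exists_rieszPotential_eq N α
  obtain ⟨c, hc, phi_eq⟩ := hs.exists_eq_powPotential hr hN
  obtain ⟨memLp_u, G₁, hG₁, memLp_G₁⟩ := hr.u_H1
  obtain ⟨G₂, hG₂, weak_equation⟩ := hs.first_eq
  obtain ⟨G, hG, memH1Loc_coord, memLpLoc_G⟩ := hr.grad_u
  choose _ D hD memLpLoc_D using memH1Loc_coord
  have memLp_G : MemLp G 2 := memLp_G₁.ae_eq (hG₁.ae_unique hG)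
  have exponent_eq : 2 * N * p / (N + α) = p * (2 * N / (N + α)) := by ring
  have hess : HasWeakHessian u G D := ⟨hG, hD, memLpLoc_of_memLp memLp_G, memLpLoc_D⟩
  refine ⟨a, c, hc, G, D, hess, memLp_u, exponent_eq ▸ hr.u_Lp, memLp_G, exponent_eq ▸ memLpLoc_G,
    hr.source_Lp, hs.locInt_source, hs.locInt_coupling, phi_eq, ?_⟩
  have equation := hess.ae_equation hs.locInt_coupling hs.locInt_choquard fun ψ hψ => by
    rw [← weak_equation ψ hψ]
    congr 2
    refine integral_congr_ae ?_
    filter_upwards [hG.ae_unique hG₂] with x hx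
    rw [hx]
  simpa only [rieszPotential_eq, mul_assoc] using equation

end WeakSolution

namespace IsStrongSolution

variable {α p q γ a c : ℝ} {u φ : Space N → ℝ} {G : Space N → Space N}
  {D : Fin N → Space N → Space N}

lemma integrable_mul_source (h : IsStrongSolution α p q γ a c u φ G D) (hN : 3 ≤ N) :
    Integrable fun x => φ x * poissonSource γ q u x := by
  have cast_N : (3 : ℝ) ≤ N := by exact_mod_cast hN
  refine ((integrable_powPotential_mul (integrable_powKernel_sub_mul two_pos (by linarith)
    h.memLp_source h.memLp_source)).const_mul c).congr ?_
  filter_upwards [h.ae_eq_potential] with x hx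
  rw [hx, mul_assoc]

lemma ae_mul_source_nonneg (h : IsStrongSolution α p q γ a c u φ G D) (hc : 0 < c) :
    ∀ᵐ x, 0 ≤ φ x * poissonSource γ q u x := by
  filter_upwards [h.ae_eq_potential] with x hx
  have source_nonneg := poissonSource_nonneg γ q u
  rw [hx]
  exact mul_nonneg (mul_nonneg hc.le (powPotential_nonneg source_nonneg x)) (source_nonneg x)

lemma locallyIntegrable_coupling_mul_norm (h : IsStrongSolution α p q γ a c u φ G D)
    (hα₀ : 0 < α) (hαN : α < N) (hp : 1 < p) :
    LocallyIntegrable fun x => powKernel γ 1 x * φ x * |u x| ^ (q - 2) * u x * ‖G x‖ := by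
  have memLpLoc_norm : MemLpLoc (fun x => ‖G x‖) 2 := memLpLoc_of_memLp h.memLp_grad.norm
  have laplacian := h.hasWeakHessian.memLpLoc_hessianTrace.locallyIntegrable_mul memLpLoc_norm
  have linear := (memLpLoc_of_memLp h.memLp).locallyIntegrable_mul memLpLoc_norm
  have choquard :=
    (locallyIntegrable_choquard_mul_norm hα₀ hαN hp h.memLp_critical h.memLpLoc_grad).smul a
  refine ((choquard.add laplacian).sub linear).congr ?_
  filter_upwards [h.ae_equation] with x hx
  simp only [Pi.add_apply, Pi.sub_apply, Pi.smul_apply, smul_eq_mul]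
  linear_combination -‖G x‖ * hx

lemma integral_equation_mul (h : IsStrongSolution α p q γ a c u φ G D) {w : Space N → ℝ}
    (hL : Integrable fun x => hessianTrace D x * w x) (hu : Integrable fun x => u x * w x)
    (hg : Integrable fun x => powKernel γ 1 x * φ x * |u x| ^ (q - 2) * u x * w x) :
    -(∫ x, hessianTrace D x * w x) + (∫ x, u x * w x)
        + (∫ x, powKernel γ 1 x * φ x * |u x| ^ (q - 2) * u x * w x)
      = a * ∫ x, powPotential (N - α) (fun y => |u y| ^ p) x * (|u x| ^ (p - 2) * u x * w x) := by
  rw [← integral_neg_add_add_mul hL hu hg, ← integral_const_mul]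
  refine integral_congr_ae ?_
  filter_upwards [h.ae_equation] with x hx
  linear_combination w x * hx

lemma energy_identity (h : IsStrongSolution α p q γ a c u φ G D) (hN : 3 ≤ N) (hα₀ : 0 < α)
    (hαN : α < N) (hp : 1 < p) (hq : 1 < q) :
    (∫ x, ‖G x‖ ^ 2) + (∫ x, u x ^ 2) + (∫ x, φ x * poissonSource γ q u x)
      = a * ∫ x, powPotential (N - α) (fun y => |u y| ^ p) x * |u x| ^ p := by
  have integrable_source := h.integrable_mul_source hN
  have memLpLoc_u := memLpLoc_of_memLp h.memLp
  have coupling_eq (x : Space N) :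
      powKernel γ 1 x * φ x * |u x| ^ (q - 2) * u x * u x = φ x * poissonSource γ q u x := by
    rw [poissonSource, ← abs_rpow_sub_two_mul_mul_self hq]
    ring
  have truncated (n : ℕ) := h.integral_equation_mul (w := fun x => u x * cutoff N n x)
    (by
      simpa only [mul_assoc] using (isTest_cutoff n).integrable_mul
        (h.hasWeakHessian.memLpLoc_hessianTrace.locallyIntegrable_mul memLpLoc_u))
    (by
      simpa only [mul_assoc] using (isTest_cutoff n).integrable_mul
        (memLpLoc_u.locallyIntegrable_mul memLpLoc_u))
    (by
      simpa only [← coupling_eq, mul_assoc] using (isTest_cutoff n).integrable_mul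
        integrable_source.locallyIntegrable)
  simp only [← mul_assoc, coupling_eq, ← pow_two] at truncated
  have left_limit := ((h.hasWeakHessian.tendsto_integral_hessianTrace_mul_self h.memLp
    h.memLp_grad).neg.add (tendsto_integral_mul_cutoff h.memLp.integrable_sq)).add
    (tendsto_integral_mul_cutoff integrable_source)
  have right_limit := (tendsto_integral_mul_cutoff
    (integrable_choquard_energy hα₀ hαN (by linarith) h.memLp_critical)).const_mul a
  rw [neg_neg] at left_limit
  refine tendsto_nhds_unique (left_limit.congr truncated) ?_
  simpa only [← abs_rpow_sub_two_mul_mul_self hp, ← mul_assoc] using right_limit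

lemma dilation_identity (h : IsStrongSolution α p q γ a c u φ G D) (hN : 3 ≤ N) (hα₀ : 0 < α)
    (hαN : α < N) (hp : 1 < p) (hq : 1 < q) (hc : 0 < c)
    (hne : ¬ poissonSource γ q u =ᵐ[volume] 0) :
    -((N / 2 - 1) * ∫ x, ‖G x‖ ^ 2) + -(N / 2) * (∫ x, u x ^ 2)
        + q⁻¹ * (-((N + 2) / 2) * (∫ x, φ x * poissonSource γ q u x)
          + γ * ∫ x, φ x * poissonSource γ q u x * (powKernel 2 1 x * ‖x‖ ^ 2))
      = a * (-((N + α) / (2 * p)) *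
        ∫ x, powPotential (N - α) (fun y => |u y| ^ p) x * |u x| ^ p) := by
  have hess := h.hasWeakHessian
  have measurable_G := h.memLp_grad.1
  have memLpLoc_norm : MemLpLoc (fun x => ‖G x‖) 2 := memLpLoc_of_memLp h.memLp_grad.norm
  have coupling := h.locallyIntegrable_coupling_mul_norm hα₀ hαN hp
  have measurable_coupling := h.locallyIntegrable_coupling.aestronglyMeasurable
  have integrable_euler (n : ℕ) {f : Space N → ℝ} (mf : AEStronglyMeasurable f)
      (hf : LocallyIntegrable fun x => f x * ‖G x‖) :
      Integrable fun x => f x * (cutoff N n x * inner ℝ (G x) x) := by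
    simpa only [mul_assoc, mul_comm (cutoff N n _)] using
      (isTest_cutoff n).integrable_mul (locallyIntegrable_mul_inner mf measurable_G hf)
  have truncated (n : ℕ) := h.integral_equation_mul
    (integrable_euler n hess.locallyIntegrable_hessianTrace.aestronglyMeasurable
      (hess.memLpLoc_hessianTrace.locallyIntegrable_mul memLpLoc_norm))
    (integrable_euler n h.memLp.1 ((memLpLoc_of_memLp h.memLp).locallyIntegrable_mul memLpLoc_norm))
    (integrable_euler n measurable_coupling coupling)
  have left_limit := ((hess.tendsto_integral_hessianTrace_mul_euler h.memLp_grad).neg.add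
    (hess.hasWeakGradient.tendsto_integral_mul_euler h.memLp h.memLp_grad)).add
    (tendsto_integral_coupling_mul_euler hN hq hc hess.hasWeakGradient h.memLp_source
      h.locallyIntegrable_source hne h.ae_eq_potential (h.integrable_mul_source hN) coupling
      measurable_coupling)
  have right_limit := (tendsto_integral_choquard_mul_euler hα₀ hαN hp h.memLp_critical
    hess.hasWeakGradient h.memLpLoc_grad).const_mul a
  exact tendsto_nhds_unique (left_limit.congr truncated) right_limit

lemma pohozaev_identity (h : IsStrongSolution α p q γ a c u φ G D) (hN : 3 ≤ N) (hα₀ : 0 < α)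
    (hαN : α < N) (hp : 1 < p) (hq : 1 < q) (hc : 0 < c)
    (hne : ¬ poissonSource γ q u =ᵐ[volume] 0) :
    (2 - N + (N + α) / p) * (∫ x, ‖G x‖ ^ 2) + ((N + α) / p - N) * (∫ x, u x ^ 2)
      + ((N + α) / p - (N + 2) / q) * (∫ x, φ x * poissonSource γ q u x)
      + 2 * γ / q * (∫ x, φ x * poissonSource γ q u x * (powKernel 2 1 x * ‖x‖ ^ 2)) = 0 := by
  linear_combination (N + α) / p * h.energy_identity hN hα₀ hαN hp hq
    + 2 * h.dilation_identity hN hα₀ hαN hp hq hc hne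

end IsStrongSolution

/-! ### Vanishing of regular solutions -/

lemma ae_eq_zero_of_integral_sq_nonpos {v : Space N → ℝ} (hv : MemLp v 2)
    (h : ∫ x, v x ^ 2 ≤ 0) : v =ᵐ[volume] 0 := by
  have sq_ae_eq_zero := (integral_eq_zero_iff_of_nonneg (fun x => sq_nonneg (v x))
    hv.integrable_sq).1 (h.antisymm (integral_nonneg fun x => sq_nonneg (v x)))
  filter_upwards [sq_ae_eq_zero] with x hx
  exact pow_eq_zero_iff two_ne_zero |>.1 hx

lemma HasWeakGradient.ae_eq_zero_of_integral_norm_sq {u : Space N → ℝ} {G : Space N → Space N}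
    (h : HasWeakGradient u G) (hN : 0 < N) (hu : MemLp u 2) (hG : MemLp G 2)
    (hG₀ : ∫ x, ‖G x‖ ^ 2 = 0) : u =ᵐ[volume] 0 := by
  have grad_ae_eq_zero :=
    (integral_eq_zero_iff_of_nonneg (fun x => sq_nonneg ‖G x‖) (integrable_norm_sq hG)).1 hG₀
  have integral_euler (n : ℕ) : ∫ x, u x * (cutoff N n x * inner ℝ (G x) x) = 0 := by
    refine integral_eq_zero_of_ae ?_
    filter_upwards [grad_ae_eq_zero] with x hx
    have grad_eq_zero : G x = 0 := by simpa using hx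
    simp [grad_eq_zero]
  have euler_limit := h.tendsto_integral_mul_euler hu hG
  simp only [integral_euler, tendsto_const_nhds_iff] at euler_limit
  have cast_pos : (0 : ℝ) < N := by exact_mod_cast hN
  exact ae_eq_zero_of_integral_sq_nonpos hu (by nlinarith)

section Source

variable {γ q : ℝ} {u : Space N → ℝ}

lemma ae_eq_zero_of_poissonSource (hq : q ≠ 0) (h : poissonSource γ q u =ᵐ[volume] 0) :
    u =ᵐ[volume] 0 := by
  filter_upwards [h] with x hx
  have rpow_eq_zero := (mul_eq_zero.1 hx).resolve_left (powKernel_pos γ one_pos x).ne'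
  exact abs_eq_zero.1 ((Real.rpow_eq_zero (abs_nonneg _) hq).1 rpow_eq_zero)

lemma powPotential_poissonSource_eq_zero (hq : q ≠ 0) (h : u =ᵐ[volume] 0) (s : ℝ) (x : Space N) :
    powPotential s (poissonSource γ q u) x = 0 := by
  refine integral_eq_zero_of_ae ?_
  filter_upwards [h] with y hy
  simp [poissonSource, hy, Real.zero_rpow hq]

end Source

namespace IsStrongSolution

variable {α p q γ a c : ℝ} {u φ : Space N → ℝ} {G : Space N → Space N}
  {D : Fin N → Space N → Space N}

lemma integral_weighted_source_nonneg (h : IsStrongSolution α p q γ a c u φ G D) (hc : 0 < c) :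
    0 ≤ ∫ x, φ x * poissonSource γ q u x * (powKernel 2 1 x * ‖x‖ ^ 2) := by
  refine integral_nonneg_of_ae ?_
  filter_upwards [h.ae_mul_source_nonneg hc] with x hx
  exact mul_nonneg hx (powKernel_two_mul_norm_sq_nonneg x)

lemma integral_weighted_source_le (h : IsStrongSolution α p q γ a c u φ G D) (hN : 3 ≤ N)
    (hc : 0 < c) :
    ∫ x, φ x * poissonSource γ q u x * (powKernel 2 1 x * ‖x‖ ^ 2)
      ≤ ∫ x, φ x * poissonSource γ q u x := by
  refine integral_mono_of_nonneg ?_ (h.integrable_mul_source hN) ?_ <;>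
    filter_upwards [h.ae_mul_source_nonneg hc] with x hx
  · exact mul_nonneg hx (powKernel_two_mul_norm_sq_nonneg x)
  · exact mul_le_of_le_one_right hx (powKernel_two_mul_norm_sq_le_one x)

lemma ae_eq_zero_of_supercritical (h : IsStrongSolution α p q γ a c u φ G D) (hN : 3 ≤ N)
    (hα₀ : 0 < α) (hαN : α < N) (hp : 1 < p) (hq : 1 < q) (hc : 0 < c)
    (hγ : 0 ≤ γ) (hpN : (N + α) / p ≤ N - 2) (hpq : (N + α) / p ≤ (N + 2 - 2 * γ) / q) :
    u =ᵐ[volume] 0 := by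
  by_contra hu
  have identity := h.pohozaev_identity hN hα₀ hαN hp hq hc
    fun hS => hu (ae_eq_zero_of_poissonSource (by linarith) hS)
  have weighted_nonneg := h.integral_weighted_source_nonneg hc
  have weighted_le := h.integral_weighted_source_le hN hc
  set C := ∫ x, φ x * poissonSource γ q u x
  set E := ∫ x, φ x * poissonSource γ q u x * (powKernel 2 1 x * ‖x‖ ^ 2)
  have grad_term : (2 - N + (N + α) / p) * ∫ x, ‖G x‖ ^ 2 ≤ 0 :=
    mul_nonpos_of_nonpos_of_nonneg (by linarith) (integral_nonneg fun x => sq_nonneg _)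
  have source_term : ((N + α) / p - (N + 2) / q) * C + 2 * γ / q * E ≤ 0 := calc
    _ ≤ ((N + α) / p - (N + 2) / q) * C + 2 * γ / q * C := by gcongr
    _ = ((N + α) / p - (N + 2 - 2 * γ) / q) * C := by ring
    _ ≤ 0 := mul_nonpos_of_nonpos_of_nonneg (by linarith) (weighted_nonneg.trans weighted_le)
  exact hu (ae_eq_zero_of_integral_sq_nonpos h.memLp (by nlinarith))

lemma ae_eq_zero_of_subcritical (h : IsStrongSolution α p q γ a c u φ G D) (hN : 3 ≤ N)
    (hα₀ : 0 < α) (hαN : α < N) (hp : 1 < p) (hq : 1 < q) (hc : 0 < c)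
    (hγ : γ ≤ 0) (hpN : N ≤ (N + α) / p) (hpq : (N + 2 - 2 * γ) / q ≤ (N + α) / p) :
    u =ᵐ[volume] 0 := by
  by_contra hu
  have identity := h.pohozaev_identity hN hα₀ hαN hp hq hc
    fun hS => hu (ae_eq_zero_of_poissonSource (by linarith) hS)
  have weighted_nonneg := h.integral_weighted_source_nonneg hc
  have weighted_le := h.integral_weighted_source_le hN hc
  set C := ∫ x, φ x * poissonSource γ q u x
  set E := ∫ x, φ x * poissonSource γ q u x * (powKernel 2 1 x * ‖x‖ ^ 2)
  have mass_term : 0 ≤ ((N + α) / p - N) * ∫ x, u x ^ 2 :=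
    mul_nonneg (by linarith) (integral_nonneg fun x => sq_nonneg _)
  have source_term : 0 ≤ ((N + α) / p - (N + 2) / q) * C + 2 * γ / q * E := calc
    0 ≤ ((N + α) / p - (N + 2 - 2 * γ) / q) * C :=
      mul_nonneg (by linarith) (weighted_nonneg.trans weighted_le)
    _ = ((N + α) / p - (N + 2) / q) * C + 2 * γ / q * C := by ring
    _ ≤ ((N + α) / p - (N + 2) / q) * C + 2 * γ / q * E := by
      have : 2 * γ / q ≤ 0 := div_nonpos_of_nonpos_of_nonneg (by linarith) (by linarith)
      linarith [mul_le_mul_of_nonpos_left weighted_le this]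
  have grad_nonneg : 0 ≤ ∫ x, ‖G x‖ ^ 2 := integral_nonneg fun x => sq_nonneg _
  exact hu (h.hasWeakHessian.hasWeakGradient.ae_eq_zero_of_integral_norm_sq (by lia) h.memLp
    h.memLp_grad (by nlinarith))

end IsStrongSolution

theorem IsWeakSolution.ae_eq_zero {α p q γ : ℝ} {u φ : Space N → ℝ}
    (hs : IsWeakSolution α p q (powKernel γ 1) u φ) (hr : IsRegular α p q (powKernel γ 1) u φ)
    (hN : 3 ≤ N) (hα₀ : 0 < α) (hαN : α < N) (hp : 1 < p) (hq : 1 < q)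
    (h : (0 ≤ γ ∧ (N + α) / (N - 2) ≤ p ∧ (N + α) / p ≤ (N + 2 - 2 * γ) / q) ∨
      (γ ≤ 0 ∧ p ≤ (N + α) / N ∧ (N + 2 - 2 * γ) / q ≤ (N + α) / p)) :
    u =ᵐ[volume] 0 ∧ φ =ᵐ[volume] 0 := by
  have cast_N : (3 : ℝ) ≤ N := by exact_mod_cast hN
  obtain ⟨a, c, hc, G, D, strong⟩ := hs.exists_isStrongSolution hr hN
  have hu : u =ᵐ[volume] 0 := by
    rcases h with ⟨hγ, hpN, hpq⟩ | ⟨hγ, hpN, hpq⟩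
    · exact strong.ae_eq_zero_of_supercritical hN hα₀ hαN hp hq hc hγ
        ((div_le_comm₀ (by linarith) (by linarith)).1 hpN) hpq
    · exact strong.ae_eq_zero_of_subcritical hN hα₀ hαN hp hq hc hγ
        ((le_div_comm₀ (by linarith) (by linarith)).1 hpN) hpq
  refine ⟨hu, ?_⟩
  filter_upwards [strong.ae_eq_potential] with x hx
  rw [hx, powPotential_poissonSource_eq_zero (by linarith) hu, mul_zero, Pi.zero_apply]

/-! ### The trivial solution -/

lemma hasWeakGradient_zero {u : Space N → ℝ} (hu : u =ᵐ[volume] 0) : HasWeakGradient u 0 := by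
  refine ⟨locallyIntegrable_zero.congr hu.symm, locallyIntegrable_zero, fun ψ _ => ?_⟩
  rw [integral_eq_zero_of_ae]
  · simp
  · filter_upwards [hu] with x hx
    simp [hx]

section Trivial

variable {α p q : ℝ} {K u φ : Space N → ℝ}

lemma isWeakSolution_of_ae_eq_zero (hp : p ≠ 0) (hq : q ≠ 0) (hu : u =ᵐ[volume] 0)
    (hφ : φ =ᵐ[volume] 0) : IsWeakSolution α p q K u φ := by
  have choquard_eq_zero :
      (fun x => rieszPotential α (fun y => |u y| ^ p) x * |u x| ^ (p - 2) * u x) =ᵐ[volume] 0 := by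
    filter_upwards [hu] with x hx
    simp [hx]
  have coupling_eq_zero : (fun x => K x * φ x * |u x| ^ (q - 2) * u x) =ᵐ[volume] 0 := by
    filter_upwards [hu] with x hx
    simp [hx]
  have source_eq_zero : (fun x => K x * |u x| ^ q) =ᵐ[volume] 0 := by
    filter_upwards [hu] with x hx
    simp [hx, Real.zero_rpow hq]
  have integral_mul_eq_zero {f : Space N → ℝ} (hf : f =ᵐ[volume] 0) (ψ : Space N → ℝ) :
      ∫ x, f x * ψ x = 0 := by
    refine integral_eq_zero_of_ae ?_
    filter_upwards [hf] with x hx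
    simp [hx]
  refine ⟨Eventually.of_forall fun x => (integrable_zero _ _ _).congr ?_,
    locallyIntegrable_zero.congr choquard_eq_zero.symm,
    locallyIntegrable_zero.congr coupling_eq_zero.symm,
    locallyIntegrable_zero.congr source_eq_zero.symm,
    ⟨0, hasWeakGradient_zero hu, fun ψ _ => ?_⟩, ⟨0, hasWeakGradient_zero hφ, fun ψ _ => ?_⟩⟩
  · filter_upwards [hu] with y hy
    simp [hy, Real.zero_rpow hp]
  · simp [integral_mul_eq_zero hu, integral_mul_eq_zero choquard_eq_zero,
      integral_mul_eq_zero coupling_eq_zero]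
  · simp [integral_mul_eq_zero source_eq_zero]

lemma isRegular_of_ae_eq_zero (hq : q ≠ 0) (hu : u =ᵐ[volume] 0) (hφ : φ =ᵐ[volume] 0) :
    IsRegular α p q K u φ := by
  have memLp_of_eq_zero {f : Space N → ℝ} {r : ENNReal} (hf : f =ᵐ[volume] 0) : MemLp f r :=
    (memLp_congr_ae hf).2 MemLp.zero
  have source_eq_zero : (fun x => K x * |u x| ^ q) =ᵐ[volume] 0 := by
    filter_upwards [hu] with x hx
    simp [hx, Real.zero_rpow hq]
  exact
    { u_H1 := ⟨memLp_of_eq_zero hu, 0, hasWeakGradient_zero hu, MemLp.zero⟩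
      u_Lp := memLp_of_eq_zero hu
      phi_H1 := ⟨memLp_of_eq_zero hφ, 0, hasWeakGradient_zero hφ, MemLp.zero⟩
      source_Lp := memLp_of_eq_zero source_eq_zero
      grad_u := ⟨0, hasWeakGradient_zero hu, fun _ => ⟨fun _ _ => MemLp.zero, 0,
        hasWeakGradient_zero (ae_eq_refl _), fun _ _ => MemLp.zero⟩, fun _ _ => MemLp.zero⟩ }

end Trivial

end ChoquardPoisson

end

theorem corollary2p4 (N : ℕ) (hN : 3 ≤ N) (α p q γ : ℝ) (hα₀ : 0 < α) (hα₁ : α < N)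
    (hp : 1 < p) (hq : 1 < q)
    (h : ((0 ≤ γ ∧ γ < ((N : ℝ) + 2) / 2) ∧
            (((N : ℝ) + α) / ((N : ℝ) - 2) ≤ p ∧
              ((N : ℝ) + α) / p ≤ ((N : ℝ) + 2 - 2 * γ) / q)) ∨
         (γ ≤ 0 ∧
            (p ≤ ((N : ℝ) + α) / (N : ℝ) ∧
              ((N : ℝ) + 2 - 2 * γ) / q ≤ ((N : ℝ) + α) / p)))
    (u φ : EuclideanSpace ℝ (Fin N) → ℝ) :
    (ChoquardPoisson.IsWeakSolution α p q (ChoquardPoisson.weight γ) u φ ∧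
        ChoquardPoisson.IsRegular α p q (ChoquardPoisson.weight γ) u φ) ↔
      (u =ᵐ[MeasureTheory.volume] 0 ∧ φ =ᵐ[MeasureTheory.volume] 0) := by
  rw [ChoquardPoisson.weight_eq_powKernel]
  constructor
  · rintro ⟨hs, hr⟩
    exact hs.ae_eq_zero hr hN hα₀ hα₁ hp hq
      (h.imp_left fun ⟨⟨hγ, _⟩, exponents⟩ => ⟨hγ, exponents⟩)
  · rintro ⟨hu, hφ⟩
    exact ⟨ChoquardPoisson.isWeakSolution_of_ae_eq_zero (by linarith) (by linarith) hu hφ,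
      ChoquardPoisson.isRegular_of_ae_eq_zero (by linarith) hu hφ⟩
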